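/- **Conventions.** All graphs are finite and simple; $G$ has $n$ vertices, and complements are taken in $V(G)$. For $x\in V(G)$ and $Y\subseteq V(G)$, $d_Y(x)$ is the number of neighbours of $x$ in $Y$; for (possibly overlapping) sets $S,T$, $e(S,T)$ is the number of edges with one endpoint in $S$ and the other in $T$. $G$ is *3-connected* if $n>3$ and $G$ stays connected after deleting any at most two vertices. **Bipartite robust expander components.** Let $0<\rho\le\nu\le\tau<1$, let $A,B\subseteq V(G)$ be disjoint and $W=A\cup B$. Then $G[W]$ is a *bipartite $(\rho,\nu,\tau)$-robust expander component of $G$ with bipartition $A,B$* if $|A|,|B|\ge\sqrt\rho\,n$, $\ \big||A|-|B|\big|\le\rho n$, $\ e(A,\overline B)+e(B,\overline A)\le\rho n^2$, and every $S\subseteq A$ with $\tau|A|\le|S|\le(1-\tau)|A|$ satisfies $$\big|\{x\in B: d_S(x)\ge\nu|W|\}\big|\ge|S|+\nu|W|.$$ **Robust partitions (case $k=0$, $\ell=2$).** Let $G$ be $D$-regular. A partition $\mathcal V=\{W_1,W_2\}$ of $V(G)$, together with a partition $A_j,B_j$ of each $W_j$, is a *robust partition of $G$ with parameters $\rho,\nu,\tau,0,2$*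 if * for $j=1,2$, $G[W_j]$ is a bipartite $(\rho,\nu,\tau)$-robust expander component of $G$ with bipartition $A_j,B_j$; * $d_X(x)\ge d_{X'}(x)$ for all $X,X'\in\mathcal V$ and all $x\in X$; * for $j=1,2$, $d_{B_j}(u)\ge d_{A_j}(u)$ for all $u\in A_j$, and $d_{A_j}(v)\ge d_{B_j}(v)$ for all $v\in B_j$; * $4\le\lfloor(1+\rho^{1/3})n/D\rfloor$; * for every $X\in\mathcal V$, all but at most $\rho n$ vertices $x\in X$ satisfy $d_X(x)\ge D-\rho n$. **Tours.** A *path system* $\mathcal P$ in $G$ is a collection of pairwise vertex-disjoint paths of $G$, each with at least one edge; $V(\mathcal P)$ is the set of vertices of its paths, and its *endpoints* are the endpoints of its paths. The reduced multigraph $R_{\mathcal V}(\mathcal P)$ has vertex set $\mathcal V$ and, for every path of $\mathcal P$, a distinct edge joining the members of $\mathcal V$ that contain the two endpoints of that path (so loops and multiple edges may occur). An Euler tour of a multigraph is a closed walk that uses each edge exactly once. A path system $\mathcal P$ is a *$\mathcal V$-tour with parameter $\gamma$* if * $R_{\mathcal V}(\mathcal P)$ has an Euler tour; * $|V(\mathcal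 P)\cap X|\le\gamma n$ for all $X\in\mathcal V$; * for $j=1,2$, $|A_j\setminus V(\mathcal P)|=|B_j\setminus V(\mathcal P)|$, and $A_j$ and $B_j$ contain the same, positive number of endpoints of $\mathcal P$. **Lemma 6.1.** There is a non-decreasing function $f:(0,1]\to(0,1]$ such that the following holds for all positive integers $n,D$ and all positive reals $\rho,\nu,\tau,\alpha$ with $\alpha<1$, $\tau\le f(\alpha)$, $\nu\le f(\tau)$, $\rho\le f(\nu)$, $1/n\le f(\rho)$ and $D\ge\alpha n$ (in short, $0<1/n\ll\rho\ll\nu\ll\tau\ll\alpha<1$). If $G$ is a 3-connected $D$-regular graph on $n$ vertices and $\mathcal V=\{W_1,W_2\}$, with partitions $A_j,B_j$ of $W_j$ for $j=1,2$, is a robust partition of $G$ with parameters $\rho,\nu,\tau,0,2$, then $G$ contains a $\mathcal V$-tour with parameter $\rho^{1/3}$. -/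

import Mathlib

open Finset

namespace RobustPartition

/-- `G` is `k`-connected: it has more than `k` vertices and stays connected after the removal of
any set of fewer than `k` vertices. -/
def IsKConnected {α : Type*} [Fintype α] (G : SimpleGraph α) (k : ℕ) : Prop :=
  k < Fintype.card α ∧
    ∀ S : Finset α, #S < k → (G.induce {x | x ∉ S}).Connected

open Classical in
/-- `d_Y(x)`: the number of neighbours of `x` in `Y`. -/
noncomputable def degIn {α : Type*} (G : SimpleGraph α) (Y : Finset α) (x : α) : ℕ :=
  #{y ∈ Y | G.Adj x y}

open Classical in
/-- `e(S, T)`: the number of edges with one endpoint in `S` and the other in `T`. The sets may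
overlap, and every edge is counted once. -/
noncomputable def edgesBetween {α : Type*} [Fintype α] (G : SimpleGraph α) (S T : Finset α) : ℕ :=
  #{e : Sym2 α | e ∈ G.edgeSet ∧ ∃ s ∈ S, ∃ t ∈ T, e = s(s, t)}

/-- The complement of `S` in the vertex set. -/
noncomputable def outside {α : Type*} [Fintype α] (S : Finset α) : Finset α :=
  open Classical in univ \ S

/-- The `ν`-robust neighbourhood of `S ⊆ U` in the induced graph `G[U]`: the vertices of `U` with
at least `ν |U|` neighbours in `S`. -/
noncomputable def robustNbhd {α : Type*} (G : SimpleGraph α) (ν : ℝ) (U S : Finset α) :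
    Finset α :=
  open Classical in {x ∈ U | ν * #U ≤ degIn G S x}

/-- `G[U]` is a robust `(ν, τ)`-expander. -/
def IsRobustExpander {α : Type*} (G : SimpleGraph α) (ν τ : ℝ) (U : Finset α) : Prop :=
  ∀ S ⊆ U, τ * #U ≤ #S → (#S : ℝ) ≤ (1 - τ) * #U →
    (#S : ℝ) + ν * #U ≤ #(robustNbhd G ν U S)

open Classical in
/-- `G[A ∪ B]` is a bipartite robust `(ν, τ)`-expander with (ordered) bipartition `A, B`. -/
def IsBipartiteRobustExpander {α : Type*} (G : SimpleGraph α) (ν τ : ℝ) (A B : Finset α) : Prop :=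
  Disjoint A B ∧
  ∀ S ⊆ A, τ * #A ≤ #S → (#S : ℝ) ≤ (1 - τ) * #A →
    (#S : ℝ) + ν * #(A ∪ B) ≤ #(robustNbhd G ν (A ∪ B) S ∩ B)

/-- `U` is a `ρ`-component of `G`. -/
def IsRhoComponent {α : Type*} [Fintype α] (G : SimpleGraph α) (ρ : ℝ) (U : Finset α) : Prop :=
  √ρ * Fintype.card α ≤ #U ∧
    (edgesBetween G U (outside U) : ℝ) ≤ ρ * (Fintype.card α : ℝ) ^ 2

/-- `G[A ∪ B]` is `ρ`-close to bipartite with bipartition `A, B`. -/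
structure IsCloseToBipartite {α : Type*} [Fintype α] (G : SimpleGraph α) (ρ : ℝ)
    (A B : Finset α) : Prop where
  disjoint : Disjoint A B
  card_left : √ρ * Fintype.card α ≤ #A
  card_right : √ρ * Fintype.card α ≤ #B
  card_sub_card : |(#A : ℝ) - #B| ≤ ρ * Fintype.card α
  edges : (edgesBetween G A (outside B) : ℝ) + edgesBetween G B (outside A) ≤
    ρ * (Fintype.card α : ℝ) ^ 2

/-- `G[U]` is a `(ρ, ν, τ)`-robust expander component of `G`. -/
def IsRobustExpanderComponent {α : Type*} [Fintype α] (G : SimpleGraph α) (ρ ν τ : ℝ)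
    (U : Finset α) : Prop :=
  IsRhoComponent G ρ U ∧ IsRobustExpander G ν τ U

/-- `G[A ∪ B]` is a bipartite `(ρ, ν, τ)`-robust expander component of `G` with bipartition
`A, B`. -/
def IsBipartiteRobustExpanderComponent {α : Type*} [Fintype α] (G : SimpleGraph α) (ρ ν τ : ℝ)
    (A B : Finset α) : Prop :=
  IsCloseToBipartite G ρ A B ∧ IsBipartiteRobustExpander G ν τ A B

open Classical in
/-- The underlying combinatorial data of a robust partition: a partition
`V 1, …, V k, W 1, …, W ℓ` of the vertex set together with a partition `A j, B j` of each
`W j = A j ∪ B j`. -/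
structure ClusterPartition (α : Type*) (k ℓ : ℕ) where
  V : Fin k → Finset α
  A : Fin ℓ → Finset α
  B : Fin ℓ → Finset α
  disjoint_bipartition : ∀ j, Disjoint (A j) (B j)
  disjoint_clusters : Pairwise fun X X' : Fin k ⊕ Fin ℓ =>
    Disjoint (Sum.elim V (fun j => A j ∪ B j) X) (Sum.elim V (fun j => A j ∪ B j) X')
  cover : ∀ x : α, ∃ X : Fin k ⊕ Fin ℓ, x ∈ Sum.elim V (fun j => A j ∪ B j) X

open Classical in
/-- The members `V i` and `W j = A j ∪ B j` of the partition. -/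
noncomputable def ClusterPartition.cluster {α : Type*} {k ℓ : ℕ} (𝒱 : ClusterPartition α k ℓ) :
    Fin k ⊕ Fin ℓ → Finset α :=
  Sum.elim 𝒱.V (fun j => 𝒱.A j ∪ 𝒱.B j)

open Classical in
/-- `𝒱`, with the bipartitions `A j, B j` of its bipartite members, is a robust partition of the
`D`-regular graph `G` with parameters `ρ, ν, τ, k, ℓ`. -/
structure IsRobustPartition {α : Type*} [Fintype α] {k ℓ : ℕ} (G : SimpleGraph α) (D : ℕ)
    (ρ ν τ : ℝ) (𝒱 : ClusterPartition α k ℓ) : Prop where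
  rho_pos : 0 < ρ
  rho_le : ρ ≤ ν
  nu_le : ν ≤ τ
  tau_lt : τ < 1
  expander : ∀ i, IsRobustExpanderComponent G ρ ν τ (𝒱.V i)
  bipartite : ∀ j, IsBipartiteRobustExpanderComponent G ρ ν τ (𝒱.A j) (𝒱.B j)
  deg_cluster : ∀ X X' : Fin k ⊕ Fin ℓ, ∀ x ∈ 𝒱.cluster X,
    degIn G (𝒱.cluster X') x ≤ degIn G (𝒱.cluster X) x
  deg_left : ∀ j, ∀ u ∈ 𝒱.A j, degIn G (𝒱.A j) u ≤ degIn G (𝒱.B j) u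
  deg_right : ∀ j, ∀ v ∈ 𝒱.B j, degIn G (𝒱.B j) v ≤ degIn G (𝒱.A j) v
  number : k + 2 * ℓ ≤ ⌊(1 + ρ ^ (1 / 3 : ℝ)) * Fintype.card α / D⌋₊
  deg_most : ∀ X, (#{x ∈ 𝒱.cluster X |
      ¬ ((D : ℝ) - ρ * Fintype.card α ≤ degIn G (𝒱.cluster X) x)} : ℝ) ≤ ρ * Fintype.card α

/-- A path system in `G`: a finite collection of pairwise vertex-disjoint paths of `G`, each with
at least one edge. (The choice which endpoint of a path comes first is immaterial.) -/
structure PathSystem {α : Type*} (G : SimpleGraph α) where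
  size : ℕ
  fst : Fin size → α
  snd : Fin size → α
  walk : ∀ i, G.Walk (fst i) (snd i)
  isPath : ∀ i, (walk i).IsPath
  nontrivial : ∀ i, 0 < (walk i).length
  disjoint : Pairwise fun i j => (walk i).support.Disjoint (walk j).support

open Classical in
/-- The vertex set of a path system. -/
noncomputable def PathSystem.verts {α : Type*} [Fintype α] {G : SimpleGraph α}
    (P : PathSystem G) : Finset α :=
  {x | ∃ i, x ∈ (P.walk i).support}

open Classical in
/-- The set of endpoints of the paths of a path system. -/
noncomputable def PathSystem.endpoints {α : Type*} [Fintype α] {G : SimpleGraph α}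
    (P : PathSystem G) : Finset α :=
  {x | ∃ i, x = P.fst i ∨ x = P.snd i}

theorem ClusterPartition.cluster_unique {α : Type*} {k ℓ : ℕ} (𝒱 : ClusterPartition α k ℓ)
    {x : α} {X X' : Fin k ⊕ Fin ℓ} (h : x ∈ 𝒱.cluster X) (h' : x ∈ 𝒱.cluster X') : X = X' := by
  by_contra hne
  exact Finset.disjoint_left.1 (𝒱.disjoint_clusters hne) h h'

/-- The reduced multigraph of a path system `P` with respect to `𝒱`: its vertices are the members
of `𝒱`, and every path of `P` gives a distinct edge, between the members that contain the two
endpoints of the path. -/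
def reducedGraph {α : Type*} {k ℓ : ℕ} {G : SimpleGraph α} (𝒱 : ClusterPartition α k ℓ)
    (P : PathSystem G) : Graph (Fin k ⊕ Fin ℓ) (Fin P.size) where
  vertexSet := Set.univ
  IsLink i X X' := (P.fst i ∈ 𝒱.cluster X ∧ P.snd i ∈ 𝒱.cluster X') ∨
    (P.fst i ∈ 𝒱.cluster X' ∧ P.snd i ∈ 𝒱.cluster X)
  isLink_symm _ _ := ⟨fun _ _ h => h.symm⟩
  eq_or_eq_of_isLink_of_isLink := by
    rintro i X Y Z W (⟨h1, h2⟩ | ⟨h1, h2⟩) (⟨h3, h4⟩ | ⟨h3, h4⟩)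
    · exact Or.inl (𝒱.cluster_unique h1 h3)
    · exact Or.inr (𝒱.cluster_unique h1 h3)
    · exact Or.inr (𝒱.cluster_unique h2 h4)
    · exact Or.inl (𝒱.cluster_unique h2 h4)
  left_mem_of_isLink _ _ _ _ := Set.mem_univ _

/-- The multigraph `R` has an Euler tour: a closed walk `x 0, e 0, x 1, …, e (m - 1), x m = x 0`
that uses each edge exactly once. -/
def HasEulerTour {α β : Type*} (R : Graph α β) : Prop :=
  ∃ (m : ℕ) (x : Fin (m + 1) → α) (e : Fin m → β),
    (∀ i, x i ∈ R.vertexSet) ∧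
    x 0 = x (Fin.last m) ∧
    (∀ i : Fin m, R.IsLink (e i) (x i.castSucc) (x i.succ)) ∧
    Function.Injective e ∧ Set.range e = R.edgeSet

open Classical in
/-- The path system `P` is a `𝒱`-tour with parameter `γ`. -/
structure IsTour {α : Type*} [Fintype α] {k ℓ : ℕ} {G : SimpleGraph α}
    (𝒱 : ClusterPartition α k ℓ) (P : PathSystem G) (γ : ℝ) : Prop where
  euler : HasEulerTour (reducedGraph 𝒱 P)
  small : ∀ X, (#(P.verts ∩ 𝒱.cluster X) : ℝ) ≤ γ * Fintype.card α
  balanced : ∀ j, #(𝒱.A j \ P.verts) = #(𝒱.B j \ P.verts)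
  endpoints_eq : ∀ j, #(𝒱.A j ∩ P.endpoints) = #(𝒱.B j ∩ P.endpoints)
  endpoints_pos : ∀ j, 0 < #(𝒱.A j ∩ P.endpoints)

end RobustPartition

/-! For a path system `P`, `P.weight A B` is the sum of the `P`-degrees over `A` minus that over
`B`. If the endpoints are balanced (`surplus` zero), then `A` and `B` have equally many uncovered
vertices exactly when the weight is 2(|A| - |B|). An edge between `A` and `B` contributes nothing to
the weight. So it suffices to find a small path system with the right weight in both parts W₁, W₂
and with at least one path between them: lengthening paths by edges between Aⱼ and Bⱼ then balances
the endpoints (`PathSystem.exists_balanced`). The reduced multigraph has two vertices; balanced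
endpoints make the number of paths between them even, and one such path makes it connected, which
gives the Euler tour.

Regularity provides the weights fractionally. Put Iⱼ = 2e(Aⱼ) - 2e(Bⱼ), P = e(A₁,A₂) - e(B₁,B₂), R =
e(A₁,B₂) - e(B₁,A₂). Counting degrees gives D(|A₁| - |B₁|) = I₁ + P + R and D(|A₂| - |B₂|) = I₂ + P
- R, so giving every edge the value 2/D yields the required weights. By symmetry P, R ≥ 0.
`exists_rounding` turns this into integers: y edges A₁A₂, z edges A₁B₂, and iⱼ edges inside Aⱼ (or
-iⱼ inside Bⱼ). Disjoint edges in these numbers exist because all relevant maximum degrees are at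
most D/2: the crossing ones by Hall's theorem (`exists_matching_of_sum_degIn`), the inner ones by
treating vertices of high and low degree separately (`Supply`). The union of the crossing and the
inner matching could contain cycles, so the inner edges are chosen with care
(`exists_pathSystem_of_supply`).

If y = z = 0, no path would cross. Then 3-connectivity supplies two disjoint crossing edges. They
can be chosen so that their weights cancel, or all crossing edges meet the same side and the weights
are offset by changing some iⱼ by one (`signedSupply_pred`). -/

namespace RobustPartition

/-! ### Path systems, their extension by a vertex or an edge, and linear forests. -/

/-- A path of `G` with at least one edge. -/
structure Segment {α : Type*} (G : SimpleGraph α) where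
  fst : α
  snd : α
  walk : G.Walk fst snd
  isPath : walk.IsPath
  nontrivial : 0 < walk.length

variable {α : Type*} {G : SimpleGraph α}

/-- The `i`-th path of a path system. -/
def PathSystem.segment (P : PathSystem G) (i : Fin P.size) : Segment G :=
  ⟨P.fst i, P.snd i, P.walk i, P.isPath i, P.nontrivial i⟩

/-- The path system formed by a disjoint family of paths. -/
def PathSystem.ofSegments {m : ℕ} (s : Fin m → Segment G)
    (h : Pairwise fun i j => (s i).walk.support.Disjoint (s j).walk.support) : PathSystem G where
  size := m
  fst i := (s i).fst
  snd i := (s i).snd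
  walk i := (s i).walk
  isPath i := (s i).isPath
  nontrivial i := (s i).nontrivial
  disjoint := h

theorem PathSystem.mem_verts [Fintype α] {P : PathSystem G} {x : α} :
    x ∈ P.verts ↔ ∃ i, x ∈ (P.walk i).support := by
  simp [PathSystem.verts]

theorem PathSystem.mem_endpoints [Fintype α] {P : PathSystem G} {x : α} :
    x ∈ P.endpoints ↔ ∃ i, x = P.fst i ∨ x = P.snd i := by
  simp [PathSystem.endpoints]

theorem PathSystem.endpoints_subset_verts [Fintype α] (P : PathSystem G) :
    P.endpoints ⊆ P.verts := by
  intro x hx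
  obtain ⟨i, rfl | rfl⟩ := PathSystem.mem_endpoints.1 hx
  · exact PathSystem.mem_verts.2 ⟨i, SimpleGraph.Walk.start_mem_support _⟩
  · exact PathSystem.mem_verts.2 ⟨i, SimpleGraph.Walk.end_mem_support _⟩

theorem Segment.fst_ne_snd (s : Segment G) : s.fst ≠ s.snd := by
  obtain ⟨u, v, w, hw, hl⟩ := s
  rintro h
  dsimp only at h
  subst h
  have := SimpleGraph.Walk.length_eq_zero_iff.2 (SimpleGraph.Walk.isPath_iff_nil.1 hw)
  omega

theorem PathSystem.fst_ne_snd (P : PathSystem G) (i : Fin P.size) : P.fst i ≠ P.snd i :=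
  (P.segment i).fst_ne_snd

theorem PathSystem.index_unique (P : PathSystem G) {i j : Fin P.size} {x : α}
    (hi : x ∈ (P.walk i).support) (hj : x ∈ (P.walk j).support) : i = j := by
  by_contra hne
  exact P.disjoint hne hi hj

/-- The path obtained by attaching a new vertex `w` to an end `x` of a path. -/
theorem Segment.exists_extend (s : Segment G) {x w : α} (hx : x = s.fst ∨ x = s.snd)
    (hw : w ∉ s.walk.support) (hadj : G.Adj x w) :
    ∃ s' : Segment G, (∀ z, z ∈ s'.walk.support ↔ z = w ∨ z ∈ s.walk.support) ∧ s'.fst = w ∧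
      (x = s.fst ∧ s'.snd = s.snd ∨ x = s.snd ∧ s'.snd = s.fst) := by
  rcases hx with rfl | rfl
  · exact ⟨⟨w, s.snd, .cons hadj.symm s.walk, by simp [SimpleGraph.Walk.cons_isPath_iff, s.isPath, hw],
      by simp⟩, by simp, rfl, Or.inl ⟨rfl, rfl⟩⟩
  · exact ⟨⟨w, s.fst, .cons hadj.symm s.walk.reverse,
      by simp [SimpleGraph.Walk.cons_isPath_iff, s.isPath, hw], by simp⟩, by simp, rfl,
      Or.inr ⟨rfl, rfl⟩⟩

/-- Some path of the system has exactly one end in `C`. -/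
def PathSystem.Crosses (P : PathSystem G) (C : Finset α) : Prop :=
  ∃ i, ¬ (P.fst i ∈ C ↔ P.snd i ∈ C)

open Classical in
-- Only one path changes, and its end `x` moves to `w`; a set `C` that does not separate `x` from
-- `w` is therefore crossed as before. The clause on `r` will be used with `r` the reachability in a
-- graph containing the paths.
theorem PathSystem.exists_extend [Fintype α] (P : PathSystem G) {x w : α} (hx : x ∈ P.endpoints)
    (hw : w ∉ P.verts) (hadj : G.Adj x w) :
    ∃ P' : PathSystem G, P'.verts = insert w P.verts ∧
      P'.endpoints = insert w (P.endpoints.erase x) ∧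
      (∀ r : α → α → Prop, (∀ a b, r a b → r b a) → (∀ a b c, r a b → r b c → r a c) →
        r x w → (∀ i, ∀ u ∈ (P.walk i).support, ∀ v ∈ (P.walk i).support, r u v) →
        ∀ i, ∀ u ∈ (P'.walk i).support, ∀ v ∈ (P'.walk i).support, r u v) ∧
      ∀ C : Finset α, (x ∈ C ↔ w ∈ C) → P.Crosses C → P'.Crosses C := by
  obtain ⟨i, hi⟩ := PathSystem.mem_endpoints.1 hx
  have hwi : ∀ j, w ∉ (P.walk j).support := fun j hj => hw (PathSystem.mem_verts.2 ⟨j, hj⟩)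
  obtain ⟨s', hs', hfst, hsnd⟩ := (P.segment i).exists_extend hi (hwi i) hadj
  have hs'' : ∀ z, z ∈ s'.walk.support ↔ z = w ∨ z ∈ (P.walk i).support := hs'
  have hsnd' : (x = P.fst i ∧ s'.snd = P.snd i ∨ x = P.snd i ∧ s'.snd = P.fst i) := hsnd
  have hxi : x ∈ (P.walk i).support := by
    rcases hi with h | h
    · rw [h]; exact SimpleGraph.Walk.start_mem_support _
    · rw [h]; exact SimpleGraph.Walk.end_mem_support _
  have hne := P.fst_ne_snd i
  set g : Fin P.size → Segment G := Function.update P.segment i s' with hg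
  have gi : g i = s' := by simp [hg]
  have gj : ∀ j, j ≠ i → g j = P.segment j := fun j hj => by simp [hg, hj]
  have hsup : ∀ j z, z ∈ (g j).walk.support ↔ (j = i ∧ z = w) ∨ z ∈ (P.walk j).support := by
    intro j z
    by_cases hj : j = i
    · subst hj; rw [gi, hs'']; simp
    · rw [gj j hj]; simp [hj, PathSystem.segment]
  have hdisj : Pairwise fun i j => (g i).walk.support.Disjoint (g j).walk.support := by
    intro j k hjk z hj hk
    rw [hsup] at hj hk
    rcases hj with ⟨rfl, rfl⟩ | hj
    · rcases hk with ⟨rfl, _⟩ | hk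
      · exact hjk rfl
      · exact hwi _ hk
    · rcases hk with ⟨rfl, rfl⟩ | hk
      · exact hwi _ hj
      · exact P.disjoint hjk hj hk
  refine ⟨PathSystem.ofSegments g hdisj, ?_, ?_, ?_, ?_⟩
  · ext z
    rw [PathSystem.mem_verts, Finset.mem_insert, PathSystem.mem_verts]
    change (∃ j : Fin P.size, z ∈ (g j).walk.support) ↔ _
    simp only [hsup]
    constructor
    · rintro ⟨j, ⟨_, h⟩ | h⟩
      · exact Or.inl h
      · exact Or.inr ⟨j, h⟩
    · rintro (h | ⟨j, h⟩)
      · exact ⟨i, Or.inl ⟨rfl, h⟩⟩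
      · exact ⟨j, Or.inr h⟩
  · ext z
    rw [PathSystem.mem_endpoints, Finset.mem_insert, Finset.mem_erase, PathSystem.mem_endpoints]
    change (∃ j : Fin P.size, z = (g j).fst ∨ z = (g j).snd) ↔ _
    constructor
    · rintro ⟨j, h⟩
      by_cases hj : j = i
      · subst hj
        rw [gi, hfst] at h
        rcases h with h | h
        · exact Or.inl h
        · right
          rcases hsnd' with ⟨h1, h2⟩ | ⟨h1, h2⟩
          · rw [h2] at h; exact ⟨by rw [h, h1]; exact hne.symm, j, Or.inr h⟩
          · rw [h2] at h; exact ⟨by rw [h, h1]; exact hne, j, Or.inl h⟩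
      · rw [gj j hj] at h
        right
        refine ⟨?_, j, h⟩
        rintro rfl
        apply hj
        apply P.index_unique _ hxi
        rcases h with h | h
        · rw [h]; exact SimpleGraph.Walk.start_mem_support _
        · rw [h]; exact SimpleGraph.Walk.end_mem_support _
    · rintro (h | ⟨hzx, j, h⟩)
      · exact ⟨i, Or.inl (by rw [gi, hfst, h])⟩
      · by_cases hj : j = i
        · subst hj
          refine ⟨j, Or.inr ?_⟩
          rw [gi]
          rcases hsnd' with ⟨h1, h2⟩ | ⟨h1, h2⟩
          · rw [h2]; exact h.resolve_left (by rw [← h1]; exact hzx)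
          · rw [h2]; exact h.resolve_right (by rw [← h1]; exact hzx)
        · exact ⟨j, by rw [gj j hj]; exact h⟩
  · intro r hsymm htrans hxw hr
    change ∀ j : Fin P.size, ∀ u ∈ (g j).walk.support, ∀ v ∈ (g j).walk.support, r u v
    intro j u hu v hv
    rw [hsup] at hu hv
    rcases hu with ⟨rfl, rfl⟩ | hu
    · rcases hv with ⟨_, rfl⟩ | hv
      · exact htrans _ _ _ (hsymm _ _ hxw) hxw
      · exact htrans _ _ _ (hsymm _ _ hxw) (hr _ _ hxi _ hv)
    · rcases hv with ⟨rfl, rfl⟩ | hv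
      · exact htrans _ _ _ (hr _ _ hu _ hxi) hxw
      · exact hr _ _ hu _ hv
  · rintro C hC ⟨j, hj⟩
    refine ⟨j, ?_⟩
    change ¬ ((g j).fst ∈ C ↔ (g j).snd ∈ C)
    by_cases hji : j = i
    · subst hji
      rw [gi, hfst]
      rcases hsnd' with ⟨h1, h2⟩ | ⟨h1, h2⟩
      · rw [h2, ← hC, h1]; exact hj
      · rw [h2, ← hC, h1]; exact fun h => hj h.symm
    · rw [gj j hji]; exact hj

open Classical in
theorem PathSystem.exists_add_edge [Fintype α] (P : PathSystem G) {x w : α} (hx : x ∉ P.verts)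
    (hw : w ∉ P.verts) (hadj : G.Adj x w) :
    ∃ P' : PathSystem G, P'.verts = insert x (insert w P.verts) ∧
      P'.endpoints = insert x (insert w P.endpoints) ∧
      (∀ r : α → α → Prop, (∀ a b, r a b → r b a) → (∀ a b c, r a b → r b c → r a c) →
        r x w → (∀ i, ∀ u ∈ (P.walk i).support, ∀ v ∈ (P.walk i).support, r u v) →
        ∀ i, ∀ u ∈ (P'.walk i).support, ∀ v ∈ (P'.walk i).support, r u v) := by
  have hxi : ∀ j, x ∉ (P.walk j).support := fun j hj => hx (PathSystem.mem_verts.2 ⟨j, hj⟩)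
  have hwi : ∀ j, w ∉ (P.walk j).support := fun j hj => hw (PathSystem.mem_verts.2 ⟨j, hj⟩)
  let s : Segment G := ⟨x, w, hadj.toWalk, by simp [hadj.ne], by simp⟩
  have hs : ∀ z, z ∈ s.walk.support ↔ z = x ∨ z = w := by intro z; simp [s]
  let g : Fin (P.size + 1) → Segment G := Fin.cons s P.segment
  have g0 : g 0 = s := rfl
  have gs : ∀ j : Fin P.size, g j.succ = P.segment j := fun j => by simp [g]
  have hdisj : Pairwise fun i j => (g i).walk.support.Disjoint (g j).walk.support := by
    intro j k hjk z hj hk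
    induction j using Fin.cases with
    | zero =>
      induction k using Fin.cases with
      | zero => exact hjk rfl
      | succ k =>
        rw [g0, hs] at hj; rw [gs] at hk
        rcases hj with rfl | rfl
        · exact hxi _ hk
        · exact hwi _ hk
    | succ j =>
      induction k using Fin.cases with
      | zero =>
        rw [g0, hs] at hk; rw [gs] at hj
        rcases hk with rfl | rfl
        · exact hxi _ hj
        · exact hwi _ hj
      | succ k =>
        rw [gs] at hj hk
        exact P.disjoint (fun h => hjk (by rw [h])) hj hk
  refine ⟨PathSystem.ofSegments g hdisj, ?_, ?_, ?_⟩
  · ext z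
    rw [PathSystem.mem_verts]
    change (∃ j : Fin (P.size + 1), z ∈ (g j).walk.support) ↔ _
    rw [Fin.exists_fin_succ]
    have h0 : z ∈ (g 0).walk.support ↔ z = x ∨ z = w := hs z
    have h1 : ∀ j : Fin P.size, z ∈ (g j.succ).walk.support ↔ z ∈ (P.walk j).support :=
      fun j => by rw [gs]; rfl
    rw [h0, exists_congr h1]
    simp only [Finset.mem_insert, PathSystem.mem_verts, or_assoc]
  · ext z
    rw [PathSystem.mem_endpoints]
    change (∃ j : Fin (P.size + 1), z = (g j).fst ∨ z = (g j).snd) ↔ _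
    rw [Fin.exists_fin_succ]
    simp only [g0, gs, Finset.mem_insert, PathSystem.mem_endpoints, or_assoc, PathSystem.segment, s]
  · intro r hsymm htrans hxw hr
    change ∀ j : Fin (P.size + 1), ∀ u ∈ (g j).walk.support, ∀ v ∈ (g j).walk.support, r u v
    intro j u hu v hv
    induction j using Fin.cases with
    | zero =>
      rw [g0, hs] at hu hv
      rcases hu with rfl | rfl <;> rcases hv with rfl | rfl
      · exact htrans _ _ _ hxw (hsymm _ _ hxw)
      · exact hxw
      · exact hsymm _ _ hxw
      · exact htrans _ _ _ (hsymm _ _ hxw) hxw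
    | succ j =>
      rw [gs] at hu hv
      exact hr _ _ hu _ hv

/-- A graph with maximum degree at most two in which every nonempty subgraph has a leaf is the union
of the paths of a path system. -/
theorem exists_pathSystem_of_linearForest [Fintype α] (L : SimpleGraph α) (hLG : L ≤ G)
    (hdeg : ∀ v a b c, L.Adj v a → L.Adj v b → L.Adj v c → a = b ∨ a = c ∨ b = c)
    (hleaf : ∀ H ≤ L, H ≠ ⊥ → ∃ v, ∃! y, H.Adj v y) :
    ∃ P : PathSystem G, (∀ v, v ∈ P.verts ↔ ∃ y, L.Adj v y) ∧
      (∀ v, v ∈ P.endpoints ↔ ∃! y, L.Adj v y) ∧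
      ∀ i, ∀ u ∈ (P.walk i).support, ∀ v ∈ (P.walk i).support, L.Reachable u v := by
  classical
  -- Delete the edge from a leaf `v` to its neighbour `y`. In the path system of the rest, `y` is
  -- either an end of a path, which is extended to `v`, or uncovered, and then the edge `vy` becomes
  -- a new path.
  induction hn : L.edgeSet.ncard using Nat.strong_induction_on generalizing L with
  | _ n ih =>
  by_cases hL : L = ⊥
  · subst hL
    refine ⟨⟨0, Fin.elim0, Fin.elim0, fun i => i.elim0, fun i => i.elim0, fun i => i.elim0,
      fun i => i.elim0⟩, ?_, ?_, fun i => i.elim0⟩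
    · intro v; rw [PathSystem.mem_verts]; simp
    · intro v; rw [PathSystem.mem_endpoints]; simp [ExistsUnique]
  · obtain ⟨v, y, hvy, huniq⟩ := hleaf L le_rfl hL
    have hvy' : L.Adj v y := hvy
    set L' := L.deleteEdges {s(v, y)} with hL'
    have hle : L' ≤ L := SimpleGraph.deleteEdges_le _
    have hadj : ∀ a b, L'.Adj a b ↔ L.Adj a b ∧ ¬ (a = v ∧ b = y ∨ a = y ∧ b = v) := by
      intro a b; simp [hL']
    have hlt : L'.edgeSet.ncard < n := by
      rw [← hn]
      apply Set.ncard_lt_ncard _ (Set.toFinite _)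
      refine ⟨SimpleGraph.edgeSet_mono hle, fun h => ?_⟩
      have := h (show s(v, y) ∈ L.edgeSet from hvy')
      simp [hL'] at this
    obtain ⟨P, hP1, hP2, hP3⟩ := ih _ hlt L' (hle.trans hLG)
      (fun v a b c h1 h2 h3 => hdeg v a b c (hle h1) (hle h2) (hle h3))
      (fun H hH => hleaf H (hH.trans hle)) rfl
    have hyv : y ≠ v := hvy'.ne'
    have hv : v ∉ P.verts := by
      rw [hP1]
      rintro ⟨z, hz⟩
      rw [hadj] at hz
      exact hz.2 (Or.inl ⟨rfl, huniq z hz.1⟩)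
    have hreach : ∀ i, ∀ a ∈ (P.walk i).support, ∀ b ∈ (P.walk i).support, L.Reachable a b :=
      fun i a ha b hb => (hP3 i a ha b hb).mono hle
    have hvu : ∃! z, L.Adj v z := ⟨y, hvy, huniq⟩
    have hother : ∀ a, a ≠ v → a ≠ y → ∀ b, L'.Adj a b ↔ L.Adj a b := by
      intro a h1 h2 b
      rw [hadj]; simp [h1, h2]
    by_cases hy : ∃ z, L'.Adj y z
    · obtain ⟨z, hz⟩ := hy
      have hz' := (hadj _ _).1 hz
      have hzv : z ≠ v := fun h => hz'.2 (Or.inr ⟨rfl, h⟩)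
      have hyend : y ∈ P.endpoints := by
        rw [hP2]
        refine ⟨z, hz, fun z' hz1 => ?_⟩
        have hz1' := (hadj _ _).1 hz1
        have hz1v : z' ≠ v := fun h => hz1'.2 (Or.inr ⟨rfl, h⟩)
        rcases hdeg y v z z' hvy'.symm hz'.1 hz1'.1 with h | h | h
        · exact absurd h.symm hzv
        · exact absurd h.symm hz1v
        · exact h.symm
      obtain ⟨P', h1, h2, h3, -⟩ := P.exists_extend hyend hv (hLG hvy'.symm)
      refine ⟨P', ?_, ?_, h3 L.Reachable (fun _ _ h => h.symm) (fun _ _ _ h h' => h.trans h')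
        hvy'.symm.reachable hreach⟩
      · intro a
        rw [h1, Finset.mem_insert, hP1]
        constructor
        · rintro (rfl | ⟨b, hb⟩)
          · exact ⟨y, hvy'⟩
          · exact ⟨b, hle hb⟩
        · rintro ⟨b, hb⟩
          by_cases hav : a = v
          · exact Or.inl hav
          · right
            by_cases hay : a = y
            · exact ⟨z, hay ▸ hz⟩
            · exact ⟨b, (hother a hav hay b).2 hb⟩
      · intro a
        rw [h2, Finset.mem_insert, Finset.mem_erase, hP2]
        by_cases hav : a = v
        · subst hav; simp [hvu]
        · by_cases hay : a = y
          · subst hay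
            simp only [hav, ne_eq, not_true_eq_false, false_and, or_self, false_iff]
            rintro ⟨b, hb, hb'⟩
            have e1 := hb' v hvy'.symm
            have e2 := hb' z hz'.1
            exact hzv (e2.trans e1.symm)
          · simp only [hav, ne_eq, hay, not_false_eq_true, true_and, false_or,
              hother a hav hay]
    · have hyP : y ∉ P.verts := by rw [hP1]; exact hy
      have hyL : ∀ z, L.Adj y z → z = v := by
        intro z hz
        by_contra hzv
        exact hy ⟨z, by rw [hadj]; exact ⟨hz, by simp [hyv, hzv]⟩⟩
      obtain ⟨P', h1, h2, h3⟩ := P.exists_add_edge hv hyP (hLG hvy')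
      refine ⟨P', ?_, ?_, h3 L.Reachable (fun _ _ h => h.symm) (fun _ _ _ h h' => h.trans h')
        hvy'.reachable hreach⟩
      · intro a
        rw [h1, Finset.mem_insert, Finset.mem_insert, hP1]
        by_cases hav : a = v
        · subst hav; simpa using ⟨y, hvy'⟩
        · by_cases hay : a = y
          · subst hay; simpa using ⟨v, hvy'.symm⟩
          · simp [hav, hay, hother a hav hay]
      · intro a
        rw [h2, Finset.mem_insert, Finset.mem_insert, hP2]
        by_cases hav : a = v
        · subst hav; simp [hvu]
        · by_cases hay : a = y
          · subst hay
            simp only [hav, true_or, or_true, true_iff]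
            exact ⟨v, hvy'.symm, hyL⟩
          · simp only [hav, hay, false_or, hother a hav hay]

end RobustPartition

/-! ### Matchings: greedy choice, Hall's theorem with deficiency, and supplies of inner edges. -/

namespace RobustPartition

variable {α : Type*} {G : SimpleGraph α}

/-- `μ` pairs up the vertices of `X` along edges of `G`. -/
def IsMatchingOn (G : SimpleGraph α) (X : Finset α) (μ : α → α) : Prop :=
  ∀ x ∈ X, μ x ∈ X ∧ μ (μ x) = x ∧ G.Adj x (μ x)

open Classical in
theorem IsMatchingOn.union {X Y : Finset α} {μ ν : α → α} (hX : IsMatchingOn G X μ)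
    (hY : IsMatchingOn G Y ν) (h : Disjoint X Y) :
    IsMatchingOn G (X ∪ Y) (fun x => if x ∈ X then μ x else ν x) := by
  intro x hx
  by_cases h1 : x ∈ X
  · obtain ⟨a, b, c⟩ := hX x h1
    simp only [h1, if_true, a, b, c, Finset.mem_union, true_or, and_self]
  · have h2 : x ∈ Y := (Finset.mem_union.1 hx).resolve_left h1
    obtain ⟨a, b, c⟩ := hY x h2
    have h3 : ν x ∉ X := fun h' => Finset.disjoint_left.1 h h' a
    simp only [h1, h3, if_false, a, b, c, Finset.mem_union, or_true, and_self]

open Classical in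
/-- The matching `{f x, x}`, `x ∈ X`, of an injection `f` of `X` into the complement of `X`. -/
theorem exists_isMatchingOn_of_injOn {X : Finset α} {f : α → α} (hf : Set.InjOn f X)
    (hd : ∀ x ∈ X, f x ∉ X) (hadj : ∀ x ∈ X, G.Adj x (f x)) :
    ∃ μ : α → α, IsMatchingOn G (X ∪ X.image f) μ ∧ (∀ x ∈ X, μ x = f x) ∧
      ∀ x ∈ X, μ (f x) = x := by
  have key : ∀ x ∈ X, ∃ y ∈ X, f y = f x ∧ y = x := fun x hx => ⟨x, hx, rfl, rfl⟩
  let g : α → α := fun z => if h : ∃ y ∈ X, f y = z then h.choose else z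
  have hg : ∀ x ∈ X, g (f x) = x := by
    intro x hx
    have h : ∃ y ∈ X, f y = f x := ⟨x, hx, rfl⟩
    simp only [g, dif_pos h]
    exact hf h.choose_spec.1 hx h.choose_spec.2
  refine ⟨fun z => if z ∈ X then f z else g z, ?_, fun x hx => by simp [hx],
    fun x hx => by simp [hd x hx, hg x hx]⟩
  intro x hx
  rcases Finset.mem_union.1 hx with h | h
  · refine ⟨?_, ?_, ?_⟩
    · simp only [h, if_true]; exact Finset.mem_union_right _ (Finset.mem_image_of_mem _ h)
    · simp [h, hd x h, hg x h]
    · simpa [h] using hadj x h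
  · obtain ⟨y, hy, rfl⟩ := Finset.mem_image.1 h
    simp only [hd y hy, if_false, hg y hy, hy, if_true]
    exact ⟨Finset.mem_union_left _ hy, trivial, (hadj y hy).symm⟩

open Classical in
theorem degIn_mono {Y Z : Finset α} (h : Y ⊆ Z) (x : α) : degIn G Y x ≤ degIn G Z x :=
  Finset.card_le_card (Finset.filter_subset_filter _ h)

open Classical in
theorem degIn_union {Y Z : Finset α} (h : Disjoint Y Z) (x : α) :
    degIn G (Y ∪ Z) x = degIn G Y x + degIn G Z x := by
  simp only [degIn, Finset.filter_union]
  exact Finset.card_union_of_disjoint (Finset.disjoint_filter_filter h)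

open Classical in
theorem degIn_eq_sum (Y : Finset α) (x : α) :
    degIn G Y x = ∑ y ∈ Y, if G.Adj x y then 1 else 0 := by
  exact Finset.card_filter _ _

theorem sum_degIn_comm (S T : Finset α) : ∑ x ∈ S, degIn G T x = ∑ y ∈ T, degIn G S y := by
  classical
  simp only [degIn_eq_sum]
  rw [Finset.sum_comm]
  simp only [G.adj_comm]

theorem degIn_pos {Y : Finset α} {x : α} (h : 0 < degIn G Y x) : ∃ y ∈ Y, G.Adj x y := by
  classical
  obtain ⟨y, hy⟩ := Finset.card_pos.1 h
  exact ⟨y, (Finset.mem_filter.1 hy).1, (Finset.mem_filter.1 hy).2⟩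

theorem exists_adj_of_sum_degIn_pos {S T : Finset α} (h : 0 < ∑ x ∈ S, degIn G T x) :
    ∃ x ∈ S, ∃ y ∈ T, G.Adj x y := by
  obtain ⟨x, hx, hx'⟩ := Finset.exists_ne_zero_of_sum_ne_zero h.ne'
  obtain ⟨y, hy, hxy⟩ := degIn_pos (Nat.pos_of_ne_zero hx')
  exact ⟨x, hx, y, hy, hxy⟩

theorem sum_degIn_pos {S T : Finset α} {x y : α} (hx : x ∈ S) (hy : y ∈ T) (h : G.Adj x y) :
    0 < ∑ x ∈ S, degIn G T x := by
  classical
  apply Finset.sum_pos' (fun _ _ => Nat.zero_le _)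
  exact ⟨x, hx, Finset.card_pos.2 ⟨y, by simp [hy, h]⟩⟩

open Classical in
/-- Greedy choice of distinct neighbours outside a forbidden set. -/
theorem exists_injOn_neighbors {S U F : Finset α} (h : ∀ u ∈ U, #F + #U ≤ degIn G S u) :
    ∃ f : α → α, Set.InjOn f U ∧ ∀ u ∈ U, f u ∈ S ∧ f u ∉ F ∧ G.Adj u (f u) := by
  let t : U → Finset α := fun u => {y ∈ S | G.Adj u y} \ F
  have ht : ∀ u : U, #U ≤ #(t u) := by
    intro u
    have h1 := h u u.2
    have h2 := Finset.le_card_sdiff F {y ∈ S | G.Adj u y}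
    simp only [degIn] at h1
    simp only [t]
    omega
  -- Each of the `#U` candidate sets has at least `#U` elements, so Hall's condition is immediate.
  obtain ⟨f, hf, hft⟩ := (Finset.all_card_le_biUnion_card_iff_exists_injective t).1 (by
    intro s
    rcases s.eq_empty_or_nonempty with rfl | ⟨u, hu⟩
    · simp
    · calc #s ≤ Fintype.card U := Finset.card_le_univ s
        _ = #U := Fintype.card_coe U
        _ ≤ #(t u) := ht u
        _ ≤ _ := Finset.card_le_card (Finset.subset_biUnion_of_mem t hu))
  refine ⟨fun x => if hx : x ∈ U then f ⟨x, hx⟩ else x, ?_, ?_⟩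
  · intro x hx y hy hxy
    have hx' : x ∈ U := hx
    have hy' : y ∈ U := hy
    simp only [hx', hy', dif_pos] at hxy
    simpa using hf hxy
  · intro u hu
    have := hft ⟨u, hu⟩
    simp only [t, Finset.mem_sdiff, Finset.mem_filter] at this
    simp only [hu, dif_pos]
    exact ⟨this.1.1, this.2, this.1.2⟩

open Classical in
/-- The vertices outside `T` and the neighbours of `T` cover all edges between `X` and `A`. -/
theorem two_mul_sum_degIn_le {A X T : Finset α} {D : ℕ} (hT : T ⊆ X) {N : Finset α}
    (hN : N ⊆ A) (hTN : ∀ x ∈ T, ∀ a ∈ A, G.Adj x a → a ∈ N)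
    (hA : ∀ a ∈ A, 2 * degIn G X a ≤ D) (hX : ∀ x ∈ X, 2 * degIn G A x ≤ D) :
    2 * ∑ x ∈ X, degIn G A x ≤ D * (#N + #(X \ T)) := by
  classical
  have h1 : ∑ x ∈ T, degIn G A x = ∑ x ∈ T, degIn G N x := by
    refine Finset.sum_congr rfl fun x hx => ?_
    unfold degIn
    congr 1
    ext a
    simp only [Finset.mem_filter]
    exact ⟨fun h => ⟨hTN x hx a h.1 h.2, h.2⟩, fun h => ⟨hN h.1, h.2⟩⟩
  have h2 : 2 * ∑ x ∈ T, degIn G A x ≤ D * #N := by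
    rw [h1, sum_degIn_comm, Finset.mul_sum, mul_comm D, ← smul_eq_mul]
    exact Finset.sum_le_card_nsmul _ _ _ fun a ha =>
      (Nat.mul_le_mul_left 2 (degIn_mono hT a)).trans (hA a (hN ha))
  have h3 : 2 * ∑ x ∈ X \ T, degIn G A x ≤ D * #(X \ T) := by
    rw [Finset.mul_sum, mul_comm D, ← smul_eq_mul]
    exact Finset.sum_le_card_nsmul _ _ _ fun a ha => hX a (Finset.sdiff_subset ha)
  rw [← Finset.sum_sdiff hT, mul_add, mul_add]
  omega

open Classical in
/-- A bipartite graph with maximum degree at most `D / 2` between `A` and `R ∪ S` contains a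
matching with `y` edges at `R` and `z` edges at `S` if the number of edges at `R`, at `S` and
altogether leave no obstruction in terms of vertex covers. -/
theorem exists_matching_of_sum_degIn {A R S : Finset α} {D y z : ℕ}
    (hRS : Disjoint R S) (hA : ∀ a ∈ A, 2 * degIn G (R ∪ S) a ≤ D)
    (hB : ∀ x ∈ R ∪ S, 2 * degIn G A x ≤ D)
    (hy : D * y < 2 * ∑ x ∈ R, degIn G A x + D)
    (hz : D * z < 2 * ∑ x ∈ S, degIn G A x + D)
    (hyz : D * (y + z) < 2 * ∑ x ∈ R ∪ S, degIn G A x + D) :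
    ∃ R' ⊆ R, ∃ S' ⊆ S, ∃ f : α → α, #R' = y ∧ #S' = z ∧ Set.InjOn f ↑(R' ∪ S') ∧
      ∀ x ∈ R' ∪ S', f x ∈ A ∧ G.Adj x (f x) := by
  -- `N` and `X \ T` form a vertex cover, and a vertex covers at most D/2 edges; hence the cover has
  -- at least ⌈2e/D⌉ elements. The summand `D` in the hypotheses accounts for rounding up.
  have key : ∀ (X T N : Finset α) (m : ℕ), X ⊆ R ∪ S → T ⊆ X → N ⊆ A →
      (∀ x ∈ T, ∀ a ∈ A, G.Adj x a → a ∈ N) → D * m < 2 * ∑ x ∈ X, degIn G A x + D →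
      m ≤ #N + #(X \ T) := by
    intro X T N m hX hT hN hTN hm
    have := two_mul_sum_degIn_le hT hN hTN
      (fun a ha => (Nat.mul_le_mul_left 2 (degIn_mono hX a)).trans (hA a ha))
      (fun x hx => hB x (hX hx))
    have h2 : D * m < D * (#N + #(X \ T) + 1) := by rw [mul_add D _ 1]; omega
    have := Nat.lt_of_mul_lt_mul_left h2
    omega
  have hyR : y ≤ #R := by
    have := key R ∅ ∅ y Finset.subset_union_left (by simp) (by simp) (by simp) hy
    simpa using this
  have hzS : z ≤ #S := by
    have := key S ∅ ∅ z Finset.subset_union_right (by simp) (by simp) (by simp) hz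
    simpa using this
  let N : Finset α → Finset α := fun T => {a ∈ A | ∃ x ∈ T, G.Adj x a}
  -- Every vertex of `R` may also be matched to one of `#R - y` dummies, and every vertex of `S` to
  -- one of `#S - z` others. A system of distinct representatives then leaves at least `y` and `z`
  -- vertices matched into `A`.
  let t : (R ∪ S : Finset α) → Finset (α ⊕ (Fin (#R - y) ⊕ Fin (#S - z))) := fun x =>
    (N {x.1}).disjSum ((if x.1 ∈ R then univ else ∅).disjSum (if x.1 ∈ S then univ else ∅))
  obtain ⟨g, hg, hgt⟩ := (Finset.all_card_le_biUnion_card_iff_exists_injective t).1 (by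
    intro s
    set T : Finset α := s.image Subtype.val with hTdef
    have hTc : #T = #s := Finset.card_image_of_injective _ Subtype.val_injective
    have hTsub : T ⊆ R ∪ S := by
      intro x hx
      obtain ⟨u, -, rfl⟩ := Finset.mem_image.1 hx
      exact u.2
    set TR := T ∩ R with hTR
    set TS := T ∩ S with hTS
    have hcard : #s = #TR + #TS := by
      rw [← hTc, ← Finset.card_union_of_disjoint
        (Finset.disjoint_of_subset_left Finset.inter_subset_right
          (Finset.disjoint_of_subset_right Finset.inter_subset_right hRS)),
        ← Finset.inter_union_distrib_left, Finset.inter_eq_left.2 hTsub]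
    have hsub : (N T).disjSum ((if TR.Nonempty then univ else ∅).disjSum
        (if TS.Nonempty then univ else ∅)) ⊆ s.biUnion t := by
      intro q hq
      rw [Finset.mem_biUnion]
      rcases q with a | q | q
      · simp only [Finset.inl_mem_disjSum, N, Finset.mem_filter] at hq
        obtain ⟨ha, x, hx, hxa⟩ := hq
        obtain ⟨u, hu, rfl⟩ := Finset.mem_image.1 hx
        exact ⟨u, hu, by simp [t, N, ha, hxa]⟩
      · have hne : TR.Nonempty := by
          by_contra hne
          simp [hne] at hq
        obtain ⟨x, hx⟩ := hne
        obtain ⟨hx1, hx2⟩ := Finset.mem_inter.1 hx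
        obtain ⟨u, hu, rfl⟩ := Finset.mem_image.1 hx1
        exact ⟨u, hu, by simp [t, hx2]⟩
      · have hne : TS.Nonempty := by
          by_contra hne
          simp [hne] at hq
        obtain ⟨x, hx⟩ := hne
        obtain ⟨hx1, hx2⟩ := Finset.mem_inter.1 hx
        obtain ⟨u, hu, rfl⟩ := Finset.mem_image.1 hx1
        exact ⟨u, hu, by simp [t, hx2]⟩
    refine le_trans ?_ (Finset.card_le_card hsub)
    rw [Finset.card_disjSum, Finset.card_disjSum, hcard]
    have hNA : N T ⊆ A := Finset.filter_subset _ _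
    have hTN : ∀ x ∈ T, ∀ a ∈ A, G.Adj x a → a ∈ N T := by
      intro x hx a ha hxa
      exact Finset.mem_filter.2 ⟨ha, x, hx, hxa⟩
    have hTRR : #(R \ TR) = #R - #TR := Finset.card_sdiff_of_subset Finset.inter_subset_right
    have hTSS : #(S \ TS) = #S - #TS := Finset.card_sdiff_of_subset Finset.inter_subset_right
    have l1 : #TR ≤ #R := Finset.card_le_card Finset.inter_subset_right
    have l2 : #TS ≤ #S := Finset.card_le_card Finset.inter_subset_right
    have k1 := key R TR (N T) y Finset.subset_union_left Finset.inter_subset_right hNA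
      (fun x hx => hTN x (Finset.mem_inter.1 hx).1) hy
    have k2 := key S TS (N T) z Finset.subset_union_right Finset.inter_subset_right hNA
      (fun x hx => hTN x (Finset.mem_inter.1 hx).1) hz
    have k3 := key (R ∪ S) T (N T) (y + z) le_rfl hTsub hNA hTN hyz
    have k4 : #((R ∪ S) \ T) = #R + #S - (#TR + #TS) := by
      rw [Finset.card_sdiff_of_subset hTsub, Finset.card_union_of_disjoint hRS, hTc, hcard]
    -- Hall's condition is the cover bound `k3` if `T` meets both sides, and `k1` or `k2` if it
    -- meets only one, since then only the dummies of that side are available.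
    by_cases e1 : TR.Nonempty <;> by_cases e2 : TS.Nonempty
    · simp only [e1, e2, if_true, Finset.card_univ, Fintype.card_fin]; omega
    · have := Finset.not_nonempty_iff_eq_empty.1 e2
      simp only [e1, if_true, Finset.card_univ, Fintype.card_fin, this,
        Finset.card_empty]
      omega
    · have := Finset.not_nonempty_iff_eq_empty.1 e1
      simp only [e2, if_true, Finset.card_univ, Fintype.card_fin, this,
        Finset.card_empty]
      omega
    · have a1 := Finset.not_nonempty_iff_eq_empty.1 e1
      have a2 := Finset.not_nonempty_iff_eq_empty.1 e2
      simp [a1, a2])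
  let f : α → α := fun x => if hx : x ∈ R ∪ S then Sum.elim id (fun _ => x) (g ⟨x, hx⟩) else x
  let good : α → Prop := fun x => ∃ (hx : x ∈ R ∪ S) (a : α), g ⟨x, hx⟩ = Sum.inl a
  have hgood : ∀ x, good x → f x ∈ A ∧ G.Adj x (f x) := by
    rintro x ⟨hx, a, ha⟩
    have := hgt ⟨x, hx⟩
    rw [ha] at this
    simp only [t, Finset.inl_mem_disjSum, N, Finset.mem_filter, Finset.mem_singleton,
      exists_eq_left] at this
    simpa only [f, dif_pos hx, ha, Sum.elim_inl, id] using this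
  have hinj : ∀ x x', good x → good x' → f x = f x' → x = x' := by
    rintro x x' ⟨hx, a, ha⟩ ⟨hx', a', ha'⟩ h
    simp only [f, dif_pos hx, dif_pos hx', ha, ha', Sum.elim_inl, id] at h
    subst h
    simpa using hg (ha.trans ha'.symm)
  have hcR : y ≤ #(R.filter good) := by
    have h1 := Finset.card_sdiff_of_subset (Finset.filter_subset good R)
    have h2 : #(R \ R.filter good) ≤ #(univ : Finset (Fin (#R - y))) := by
      refine Finset.card_le_card_of_forall_subsingleton
        (fun x k => ∃ hx : x ∈ R ∪ S, g ⟨x, hx⟩ = Sum.inr (Sum.inl k)) ?_ ?_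
      · intro x hx
        obtain ⟨hxR, hxg⟩ := Finset.mem_sdiff.1 hx
        replace hxg : ¬ good x := fun h => hxg (Finset.mem_filter.2 ⟨hxR, h⟩)
        have hx' : x ∈ R ∪ S := Finset.mem_union_left _ hxR
        have hxS : x ∉ S := Finset.disjoint_left.1 hRS hxR
        have h3 := hgt ⟨x, hx'⟩
        rcases h4 : g ⟨x, hx'⟩ with a | k | k
        · exact absurd ⟨hx', a, h4⟩ hxg
        · exact ⟨k, mem_univ _, hx', h4⟩
        · rw [h4] at h3; simp [t, hxS] at h3
      · rintro k - x ⟨-, hx, q2⟩ x' ⟨-, hx', q4⟩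
        simpa using hg (q2.trans q4.symm)
    rw [Finset.card_univ, Fintype.card_fin] at h2
    omega
  have hcS : z ≤ #(S.filter good) := by
    have h1 := Finset.card_sdiff_of_subset (Finset.filter_subset good S)
    have h2 : #(S \ S.filter good) ≤ #(univ : Finset (Fin (#S - z))) := by
      refine Finset.card_le_card_of_forall_subsingleton
        (fun x k => ∃ hx : x ∈ R ∪ S, g ⟨x, hx⟩ = Sum.inr (Sum.inr k)) ?_ ?_
      · intro x hx
        obtain ⟨hxS, hxg⟩ := Finset.mem_sdiff.1 hx
        replace hxg : ¬ good x := fun h => hxg (Finset.mem_filter.2 ⟨hxS, h⟩)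
        have hx' : x ∈ R ∪ S := Finset.mem_union_right _ hxS
        have hxR : x ∉ R := fun h => Finset.disjoint_left.1 hRS h hxS
        have h3 := hgt ⟨x, hx'⟩
        rcases h4 : g ⟨x, hx'⟩ with a | k | k
        · exact absurd ⟨hx', a, h4⟩ hxg
        · rw [h4] at h3; simp [t, hxR] at h3
        · exact ⟨k, mem_univ _, hx', h4⟩
      · rintro k - x ⟨-, hx, q2⟩ x' ⟨-, hx', q4⟩
        simpa using hg (q2.trans q4.symm)
    rw [Finset.card_univ, Fintype.card_fin] at h2
    omega
  obtain ⟨R', hR', hR'c⟩ := Finset.exists_subset_card_eq hcR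
  obtain ⟨S', hS', hS'c⟩ := Finset.exists_subset_card_eq hcS
  have hall : ∀ x ∈ R' ∪ S', good x := by
    intro x hx
    rcases Finset.mem_union.1 hx with h | h
    · exact (Finset.mem_filter.1 (hR' h)).2
    · exact (Finset.mem_filter.1 (hS' h)).2
  refine ⟨R', hR'.trans (Finset.filter_subset _ _), S', hS'.trans (Finset.filter_subset _ _), f,
    hR'c, hS'c, ?_, fun x hx => hgood x (hall x hx)⟩
  intro x hx x' hx' h
  exact hinj x x' (hall x (by exact_mod_cast hx)) (hall x' (by exact_mod_cast hx')) h

/-- A graph of small maximum degree and many edges contains a matching avoiding a small set. -/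
theorem exists_matching_avoiding {T Z : Finset α} {φ : ℕ} (hφ : ∀ x ∈ T, degIn G T x ≤ φ) (t : ℕ)
    (h : ∀ s < t, 2 * φ * (2 * s + #Z) < ∑ x ∈ T, degIn G T x) :
    ∃ (Y : Finset α) (ν : α → α), IsMatchingOn G Y ν ∧ Y ⊆ T ∧ Disjoint Y Z ∧ #Y = 2 * t := by
  classical
  induction t with
  | zero => exact ⟨∅, id, fun x hx => by simp at hx, by simp, by simp, by simp⟩
  | succ t ih =>
    obtain ⟨Y, ν, hY, hYT, hYZ, hYc⟩ := ih fun s hs => h s (by omega)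
    -- The vertices of `Y` and `Z` number at most `2 * t + #Z`, and each meets at most `φ` edges,
    -- counted twice in the degree sum; so an edge avoiding them remains.
    have hex : ∃ x ∈ T \ (Y ∪ Z), ∃ y ∈ T \ (Y ∪ Z), G.Adj x y := by
      apply exists_adj_of_sum_degIn_pos
      have hlt := h t (by omega)
      set K := T ∩ (Y ∪ Z) with hK
      set K' := T \ (Y ∪ Z) with hK'
      have hdisj : Disjoint K' K := by
        rw [Finset.disjoint_left]; intro x h1 h2
        exact (Finset.mem_sdiff.1 h1).2 (Finset.mem_inter.1 h2).2
      have hT : T = K' ∪ K := by rw [hK, hK', Finset.sdiff_union_inter]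
      have hKT : K ⊆ T := Finset.inter_subset_left
      have e1 : ∑ x ∈ T, degIn G T x = ∑ x ∈ T, degIn G K' x + ∑ x ∈ T, degIn G K x := by
        rw [← Finset.sum_add_distrib]
        refine Finset.sum_congr rfl fun x _ => ?_
        conv_lhs => rw [hT]
        exact degIn_union hdisj x
      have e2 : ∑ x ∈ T, degIn G K' x = ∑ x ∈ K', degIn G K' x + ∑ x ∈ K, degIn G K' x := by
        conv_lhs => rw [hT]
        exact Finset.sum_union hdisj
      have e3 : ∑ x ∈ T, degIn G K x ≤ #K * φ := by
        rw [sum_degIn_comm, ← smul_eq_mul]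
        exact Finset.sum_le_card_nsmul _ _ _ fun x hx => hφ x (hKT hx)
      have e4 : ∑ x ∈ K, degIn G K' x ≤ #K * φ := by
        rw [← smul_eq_mul]
        exact Finset.sum_le_card_nsmul _ _ _ fun x hx =>
          (degIn_mono Finset.sdiff_subset x).trans (hφ x (hKT hx))
      have e5 : #K ≤ 2 * t + #Z := by
        rw [← hYc]
        exact (Finset.card_le_card Finset.inter_subset_right).trans (Finset.card_union_le _ _)
      have e6 : #K * φ ≤ (2 * t + #Z) * φ := Nat.mul_le_mul_right _ e5
      have e7 : 2 * φ * (2 * t + #Z) = 2 * ((2 * t + #Z) * φ) := by ring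
      omega
    obtain ⟨x, hx, y, hy, hxy⟩ := hex
    simp only [Finset.mem_sdiff, Finset.mem_union, not_or] at hx hy
    have hpair : IsMatchingOn G {x, y} (fun z => if z = x then y else x) := by
      intro z hz
      rcases Finset.mem_insert.1 hz with rfl | hz
      · simp [hxy.ne', hxy]
      · rw [Finset.mem_singleton] at hz
        subst hz
        simp [hxy.ne', hxy.symm]
    have hd : Disjoint Y {x, y} := by
      rw [Finset.disjoint_insert_right, Finset.disjoint_singleton_right]
      exact ⟨hx.2.1, hy.2.1⟩
    refine ⟨_, _, hY.union hpair hd, ?_, ?_, ?_⟩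
    · refine Finset.union_subset hYT ?_
      intro z hz
      simp only [Finset.mem_insert, Finset.mem_singleton] at hz
      rcases hz with rfl | rfl
      · exact hx.1
      · exact hy.1
    · rw [Finset.disjoint_union_left]
      refine ⟨hYZ, ?_⟩
      rw [Finset.disjoint_insert_left, Finset.disjoint_singleton_left]
      exact ⟨hx.2.2, hy.2.2⟩
    · rw [Finset.card_union_of_disjoint hd, hYc, Finset.card_pair hxy.ne]; ring

/-- `G[S]` offers `m` disjoint edges: some vertices of degree at least `φ`, each of which can be
matched to almost any vertex, and edges that can be chosen to avoid a small subset of `X`. -/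
def Supply (G : SimpleGraph α) (φ : ℕ) (S X : Finset α) (m : ℕ) : Prop :=
  ∃ (U : Finset α) (t : ℕ), U ⊆ S ∧ #U + t = m ∧ (∀ u ∈ U, φ ≤ degIn G S u) ∧
    ∀ Z ⊆ X, #Z ≤ 2 * t + 1 → ∃ (Y : Finset α) (ν : α → α),
      IsMatchingOn G Y ν ∧ Y ⊆ S ∧ Disjoint Y U ∧ Disjoint Y Z ∧ #Y = 2 * t

open Classical in
-- Each vertex of `U` destroys at most D/2 edges, and each edge counts twice.
theorem sum_degIn_le_sdiff {S U : Finset α} {D : ℕ} (hU : U ⊆ S)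
    (hS : ∀ x ∈ S, 2 * degIn G S x ≤ D) :
    ∑ x ∈ S, degIn G S x ≤ ∑ x ∈ S \ U, degIn G (S \ U) x + #U * D := by
  have hd : Disjoint (S \ U) U := Finset.sdiff_disjoint
  have hSU : S \ U ∪ U = S := Finset.sdiff_union_of_subset hU
  have e1 : ∑ x ∈ S, degIn G S x = ∑ x ∈ S, degIn G (S \ U) x + ∑ x ∈ S, degIn G U x := by
    rw [← Finset.sum_add_distrib]
    refine Finset.sum_congr rfl fun x _ => ?_
    rw [← degIn_union hd, hSU]
  have e2 : ∑ x ∈ S, degIn G (S \ U) x =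
      ∑ x ∈ S \ U, degIn G (S \ U) x + ∑ x ∈ U, degIn G (S \ U) x := by
    rw [← Finset.sum_union hd, hSU]
  have e3 : ∑ x ∈ S, degIn G U x = ∑ x ∈ U, degIn G S x := sum_degIn_comm _ _
  have e4 : ∑ x ∈ U, degIn G (S \ U) x ≤ ∑ x ∈ U, degIn G S x :=
    Finset.sum_le_sum fun x _ => degIn_mono Finset.sdiff_subset x
  have e5 : 2 * ∑ x ∈ U, degIn G S x ≤ #U * D := by
    rw [Finset.mul_sum, ← smul_eq_mul (a := #U)]
    exact Finset.sum_le_card_nsmul _ _ _ fun x hx => hS x (hU hx)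
  omega

/-- Reduction of `Supply` to edges between vertices of small degree. -/
theorem supply_of_low {S X : Finset α} {φ m D : ℕ} (hS : ∀ x ∈ S, 2 * degIn G S x ≤ D)
    (h : ∀ (T : Finset α) (t : ℕ), T ⊆ S → 0 < t → (∀ x ∈ T, degIn G T x ≤ φ) →
      ∑ x ∈ S, degIn G S x + D * t ≤ ∑ x ∈ T, degIn G T x + D * m → ∀ Z ⊆ X, #Z ≤ 2 * t + 1 →
      ∃ (Y : Finset α) (ν : α → α), IsMatchingOn G Y ν ∧ Y ⊆ T ∧ Disjoint Y Z ∧ #Y = 2 * t) :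
    Supply G φ S X m := by
  classical
  set U : Finset α := {x ∈ S | φ ≤ degIn G S x} with hU
  have hUS : U ⊆ S := Finset.filter_subset _ _
  -- With enough high vertices, `m` of them suffice and no low edge is needed. Otherwise all high
  -- vertices are used, and by the preceding estimate the low graph still has degree sum in
  -- proportion to the missing `m - #U` edges.
  rcases le_or_gt m #U with hm | hm
  · obtain ⟨U', hU', hc⟩ := Finset.exists_subset_card_eq hm
    exact ⟨U', 0, hU'.trans hUS, by omega, fun u hu => (Finset.mem_filter.1 (hU' hu)).2,
      fun Z _ _ => ⟨∅, id, fun x hx => by simp at hx, by simp, by simp, by simp, by simp⟩⟩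
  · refine ⟨U, m - #U, hUS, by omega, fun u hu => (Finset.mem_filter.1 hu).2, fun Z hZ hZc => ?_⟩
    obtain ⟨Y, ν, h1, h2, h3, h4⟩ := h (S \ U) (m - #U) Finset.sdiff_subset (by omega) (by
        intro x hx
        obtain ⟨hx1, hx2⟩ := Finset.mem_sdiff.1 hx
        have : ¬ φ ≤ degIn G S x := fun h => hx2 (Finset.mem_filter.2 ⟨hx1, h⟩)
        exact (degIn_mono Finset.sdiff_subset x).trans (by omega)) (by
        have := sum_degIn_le_sdiff hUS hS
        have e : D * m = D * (m - #U) + #U * D := by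
          rw [mul_comm #U D, ← mul_add]; congr 1; omega
        omega) Z hZ hZc
    exact ⟨Y, ν, h1, h2.trans Finset.sdiff_subset,
      Finset.disjoint_of_subset_left h2 Finset.sdiff_disjoint, h3, h4⟩

/-- The low degree sum is at least Dt - 3D/4 ≥ Dt/4 ≥ 12φt, whereas blocking the search takes only
2φ(2s + |Z|) ≤ 8φt, as s < t and |Z| ≤ 2t + 1. -/
theorem supply_of_many {S X : Finset α} {φ m D : ℕ} (hS : ∀ x ∈ S, 2 * degIn G S x ≤ D)
    (hφ : 0 < φ) (hφD : 48 * φ ≤ D) (h : 4 * (D * m) ≤ 4 * ∑ x ∈ S, degIn G S x + 3 * D) :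
    Supply G φ S X m := by
  refine supply_of_low hS fun T t _ ht hT hsum Z _ hZ => exists_matching_avoiding hT t ?_
  intro s hs
  have h1 : 2 * φ * (2 * s + #Z) ≤ 2 * φ * (4 * t) := Nat.mul_le_mul_left _ (by omega)
  have h2 : 48 * φ * t ≤ D * t := Nat.mul_le_mul_right _ hφD
  have h3 : D * 1 ≤ D * t := Nat.mul_le_mul_left _ ht
  have h4 : 2 * φ * (4 * t) = 8 * (φ * t) := by ring
  have h5 : 48 * φ * t = 48 * (φ * t) := by ring
  have h6 : 0 < φ * t := Nat.mul_pos hφ ht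
  omega

/-- Since `Z` lies in `X` and hence misses `S`, it costs nothing to avoid. This allows the weaker
bound with slack just under `D` in place of 3D/4. -/
theorem supply_of_disjoint {S X : Finset α} {φ m D : ℕ} (hS : ∀ x ∈ S, 2 * degIn G S x ≤ D)
    (hφD : 48 * φ ≤ D) (hSX : Disjoint S X) (h : D * m < ∑ x ∈ S, degIn G S x + D) :
    Supply G φ S X m := by
  refine supply_of_low hS fun T t hTS ht hT hsum Z hZ hZc => ?_
  obtain ⟨Y, ν, h1, h2, -, h4⟩ := exists_matching_avoiding (Z := ∅) hT t (by
    intro s hs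
    rw [Finset.card_empty, add_zero]
    have e1 : 48 * φ * s ≤ D * s := Nat.mul_le_mul_right _ hφD
    have e2 : D * (s + 1) ≤ D * t := Nat.mul_le_mul_left _ hs
    have e3 : 48 * φ * s = 48 * (φ * s) := by ring
    have e4 : 2 * φ * (2 * s) = 4 * (φ * s) := by ring
    have e5 : D * (s + 1) = D * s + D := by ring
    omega)
  exact ⟨Y, ν, h1, h2, Finset.disjoint_of_subset_left (h2.trans hTS)
    (Finset.disjoint_of_subset_right hZ hSX), h4⟩

end RobustPartition

/-! ### Gluing a crossing matching and inner matchings into a path system. -/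

namespace RobustPartition

variable {α : Type*} {G : SimpleGraph α}

theorem IsMatchingOn.mem_iff {X : Finset α} {μ : α → α} (h : IsMatchingOn G X μ) {x y : α}
    (hx : x ∈ X) (hy : y = μ x) : y ∈ X ∧ x = μ y := by
  subst hy
  exact ⟨(h x hx).1, (h x hx).2.1.symm⟩

/-- The union of two matchings, as a graph. -/
def matchingGraph {X X' : Finset α} {μ μ' : α → α} (h : IsMatchingOn G X μ)
    (h' : IsMatchingOn G X' μ') : SimpleGraph α where
  Adj x y := (x ∈ X ∧ y = μ x) ∨ (x ∈ X' ∧ y = μ' x)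
  symm := ⟨by
    rintro x y (⟨hx, hy⟩ | ⟨hx, hy⟩)
    · exact Or.inl (h.mem_iff hx hy)
    · exact Or.inr (h'.mem_iff hx hy)⟩
  loopless := ⟨by
    rintro x (⟨hx, hy⟩ | ⟨hx, hy⟩)
    · exact (h x hx).2.2.ne hy
    · exact (h' x hx).2.2.ne hy⟩

theorem reachable_closed {L : SimpleGraph α} {Q : α → Prop} (hQ : ∀ x y, L.Adj x y → Q x → Q y)
    {x y : α} (h : L.Reachable x y) (hx : Q x) : Q y := by
  obtain ⟨w⟩ := h
  induction w with
  | nil => exact hx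
  | cons hadj _ ih => exact ih (hQ _ _ hadj hx)

open Classical in
/-- If no edge of the matching `μ` between `C` and its complement joins two edges of the
matching `μ'` that have both ends covered by `μ`, then the union of the two matchings is a path
system. If some edge of `μ` meets no such edge, then one of the paths has exactly one end in `C`. -/
theorem exists_pathSystem_of_matchings [Fintype α] {X X' C : Finset α} {μ μ' : α → α}
    (h : IsMatchingOn G X μ) (h' : IsMatchingOn G X' μ')
    (hC : ∀ x ∈ X, (x ∈ C ↔ μ x ∉ C)) (hC' : ∀ x ∈ X', (x ∈ C ↔ μ' x ∈ C))
    (hfull : ∀ x ∈ X, ¬ ((x ∈ X' ∧ μ' x ∈ X) ∧ (μ x ∈ X' ∧ μ' (μ x) ∈ X)))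
    {c : α} (hc : c ∈ X) (hc1 : c ∈ X' → μ' c ∉ X) (hc2 : μ c ∈ X' → μ' (μ c) ∉ X) :
    ∃ P : PathSystem G, P.verts = X ∪ X' ∧ P.endpoints = X \ X' ∪ X' \ X ∧ P.Crosses C := by
  set L := matchingGraph h h' with hL
  have hadj : ∀ x y, L.Adj x y ↔ (x ∈ X ∧ y = μ x) ∨ (x ∈ X' ∧ y = μ' x) := fun _ _ => Iff.rfl
  have hne : ∀ x, x ∈ X → x ∈ X' → μ x ≠ μ' x := by
    intro x hx hx' he
    have h1 := hC x hx
    have h2 := hC' x hx'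
    rw [he] at h1
    tauto
  have hLG : L ≤ G := by
    rintro x y (⟨hx, rfl⟩ | ⟨hx, rfl⟩)
    · exact (h x hx).2.2
    · exact (h' x hx).2.2
  have huniq : ∀ x, (∃! y, L.Adj x y) ↔ (x ∈ X ∧ x ∉ X' ∨ x ∈ X' ∧ x ∉ X) := by
    intro x
    by_cases hx : x ∈ X <;> by_cases hx' : x ∈ X'
    · simp only [hx, hx', not_true_eq_false, and_false, or_self, iff_false]
      rintro ⟨y, -, hy⟩
      exact hne x hx hx' ((hy (μ x) (Or.inl ⟨hx, rfl⟩)).trans (hy (μ' x) (Or.inr ⟨hx', rfl⟩)).symm)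
    · simp [hadj, hx, hx']
    · simp [hadj, hx, hx']
    · simp [hadj, hx, hx', ExistsUnique]
  obtain ⟨P, hP1, hP2, hP3⟩ := exists_pathSystem_of_linearForest L hLG (by
      rintro v a b c (⟨-, rfl⟩ | ⟨-, rfl⟩) (⟨-, rfl⟩ | ⟨-, rfl⟩) (⟨-, rfl⟩ | ⟨-, rfl⟩) <;> simp) (by
      -- A leafless nonempty subgraph would contain both matching edges at each of its nonisolated
      -- vertices. For a `μ`-edge in it, the `μ'`-edges at both ends then have all their ends in
      -- `X`, against `hfull`.
      intro H hH hbot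
      by_contra hno
      have htwo : ∀ x y, H.Adj x y → x ∈ X ∧ x ∈ X' ∧ H.Adj x (μ x) ∧ H.Adj x (μ' x) := by
        intro x y hxy
        have hex : ∃ z, H.Adj x z ∧ z ≠ y := by
          by_contra hcon
          push Not at hcon
          exact hno ⟨x, y, hxy, hcon⟩
        obtain ⟨z, hxz, hzy⟩ := hex
        have e1 := (hadj x y).1 (hH hxy)
        have e2 := (hadj x z).1 (hH hxz)
        rcases e1 with ⟨hx, rfl⟩ | ⟨hx, rfl⟩ <;> rcases e2 with ⟨hx2, rfl⟩ | ⟨hx2, rfl⟩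
        · exact absurd rfl hzy
        · exact ⟨hx, hx2, hxy, hxz⟩
        · exact ⟨hx2, hx, hxz, hxy⟩
        · exact absurd rfl hzy
      obtain ⟨x, y, hxy⟩ : ∃ x y, H.Adj x y := by
        by_contra hcon
        push Not at hcon
        apply hbot
        ext a b
        simp [hcon]
      obtain ⟨x1, x2, x3, x4⟩ := htwo x y hxy
      obtain ⟨y1, y2, y3, y4⟩ := htwo _ _ x3.symm
      exact hfull x x1 ⟨⟨x2, (htwo _ _ x4.symm).1⟩, y2, (htwo _ _ y4.symm).1⟩)
  refine ⟨P, ?_, ?_, ?_⟩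
  · ext v
    rw [hP1, Finset.mem_union]
    constructor
    · rintro ⟨y, ⟨hv, -⟩ | ⟨hv, -⟩⟩
      · exact Or.inl hv
      · exact Or.inr hv
    · rintro (hv | hv)
      · exact ⟨_, Or.inl ⟨hv, rfl⟩⟩
      · exact ⟨_, Or.inr ⟨hv, rfl⟩⟩
  · ext v
    rw [hP2, huniq]
    simp only [Finset.mem_union, Finset.mem_sdiff]
  · have hcv : c ∈ P.verts := (hP1 c).2 ⟨μ c, Or.inl ⟨hc, rfl⟩⟩
    obtain ⟨i, hi⟩ := PathSystem.mem_verts.1 hcv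
    refine ⟨i, fun hiff => ?_⟩
    -- The component of `c` is just the edge from `c` to `μ c` with at most one `μ'`-edge attached
    -- at either end, as those edges leave `X`.
    let Q : α → Prop := fun z => z = c ∨ z = μ c ∨ (c ∈ X' ∧ z = μ' c) ∨
      (μ c ∈ X' ∧ z = μ' (μ c))
    have hQ : ∀ x y, L.Adj x y → Q x → Q y := by
      rintro x y hxy (rfl | rfl | ⟨hcX, rfl⟩ | ⟨hcX, rfl⟩)
      · rcases hxy with ⟨-, rfl⟩ | ⟨hx, rfl⟩
        · exact Or.inr (Or.inl rfl)
        · exact Or.inr (Or.inr (Or.inl ⟨hx, rfl⟩))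
      · rcases hxy with ⟨-, rfl⟩ | ⟨hx, rfl⟩
        · exact Or.inl (h c hc).2.1
        · exact Or.inr (Or.inr (Or.inr ⟨hx, rfl⟩))
      · rcases hxy with ⟨hx, rfl⟩ | ⟨hx, rfl⟩
        · exact absurd hx (hc1 hcX)
        · exact Or.inl (h' c hcX).2.1
      · rcases hxy with ⟨hx, rfl⟩ | ⟨hx, rfl⟩
        · exact absurd hx (hc2 hcX)
        · exact Or.inr (Or.inl (h' _ hcX).2.1)
    have hQf : Q (P.fst i) := reachable_closed hQ
      (hP3 i c hi _ (SimpleGraph.Walk.start_mem_support _)) (Or.inl rfl)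
    have hQs : Q (P.snd i) := reachable_closed hQ
      (hP3 i c hi _ (SimpleGraph.Walk.end_mem_support _)) (Or.inl rfl)
    have hfe := (huniq _).1 ((hP2 _).1 (PathSystem.mem_endpoints.2 ⟨i, Or.inl rfl⟩))
    have hse := (huniq _).1 ((hP2 _).1 (PathSystem.mem_endpoints.2 ⟨i, Or.inr rfl⟩))
    have hcμ := hC c hc
    have hμc := (h c hc).1
    have k1 : c ∈ X' → (c ∈ C ↔ μ' c ∈ C) := hC' c
    have k2 : μ c ∈ X' → (μ c ∈ C ↔ μ' (μ c) ∈ C) := hC' _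
    -- On each side of `C` this component has only one candidate for an endpoint. The two distinct
    -- ends of the path therefore lie on different sides.
    have hkey : ∀ z, Q z → (z ∈ X ∧ z ∉ X' ∨ z ∈ X' ∧ z ∉ X) →
        ((z ∈ C ↔ c ∈ C) → z = if c ∈ X' then μ' c else c) ∧
        (¬ (z ∈ C ↔ c ∈ C) → z = if μ c ∈ X' then μ' (μ c) else μ c) := by
      rintro z (rfl | rfl | ⟨q, rfl⟩ | ⟨q, rfl⟩) hz
      · have : z ∉ X' := hz.elim And.right fun h => absurd hc h.2
        simp [this]
      · have : μ c ∉ X' := hz.elim And.right fun h => absurd hμc h.2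
        exact ⟨fun h => (iff_not_self (hcμ.trans (not_congr h))).elim, fun _ => by simp [this]⟩
      · exact ⟨fun _ => by simp [q], fun h => absurd (k1 q).symm h⟩
      · exact ⟨fun h => (iff_not_self (hcμ.trans (not_congr ((k2 q).trans h)))).elim,
          fun _ => by simp [q]⟩
    have h1 := hkey _ hQf hfe
    have h2 := hkey _ hQs hse
    apply P.fst_ne_snd i
    by_cases hcase : P.fst i ∈ C ↔ c ∈ C
    · rw [h1.1 hcase, h2.1 (hiff.symm.trans hcase)]
    · rw [h1.2 hcase, h2.2 (fun h => hcase (hiff.trans h))]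

/-- Completing edges `ν` on `Y` by edges from each `u ∈ U` to a new vertex. -/
theorem exists_matching_with_leaves {S X U Y : Finset α} {ν : α → α} {φ : ℕ}
    (hUS : U ⊆ S) (hU : ∀ u ∈ U, φ ≤ degIn G S u) (hY : IsMatchingOn G Y ν) (hYS : Y ⊆ S)
    (hYU : Disjoint Y U) (hφ : #X + 2 * #U + #Y ≤ φ) :
    ∃ (X' : Finset α) (μ' : α → α), IsMatchingOn G X' μ' ∧ X' ⊆ S ∧ #X' = 2 * #U + #Y ∧
      ∀ x ∈ X', x ∈ X → μ' x ∈ X → x ∈ Y := by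
  classical
  -- The new vertices avoid `X`, so no completing edge has both ends in `X`; only edges of `Y` can
  -- obstruct.
  obtain ⟨f, hf, hfU⟩ := exists_injOn_neighbors (G := G) (S := S) (U := U) (F := X ∪ U ∪ Y) (by
    intro u hu
    have h1 := hU u hu
    have h2 := Finset.card_union_le (X ∪ U) Y
    have h3 := Finset.card_union_le X U
    omega)
  have hfn : ∀ u ∈ U, f u ∈ S ∧ f u ∉ X ∧ f u ∉ U ∧ f u ∉ Y ∧ G.Adj u (f u) := by
    intro u hu
    obtain ⟨h1, h2, h3⟩ := hfU u hu
    simp only [Finset.mem_union, not_or] at h2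
    exact ⟨h1, h2.1.1, h2.1.2, h2.2, h3⟩
  obtain ⟨ρ, hρ, hρU, hρf⟩ := exists_isMatchingOn_of_injOn (G := G) hf
    (fun u hu => (hfn u hu).2.2.1) (fun u hu => (hfn u hu).2.2.2.2)
  have hUf : Disjoint U (U.image f) := by
    rw [Finset.disjoint_right]
    intro z hz
    obtain ⟨u, hu, rfl⟩ := Finset.mem_image.1 hz
    exact (hfn u hu).2.2.1
  have hYd : Disjoint Y (U ∪ U.image f) := by
    rw [Finset.disjoint_union_right]
    refine ⟨hYU, ?_⟩
    rw [Finset.disjoint_right]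
    intro z hz
    obtain ⟨u, hu, rfl⟩ := Finset.mem_image.1 hz
    exact (hfn u hu).2.2.2.1
  refine ⟨_, _, hY.union hρ hYd, ?_, ?_, ?_⟩
  · refine Finset.union_subset hYS (Finset.union_subset hUS ?_)
    intro z hz
    obtain ⟨u, hu, rfl⟩ := Finset.mem_image.1 hz
    exact (hfn u hu).1
  · rw [Finset.card_union_of_disjoint hYd, Finset.card_union_of_disjoint hUf,
      Finset.card_image_of_injOn hf]
    ring
  · intro x hx hxX hxμ
    by_contra hxY
    simp only [hxY, if_false] at hxμ
    rcases Finset.mem_union.1 ((Finset.mem_union.1 hx).resolve_left hxY) with h | h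
    · rw [hρU x h] at hxμ
      exact (hfn x h).2.1 hxμ
    · obtain ⟨u, hu, rfl⟩ := Finset.mem_image.1 h
      exact (hfn u hu).2.1 hxX

open Classical in
/-- Two families of low edges can be chosen compatibly with a matching `μ`. -/
theorem exists_compatible_low {X S₁ S₂ U₁ U₂ : Finset α} {μ : α → α} {t₁ t₂ : ℕ}
    (h : IsMatchingOn G X μ) (ht : t₁ ≤ t₂)
    (h₁ : ∀ Z ⊆ X, #Z ≤ 2 * t₁ + 1 → ∃ (Y : Finset α) (ν : α → α),
      IsMatchingOn G Y ν ∧ Y ⊆ S₁ ∧ Disjoint Y U₁ ∧ Disjoint Y Z ∧ #Y = 2 * t₁)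
    (h₂ : ∀ Z ⊆ X, #Z ≤ 2 * t₂ + 1 → ∃ (Y : Finset α) (ν : α → α),
      IsMatchingOn G Y ν ∧ Y ⊆ S₂ ∧ Disjoint Y U₂ ∧ Disjoint Y Z ∧ #Y = 2 * t₂)
    {c : α} (hc : c ∈ X) :
    ∃ (Y₁ : Finset α) (ν₁ : α → α) (Y₂ : Finset α) (ν₂ : α → α),
      (IsMatchingOn G Y₁ ν₁ ∧ Y₁ ⊆ S₁ ∧ Disjoint Y₁ U₁ ∧ #Y₁ = 2 * t₁) ∧
      (IsMatchingOn G Y₂ ν₂ ∧ Y₂ ⊆ S₂ ∧ Disjoint Y₂ U₂ ∧ #Y₂ = 2 * t₂) ∧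
      c ∉ Y₁ ∧ μ c ∉ Y₂ ∧ ∀ x ∈ X, ¬ (x ∈ Y₁ ∧ μ x ∈ Y₂) := by
  obtain ⟨Y₁, ν₁, a1, a2, a3, a4, a5⟩ := h₁ {c} (by simpa using hc) (by simp)
  -- The second family avoids the `μ`-partners of the first. These number at most 2t₁ ≤ 2t₂, and the
  -- `+ 1` in `Supply` leaves room for `μ c`.
  obtain ⟨Y₂, ν₂, b1, b2, b3, b4, b5⟩ := h₂ (insert (μ c) ((X ∩ Y₁).image μ)) (by
      intro z hz
      rcases Finset.mem_insert.1 hz with rfl | hz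
      · exact (h c hc).1
      · obtain ⟨x, hx, rfl⟩ := Finset.mem_image.1 hz
        exact (h x (Finset.mem_inter.1 hx).1).1) (by
      have e1 := Finset.card_insert_le (μ c) ((X ∩ Y₁).image μ)
      have e2 : #((X ∩ Y₁).image μ) ≤ #(X ∩ Y₁) := Finset.card_image_le
      have e3 : #(X ∩ Y₁) ≤ #Y₁ := Finset.card_le_card Finset.inter_subset_right
      omega)
  refine ⟨Y₁, ν₁, Y₂, ν₂, ⟨a1, a2, a3, a5⟩, ⟨b1, b2, b3, b5⟩, ?_, ?_, ?_⟩
  · exact Finset.disjoint_singleton_right.1 a4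
  · exact Finset.disjoint_right.1 b4 (Finset.mem_insert_self _ _)
  · rintro x hx ⟨hx1, hx2⟩
    exact Finset.disjoint_right.1 b4 (Finset.mem_insert_of_mem
      (Finset.mem_image_of_mem μ (Finset.mem_inter.2 ⟨hx, hx1⟩))) hx2

open Classical in
/-- A matching between `C` and its complement together with edges inside two sets on either side
of the partition form a path system one of whose paths crosses. -/
theorem exists_pathSystem_of_supply [Fintype α] {X S₁ S₂ C : Finset α} {μ : α → α}
    {φ m₁ m₂ : ℕ} (h : IsMatchingOn G X μ) (hC : ∀ x ∈ X, (x ∈ C ↔ μ x ∉ C))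
    (hne : X.Nonempty) (hS₁ : S₁ ⊆ C) (hS₂ : Disjoint S₂ C) (h₁ : Supply G φ S₁ X m₁)
    (h₂ : Supply G φ S₂ X m₂) (hφ : #X + 2 * m₁ + 2 * m₂ ≤ φ) :
    ∃ (P : PathSystem G) (X₁ X₂ : Finset α), X₁ ⊆ S₁ ∧ X₂ ⊆ S₂ ∧ #X₁ = 2 * m₁ ∧ #X₂ = 2 * m₂ ∧
      P.verts = X ∪ (X₁ ∪ X₂) ∧ P.endpoints = X \ (X₁ ∪ X₂) ∪ (X₁ ∪ X₂) \ X ∧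
      P.Crosses C := by
  obtain ⟨c, hc, hcC⟩ : ∃ c ∈ X, c ∈ C := by
    obtain ⟨c, hc⟩ := hne
    by_cases hcC : c ∈ C
    · exact ⟨c, hc, hcC⟩
    · exact ⟨μ c, (h c hc).1, by_contra fun h' => hcC ((hC c hc).2 h')⟩
  obtain ⟨U₁, t₁, u1, u2, u3, u4⟩ := h₁
  obtain ⟨U₂, t₂, w1, w2, w3, w4⟩ := h₂
  obtain ⟨Y₁, ν₁, Y₂, ν₂, ⟨a1, a2, a3, a4⟩, ⟨b1, b2, b3, b4⟩, hcY₁, hcY₂, hY⟩ :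
      ∃ (Y₁ : Finset α) (ν₁ : α → α) (Y₂ : Finset α) (ν₂ : α → α),
      (IsMatchingOn G Y₁ ν₁ ∧ Y₁ ⊆ S₁ ∧ Disjoint Y₁ U₁ ∧ #Y₁ = 2 * t₁) ∧
      (IsMatchingOn G Y₂ ν₂ ∧ Y₂ ⊆ S₂ ∧ Disjoint Y₂ U₂ ∧ #Y₂ = 2 * t₂) ∧
      c ∉ Y₁ ∧ μ c ∉ Y₂ ∧ ∀ x ∈ X, ¬ (x ∈ Y₁ ∧ μ x ∈ Y₂) := by
    -- The larger family is chosen second; when that reverses the order, `μ c` takes the place of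
    -- `c`.
    rcases le_total t₁ t₂ with ht | ht
    · exact exists_compatible_low h ht u4 w4 hc
    · obtain ⟨Y₂, ν₂, Y₁, ν₁, p1, p2, p3, p4, p5⟩ :=
        exists_compatible_low h ht w4 u4 (h c hc).1
      rw [(h c hc).2.1] at p4
      refine ⟨Y₁, ν₁, Y₂, ν₂, p2, p1, p4, p3, fun x hx hx' => p5 (μ x) (h x hx).1 ?_⟩
      rw [(h x hx).2.1]
      exact hx'.symm
  obtain ⟨X₁, μ₁, c1, c2, c3, c4⟩ := exists_matching_with_leaves (X := X) u1 u3 a1 a2 a3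
    (by omega)
  obtain ⟨X₂, μ₂, d1, d2, d3, d4⟩ := exists_matching_with_leaves (X := X) w1 w3 b1 b2 b3
    (by omega)
  have hX₁C : ∀ x ∈ X₁, x ∈ C := fun x hx => hS₁ (c2 hx)
  have hX₂C : ∀ x ∈ X₂, x ∉ C := fun x hx => Finset.disjoint_left.1 hS₂ (d2 hx)
  have hd : Disjoint X₁ X₂ := Finset.disjoint_left.2 fun x h1 h2 => hX₂C x h2 (hX₁C x h1)
  have hu := c1.union d1 hd
  set μ' : α → α := fun x => if x ∈ X₁ then μ₁ x else μ₂ x with hμ'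
  have hμ₁ : ∀ x ∈ X₁, μ' x = μ₁ x := fun x hx => by simp [hμ', hx]
  have hμ₂ : ∀ x ∈ X₂, μ' x = μ₂ x := fun x hx => by
    simp [hμ', Finset.disjoint_right.1 hd hx]
  have hlow : ∀ x ∈ X, x ∈ X₁ ∪ X₂ → μ' x ∈ X → (x ∈ C ∧ x ∈ Y₁) ∨ (x ∉ C ∧ x ∈ Y₂) := by
    intro x hx hx' hxμ
    rcases Finset.mem_union.1 hx' with h1 | h1
    · rw [hμ₁ x h1] at hxμ
      exact Or.inl ⟨hX₁C x h1, c4 x h1 hx hxμ⟩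
    · rw [hμ₂ x h1] at hxμ
      exact Or.inr ⟨hX₂C x h1, d4 x h1 hx hxμ⟩
  have hcμ : μ c ∉ C := (hC c hc).1 hcC
  obtain ⟨P, hP1, hP2, hP3⟩ := exists_pathSystem_of_matchings (C := C) h hu hC (by
      intro x hx
      rcases Finset.mem_union.1 hx with h1 | h1
      · rw [hμ₁ x h1]
        exact iff_of_true (hX₁C x h1) (hX₁C _ (c1 x h1).1)
      · rw [hμ₂ x h1]
        exact iff_of_false (hX₂C x h1) (hX₂C _ (d1 x h1).1)) (by
      rintro x hx ⟨⟨e1, e2⟩, e3, e4⟩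
      have f1 := hlow x hx e1 e2
      have f2 := hlow (μ x) (h x hx).1 e3 e4
      have f3 := hC x hx
      have f4 := hY x hx
      have f5 := hY (μ x) (h x hx).1
      rw [(h x hx).2.1] at f5
      tauto) hc (by
      intro e1 e2
      have := hlow c hc e1 e2
      tauto) (by
      intro e1 e2
      have := hlow (μ c) (h c hc).1 e1 e2
      tauto)
  exact ⟨P, X₁, X₂, c2, d2, by omega, by omega, hP1, hP2, hP3⟩

end RobustPartition

/-! ### Euler tours of the reduced multigraph. -/

namespace RobustPartition

section Euler

variable {α β : Type*}

/-- The edges of the list `l`, in this order, form a walk from `x` to `y`. -/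
def IsTrail (R : Graph α β) : α → List β → α → Prop
  | x, [], y => x = y
  | x, e :: l, y => ∃ z, R.IsLink e x z ∧ IsTrail R z l y

theorem IsTrail.append {R : Graph α β} {x y z : α} {l l' : List β} (h : IsTrail R x l y)
    (h' : IsTrail R y l' z) : IsTrail R x (l ++ l') z := by
  induction l generalizing x with
  | nil => cases h; exact h'
  | cons e l ih =>
    obtain ⟨w, hw, hw'⟩ := h
    exact ⟨w, hw, ih hw'⟩

theorem isTrail_loops {R : Graph α β} {x : α} {l : List β} (h : ∀ e ∈ l, R.IsLink e x x) :
    IsTrail R x l x := by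
  induction l with
  | nil => rfl
  | cons e l ih =>
    exact ⟨x, h e (by simp), ih fun e' he' => h e' (by simp [he'])⟩

theorem isTrail_alternating {R : Graph α β} {x y : α} {l : List β} (h : ∀ e ∈ l, R.IsLink e x y) :
    IsTrail R x l (if Even l.length then x else y) := by
  induction l generalizing x y with
  | nil => simp [IsTrail]
  | cons e l ih =>
    refine ⟨y, h e (by simp), ?_⟩
    have := ih (x := y) (y := x) fun e' he' => (h e' (by simp [he'])).symm
    convert this using 1
    by_cases hl : Even l.length <;> simp [hl, Nat.even_add_one]

theorem IsTrail.exists_vertices {R : Graph α β} {x y : α} {l : List β} (h : IsTrail R x l y) :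
    ∃ v : Fin (l.length + 1) → α, v 0 = x ∧ v (Fin.last _) = y ∧
      ∀ i : Fin l.length, R.IsLink (l.get i) (v i.castSucc) (v i.succ) := by
  induction l generalizing x with
  | nil => cases h; exact ⟨fun _ => y, rfl, rfl, fun i => i.elim0⟩
  | cons e l ih =>
    obtain ⟨z, hz, hz'⟩ := h
    obtain ⟨v, h0, hl, hv⟩ := ih hz'
    refine ⟨Fin.cons x v, rfl, ?_, ?_⟩
    · exact hl
    · intro i
      induction i using Fin.cases with
      | zero =>
        change R.IsLink e x (v 0)
        rw [h0]; exact hz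
      | succ i => exact hv i

theorem hasEulerTour_of_isTrail {R : Graph α β} {x : α} {l : List β} (hx : R.vertexSet = Set.univ)
    (h : IsTrail R x l x) (hl : l.Nodup) (hall : ∀ e, e ∈ l) : HasEulerTour R := by
  obtain ⟨v, h0, hlast, hv⟩ := h.exists_vertices
  refine ⟨l.length, v, l.get, fun i => by rw [hx]; trivial, h0.trans hlast.symm, hv,
    List.nodup_iff_injective_get.1 hl, ?_⟩
  ext e
  constructor
  · rintro ⟨i, rfl⟩
    exact (hv i).edge_mem
  · intro _
    exact List.mem_iff_get.1 (hall e)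

end Euler

variable {α : Type*} {G : SimpleGraph α}

open Classical in
theorem PathSystem.card_inter_endpoints [Fintype α] (P : PathSystem G) (C : Finset α) :
    #(C ∩ P.endpoints) = ∑ i, ((if P.fst i ∈ C then 1 else 0) + if P.snd i ∈ C then 1 else 0) := by
  have h1 : C ∩ P.endpoints =
      univ.biUnion fun i : Fin P.size => ({P.fst i, P.snd i} : Finset α).filter (· ∈ C) := by
    ext x
    simp only [Finset.mem_inter, PathSystem.mem_endpoints, Finset.mem_biUnion, Finset.mem_filter,
      Finset.mem_insert, Finset.mem_singleton, Finset.mem_univ, true_and]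
    exact ⟨fun ⟨h, i, hi⟩ => ⟨i, hi, h⟩, fun ⟨i, hi, h⟩ => ⟨h, i, hi⟩⟩
  rw [h1, Finset.card_biUnion]
  · refine Finset.sum_congr rfl fun i _ => ?_
    rw [Finset.card_filter, Finset.sum_pair (P.fst_ne_snd i)]
  · intro i _ j _ hij
    refine Finset.disjoint_left.2 ?_
    intro x hx hx'
    simp only [Finset.mem_filter, Finset.mem_insert, Finset.mem_singleton] at hx hx'
    refine hij (P.index_unique (x := x) ?_ ?_)
    · rcases hx.1 with h | h <;> rw [h]
      · exact SimpleGraph.Walk.start_mem_support _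
      · exact SimpleGraph.Walk.end_mem_support _
    · rcases hx'.1 with h | h <;> rw [h]
      · exact SimpleGraph.Walk.start_mem_support _
      · exact SimpleGraph.Walk.end_mem_support _

theorem ClusterPartition.not_mem_cluster_iff (𝒱 : ClusterPartition α 0 2) (x : α) :
    x ∉ 𝒱.cluster (Sum.inr 0) ↔ x ∈ 𝒱.cluster (Sum.inr 1) := by
  constructor
  · intro h
    obtain ⟨X, hX⟩ := 𝒱.cover x
    rcases X with i | i
    · exact i.elim0
    · fin_cases i
      · exact absurd hX h
      · exact hX
  · intro h h'
    have := 𝒱.cluster_unique h h'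
    simp at this

open Classical in
theorem hasEulerTour_reducedGraph [Fintype α] (𝒱 : ClusterPartition α 0 2) (P : PathSystem G)
    (hP : P.Crosses (𝒱.cluster (Sum.inr 0)))
    (heven : Even #(𝒱.cluster (Sum.inr 0) ∩ P.endpoints)) :
    HasEulerTour (reducedGraph 𝒱 P) := by
  set C := 𝒱.cluster (Sum.inr 0) with hC
  have hC' : ∀ x, x ∉ C ↔ x ∈ 𝒱.cluster (Sum.inr 1) := 𝒱.not_mem_cluster_iff
  set K : Finset (Fin P.size) := {i | ¬ (P.fst i ∈ C ↔ P.snd i ∈ C)} with hK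
  -- A path contributes an odd number of endpoints to `C` exactly when it crosses.
  have hKeven : Even #K := by
    rw [P.card_inter_endpoints, Finset.even_sum_iff_even_card_odd] at heven
    convert heven using 2
    rw [hK]
    refine Finset.filter_congr fun i _ => ?_
    by_cases h1 : P.fst i ∈ C <;> by_cases h2 : P.snd i ∈ C <;> simp [h1, h2]
  obtain ⟨c, hc⟩ := hP
  have hcK : c ∈ K := by simp [hK, hc]
  let l0 : List (Fin P.size) := ({i | P.fst i ∈ C ∧ P.snd i ∈ C} : Finset _).toList
  let l1 : List (Fin P.size) := ({i | P.fst i ∉ C ∧ P.snd i ∉ C} : Finset _).toList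
  let lk : List (Fin P.size) := (K.erase c).toList
  have hlink : ∀ i ∈ K, (reducedGraph 𝒱 P).IsLink i (Sum.inr 0) (Sum.inr 1) := by
    intro i hi
    simp only [hK, Finset.mem_filter, Finset.mem_univ, true_and] at hi
    by_cases h1 : P.fst i ∈ C
    · have h2 : P.snd i ∉ C := fun h => hi (iff_of_true h1 h)
      exact Or.inl ⟨h1, (hC' _).1 h2⟩
    · have h2 : P.snd i ∈ C := by
        by_contra h
        exact hi (iff_of_false h1 h)
      exact Or.inr ⟨(hC' _).1 h1, h2⟩
  have t0 : IsTrail (reducedGraph 𝒱 P) (Sum.inr 0) l0 (Sum.inr 0) := isTrail_loops fun e he => by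
    simp only [l0, Finset.mem_toList, Finset.mem_filter, Finset.mem_univ, true_and] at he
    exact Or.inl he
  have t1 : IsTrail (reducedGraph 𝒱 P) (Sum.inr 1) l1 (Sum.inr 1) := isTrail_loops fun e he => by
    simp only [l1, Finset.mem_toList, Finset.mem_filter, Finset.mem_univ, true_and] at he
    exact Or.inl ⟨(hC' _).1 he.1, (hC' _).1 he.2⟩
  have tk : IsTrail (reducedGraph 𝒱 P) (Sum.inr 1) lk (Sum.inr 0) := by
    have := isTrail_alternating (R := reducedGraph 𝒱 P) (x := Sum.inr 1) (y := Sum.inr 0) (l := lk)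
      fun e he => (hlink e (Finset.mem_of_mem_erase (Finset.mem_toList.1 he))).symm
    have hodd : ¬ Even lk.length := by
      rw [Finset.length_toList, Finset.card_erase_of_mem hcK]
      have := Finset.card_pos.2 ⟨c, hcK⟩
      intro h
      rw [Nat.even_sub this] at h
      simp [hKeven] at h
    simpa [hodd] using this
  have tc : IsTrail (reducedGraph 𝒱 P) (Sum.inr 0) [c] (Sum.inr 1) := ⟨_, hlink c hcK, rfl⟩
  -- Traverse all loops at the first vertex, cross by `c`, traverse all loops at the second, and
  -- return by alternating along the remaining crossing edges, which are odd in number.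
  refine hasEulerTour_of_isTrail rfl (t0.append (tc.append (t1.append tk))) ?_ ?_
  · simp only [List.nodup_append, List.nodup_cons, l0, l1, lk, Finset.nodup_toList, hK]
    simp only [Finset.mem_toList, Finset.mem_filter, Finset.mem_erase, List.mem_append,
      List.mem_singleton, Finset.mem_univ, true_and]
    refine ⟨?_, ?_⟩
    · refine ⟨by simp, ?_, ?_⟩
      · rintro a ⟨h1, h2⟩ b ⟨-, h3⟩ rfl
        tauto
      · rintro a rfl b (h | ⟨h, -⟩) rfl
        · tauto
        · exact h rfl
    · rintro a ⟨h1, h2⟩ b (rfl | h | h) rfl <;> tauto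
  · intro e
    simp only [List.mem_append, List.mem_singleton, l0, l1, lk, Finset.mem_toList,
      Finset.mem_filter, Finset.mem_univ, true_and, Finset.mem_erase, hK]
    tauto

/-! ### Surplus and weight, and balancing the endpoints. -/

open Classical in
/-- The surplus of endpoints in `A` over those in `B`. -/
noncomputable def PathSystem.surplus [Fintype α] (P : PathSystem G) (A B : Finset α) : ℤ :=
  #(A ∩ P.endpoints) - #(B ∩ P.endpoints)

open Classical in
/-- The total degree surplus of `A` over `B` in a path system: `2 e(A) - 2 e(B)` plus the difference
between the numbers of edges leaving `A ∪ B` from `A` and from `B`. -/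
noncomputable def PathSystem.weight [Fintype α] (P : PathSystem G) (A B : Finset α) : ℤ :=
  2 * (#(A ∩ P.verts) - #(B ∩ P.verts)) - P.surplus A B

theorem PathSystem.surplus_comm [Fintype α] (P : PathSystem G) (A B : Finset α) :
    P.surplus B A = - P.surplus A B := by
  simp [PathSystem.surplus]

theorem PathSystem.weight_comm [Fintype α] (P : PathSystem G) (A B : Finset α) :
    P.weight B A = - P.weight A B := by
  simp only [PathSystem.weight, PathSystem.surplus]
  ring

/-- Some endpoint lies in `A`; it has a neighbour in `B` off the system, and moving the endpoint
there changes the surplus by -2. The added edge joins `A` to `B`, so its two contributions to the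
weight cancel. -/
theorem PathSystem.exists_step [Fintype α] (P : PathSystem G) {A B : Finset α} (hAB : Disjoint A B)
    (hdeg : ∀ u ∈ A, #P.verts < degIn G B u) (hpos : 0 < P.surplus A B) :
    ∃ P' : PathSystem G, P'.surplus A B = P.surplus A B - 2 ∧ P'.weight A B = P.weight A B ∧
      #P'.verts = #P.verts + 1 ∧
      (∀ A' B' : Finset α, Disjoint A A' → Disjoint A B' → Disjoint B A' → Disjoint B B' →
        P'.surplus A' B' = P.surplus A' B' ∧ P'.weight A' B' = P.weight A' B') ∧
      ∀ C : Finset α, (A ⊆ C ∧ B ⊆ C ∨ Disjoint A C ∧ Disjoint B C) → P.Crosses C →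
        P'.Crosses C := by
  classical
  obtain ⟨x, hx⟩ : (A ∩ P.endpoints).Nonempty := by
    rw [← Finset.card_pos]
    simp only [PathSystem.surplus] at hpos
    omega
  obtain ⟨hxA, hxe⟩ := Finset.mem_inter.1 hx
  obtain ⟨w, hw, hwv⟩ := Finset.exists_mem_notMem_of_card_lt_card (hdeg x hxA)
  obtain ⟨hwB, hadj⟩ := Finset.mem_filter.1 hw
  obtain ⟨P', h1, h2, -, h4⟩ := P.exists_extend hxe hwv hadj
  have hwe : w ∉ P.endpoints := fun h => hwv (P.endpoints_subset_verts h)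
  have hv : ∀ S : Finset α, (#(S ∩ P'.verts) : ℤ) = #(S ∩ P.verts) + if w ∈ S then 1 else 0 := by
    intro S
    rw [h1]
    split_ifs with h
    · rw [Finset.inter_insert_of_mem h, Finset.card_insert_of_notMem (by simp [hwv])]
      push_cast; ring
    · rw [Finset.inter_insert_of_notMem h]; simp
  have he : ∀ S : Finset α, (#(S ∩ P'.endpoints) : ℤ) =
      #(S ∩ P.endpoints) + (if w ∈ S then 1 else 0) - if x ∈ S then 1 else 0 := by
    intro S
    have e1 : (#(S ∩ P.endpoints.erase x) : ℤ) = #(S ∩ P.endpoints) - if x ∈ S then 1 else 0 := by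
      rw [Finset.inter_erase]
      split_ifs with h
      · rw [Finset.card_erase_of_mem (Finset.mem_inter.2 ⟨h, hxe⟩)]
        have := Finset.card_pos.2 ⟨x, Finset.mem_inter.2 ⟨h, hxe⟩⟩
        omega
      · rw [Finset.erase_eq_of_notMem fun h' => h (Finset.mem_inter.1 h').1, sub_zero]
    rw [h2]
    split_ifs at e1 ⊢ with h h'
    · rw [Finset.inter_insert_of_mem h, Finset.card_insert_of_notMem (by simp [hwe])]
      push_cast; omega
    · rw [Finset.inter_insert_of_mem h, Finset.card_insert_of_notMem (by simp [hwe])]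
      push_cast; omega
    · rw [Finset.inter_insert_of_notMem h]; omega
    · rw [Finset.inter_insert_of_notMem h]; omega
  have hxB : x ∉ B := Finset.disjoint_left.1 hAB hxA
  have hwA : w ∉ A := Finset.disjoint_right.1 hAB hwB
  refine ⟨P', ?_, ?_, ?_, ?_, ?_⟩
  · simp only [PathSystem.surplus, he, hxA, hxB, hwA, hwB, if_true, if_false]
    ring
  · simp only [PathSystem.weight, PathSystem.surplus, hv, he, hxA, hxB, hwA, hwB, if_true,
      if_false]
    ring
  · rw [h1, Finset.card_insert_of_notMem hwv]
  · intro A' B' d1 d2 d3 d4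
    have q1 : x ∉ A' := Finset.disjoint_left.1 d1 hxA
    have q2 : x ∉ B' := Finset.disjoint_left.1 d2 hxA
    have q3 : w ∉ A' := Finset.disjoint_left.1 d3 hwB
    have q4 : w ∉ B' := Finset.disjoint_left.1 d4 hwB
    simp [PathSystem.weight, PathSystem.surplus, hv, he, q1, q2, q3, q4]
  · rintro C (⟨c1, c2⟩ | ⟨c1, c2⟩)
    · exact h4 C (iff_of_true (c1 hxA) (c2 hwB))
    · exact h4 C (iff_of_false (Finset.disjoint_left.1 c1 hxA) (Finset.disjoint_left.1 c2 hwB))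

open Classical in
/-- Extending paths within the two bipartite graphs balances the endpoints. -/
theorem PathSystem.exists_balanced [Fintype α] {A₁ B₁ A₂ B₂ : Finset α} {M : ℕ}
    (hd₁ : Disjoint A₁ B₁) (hd₂ : Disjoint A₂ B₂) (hd : Disjoint (A₁ ∪ B₁) (A₂ ∪ B₂))
    (hA₁ : ∀ u ∈ A₁, M < degIn G B₁ u) (hB₁ : ∀ u ∈ B₁, M < degIn G A₁ u)
    (hA₂ : ∀ u ∈ A₂, M < degIn G B₂ u) (hB₂ : ∀ u ∈ B₂, M < degIn G A₂ u)
    (P : PathSystem G) (hw₁ : Even (P.weight A₁ B₁)) (hw₂ : Even (P.weight A₂ B₂))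
    (hM : #P.verts + (P.surplus A₁ B₁).natAbs + (P.surplus A₂ B₂).natAbs ≤ M)
    (hC : P.Crosses (A₁ ∪ B₁)) :
    ∃ P' : PathSystem G, P'.surplus A₁ B₁ = 0 ∧ P'.surplus A₂ B₂ = 0 ∧
      P'.weight A₁ B₁ = P.weight A₁ B₁ ∧ P'.weight A₂ B₂ = P.weight A₂ B₂ ∧ #P'.verts ≤ M ∧
      P'.Crosses (A₁ ∪ B₁) := by
  induction hn : (P.surplus A₁ B₁).natAbs + (P.surplus A₂ B₂).natAbs using
    Nat.strong_induction_on generalizing P with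
  | _ n ih =>
  rw [Finset.disjoint_union_left, Finset.disjoint_union_right, Finset.disjoint_union_right] at hd
  obtain ⟨⟨d1, d2⟩, d3, d4⟩ := hd
  -- As surpluses are even, a step of size 2 towards zero never overshoots: their total absolute
  -- value drops by exactly 2 for each added vertex.
  have hs : ∀ A B : Finset α, Even (P.weight A B) → Even (P.surplus A B) := by
    intro A B h
    simp only [PathSystem.weight] at h
    rwa [Int.even_sub, iff_true_left (even_two_mul _)] at h
  obtain ⟨k₁, hk₁⟩ := hs _ _ hw₁
  obtain ⟨k₂, hk₂⟩ := hs _ _ hw₂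
  have c1 : A₁ ⊆ A₁ ∪ B₁ := Finset.subset_union_left
  have c2 : B₁ ⊆ A₁ ∪ B₁ := Finset.subset_union_right
  have c3 : Disjoint A₂ (A₁ ∪ B₁) := Finset.disjoint_union_right.2 ⟨d1.symm, d3.symm⟩
  have c4 : Disjoint B₂ (A₁ ∪ B₁) := Finset.disjoint_union_right.2 ⟨d2.symm, d4.symm⟩
  have hcont : ∀ P' : PathSystem G, P'.weight A₁ B₁ = P.weight A₁ B₁ →
      P'.weight A₂ B₂ = P.weight A₂ B₂ → #P'.verts = #P.verts + 1 →
      (P'.surplus A₁ B₁).natAbs + (P'.surplus A₂ B₂).natAbs + 2 =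
        (P.surplus A₁ B₁).natAbs + (P.surplus A₂ B₂).natAbs → P'.Crosses (A₁ ∪ B₁) →
      ∃ P' : PathSystem G, P'.surplus A₁ B₁ = 0 ∧ P'.surplus A₂ B₂ = 0 ∧
        P'.weight A₁ B₁ = P.weight A₁ B₁ ∧ P'.weight A₂ B₂ = P.weight A₂ B₂ ∧ #P'.verts ≤ M ∧
        P'.Crosses (A₁ ∪ B₁) := by
    intro P' e1 e2 e3 e4 e5
    obtain ⟨P'', f1, f2, f3, f4, f5, f6⟩ := ih _ (by omega) P' (by rwa [e1]) (by rwa [e2])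
      (by omega) e5 rfl
    exact ⟨P'', f1, f2, f3.trans e1, f4.trans e2, f5, f6⟩
  rcases lt_trichotomy (P.surplus A₁ B₁) 0 with h | h | h
  · obtain ⟨P', e1, e2, e3, e4, e5⟩ := P.exists_step hd₁.symm
      (fun u hu => lt_of_le_of_lt (by omega) (hB₁ u hu)) (by rw [P.surplus_comm]; omega)
    rw [P'.surplus_comm, P.surplus_comm] at e1
    rw [P'.weight_comm, P.weight_comm] at e2
    obtain ⟨f1, f2⟩ := e4 A₂ B₂ d3 d4 d1 d2
    exact hcont P' (by omega) f2 e3 (by omega) (e5 _ (Or.inl ⟨c2, c1⟩) hC)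
  · rcases lt_trichotomy (P.surplus A₂ B₂) 0 with h' | h' | h'
    · obtain ⟨P', e1, e2, e3, e4, e5⟩ := P.exists_step hd₂.symm
        (fun u hu => lt_of_le_of_lt (by omega) (hB₂ u hu)) (by rw [P.surplus_comm]; omega)
      rw [P'.surplus_comm, P.surplus_comm] at e1
      rw [P'.weight_comm, P.weight_comm] at e2
      obtain ⟨f1, f2⟩ := e4 A₁ B₁ d2.symm d4.symm d1.symm d3.symm
      exact hcont P' f2 (by omega) e3 (by omega) (e5 _ (Or.inr ⟨c4, c3⟩) hC)
    · exact ⟨P, h, h', rfl, rfl, by omega, hC⟩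
    · obtain ⟨P', e1, e2, e3, e4, e5⟩ := P.exists_step hd₂
        (fun u hu => lt_of_le_of_lt (by omega) (hA₂ u hu)) h'
      obtain ⟨f1, f2⟩ := e4 A₁ B₁ d1.symm d3.symm d2.symm d4.symm
      exact hcont P' f2 e2 e3 (by omega) (e5 _ (Or.inr ⟨c3, c4⟩) hC)
  · obtain ⟨P', e1, e2, e3, e4, e5⟩ := P.exists_step hd₁
      (fun u hu => lt_of_le_of_lt (by omega) (hA₁ u hu)) h
    obtain ⟨f1, f2⟩ := e4 A₂ B₂ d1 d2 d3 d4
    exact hcont P' e2 f2 e3 (by omega) (e5 _ (Or.inl ⟨c1, c2⟩) hC)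

end RobustPartition

/-! ### Integer rounding, and reduction to finding a crossing matching with signed supplies. -/

namespace RobustPartition

variable {α : Type*} {G : SimpleGraph α}

/-- Simultaneous rounding of a rational solution of `y + z + 2 i₁ = 2 a₁`, `y - z + 2 i₂ = 2 a₂`. -/
theorem exists_rounding {D a₁ a₂ I₁ I₂ P R : ℤ} (hD : 0 < D) (hP : 0 ≤ P) (hR : 0 ≤ R)
    (h₁ : D * a₁ = I₁ + P + R) (h₂ : D * a₂ = I₂ + P - R) :
    ∃ i₁ i₂ y z : ℤ, y + z + 2 * i₁ = 2 * a₁ ∧ y - z + 2 * i₂ = 2 * a₂ ∧ 0 ≤ y ∧ 0 ≤ z ∧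
      D * y < 2 * P + D ∧ D * z < 2 * R + D ∧ D * (y + z) < 2 * (P + R) + D ∧
      (4 * (D * i₁) ≤ 4 * I₁ + 3 * D ∧ 4 * I₁ ≤ 4 * (D * i₁) + 3 * D) ∧
      (4 * (D * i₂) ≤ 4 * I₂ + 3 * D ∧ 4 * I₂ ≤ 4 * (D * i₂) + 3 * D) := by
  -- The integer `i` is (8I + c)/(8D) rounded up, so `c`/8 prescribes the least admissible error Di
  -- - I.
  have hround : ∀ c I : ℤ, ∃ i : ℤ, c ≤ 8 * (D * i - I) ∧ 8 * (D * i - I) < c + 8 * D := by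
    intro c I
    refine ⟨-((-(8 * I + c)) / (8 * D)), ?_⟩
    have e1 := Int.emod_add_mul_ediv (-(8 * I + c)) (8 * D)
    have e2 := Int.emod_nonneg (-(8 * I + c)) (show 8 * D ≠ 0 by omega)
    have e3 := Int.emod_lt_of_pos (-(8 * I + c)) (show 0 < 8 * D by omega)
    have e4 : D * -(-(8 * I + c) / (8 * D)) * 8 = -(8 * D * (-(8 * I + c) / (8 * D))) := by ring
    constructor <;> linarith
  -- The errors e₁ ∈ [-3D/8, 5D/8) and e₂ ∈ [-D/2, D/2) give y and z the errors -e₁ ∓ e₂ ≤ 7D/8, and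
  -- y + z the error -2e₁ ≤ 3D/4, all below D. Only negativity of y or z remains to be repaired.
  obtain ⟨i₁, b1, b2⟩ := hround (-(3 * D)) I₁
  obtain ⟨i₂, c1, c2⟩ := hround (-(4 * D)) I₂
  have hpos : ∀ k : ℤ, -D < D * k → 0 ≤ k := by
    intro k hk
    by_contra hneg
    have : D * k ≤ D * (-1) := mul_le_mul_of_nonneg_left (by omega) hD.le
    linarith
  have hy : D * (a₁ - i₁ + (a₂ - i₂)) = 2 * P - (D * i₁ - I₁) - (D * i₂ - I₂) := by
    linear_combination h₁ + h₂
  have hz : D * (a₁ - i₁ - (a₂ - i₂)) = 2 * R - (D * i₁ - I₁) + (D * i₂ - I₂) := by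
    linear_combination h₁ - h₂
  have hD2 : ∀ k : ℤ, D * (k + 1) = D * k + D := fun k => by ring
  have hD3 : ∀ k : ℤ, D * (k - 1) = D * k - D := fun k => by ring
  by_cases k1 : 0 ≤ a₁ - i₁ + (a₂ - i₂)
  · by_cases k2 : 0 ≤ a₁ - i₁ - (a₂ - i₂)
    · refine ⟨i₁, i₂, a₁ - i₁ + (a₂ - i₂), a₁ - i₁ - (a₂ - i₂), by ring, by ring, k1, k2, ?_, ?_,
        ?_, ⟨?_, ?_⟩, ⟨?_, ?_⟩⟩
      all_goals linarith
    -- Here z = -1. Since y + z is even, y ≥ 1, and raising i₂ by one makes z zero and lowers y by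
    -- one. Negative z forces e₂ < -3D/8, so the new error of i₂ stays within 3D/4.
    · have f1 : D * (a₁ - i₁ - (a₂ - i₂)) ≤ D * (-1) :=
        mul_le_mul_of_nonneg_left (by omega) hD.le
      have f2 := hpos (a₁ - i₁ - (a₂ - i₂) + 1) (by rw [hD2]; linarith)
      have f3 : 0 ≤ a₁ - i₁ + (a₂ - i₂) - 1 := by omega
      have g1 := hD3 (a₁ - i₁ + (a₂ - i₂))
      have g2 := hD2 (a₁ - i₁ - (a₂ - i₂))
      have g3 := hD2 i₂
      refine ⟨i₁, i₂ + 1, a₁ - i₁ + (a₂ - i₂) - 1, a₁ - i₁ - (a₂ - i₂) + 1, by ring, by ring, f3,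
        f2, ?_, ?_, ?_, ⟨?_, ?_⟩, ⟨?_, ?_⟩⟩
      all_goals linarith
  -- The mirror case y = -1: then e₂ > 3D/8, so i₂ can be lowered, and z is odd and nonnegative.
  · have f1 : D * (a₁ - i₁ + (a₂ - i₂)) ≤ D * (-1) :=
      mul_le_mul_of_nonneg_left (by omega) hD.le
    have f2 := hpos (a₁ - i₁ + (a₂ - i₂) + 1) (by rw [hD2]; linarith)
    have f3 := hpos (a₁ - i₁ - (a₂ - i₂)) (by linarith)
    have f4 : 0 ≤ a₁ - i₁ - (a₂ - i₂) - 1 := by omega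
    have g1 := hD2 (a₁ - i₁ + (a₂ - i₂))
    have g2 := hD3 (a₁ - i₁ - (a₂ - i₂))
    have g3 := hD3 i₂
    refine ⟨i₁, i₂ - 1, a₁ - i₁ + (a₂ - i₂) + 1, a₁ - i₁ - (a₂ - i₂) - 1, by ring, by ring, f2,
      f4, ?_, ?_, ?_, ⟨?_, ?_⟩, ⟨?_, ?_⟩⟩
    all_goals linarith

open Classical in
/-- A `D`-regular graph that consists of two nearly bipartite parts `A₁, B₁` and `A₂, B₂` and has
two disjoint edges between them. -/
structure BipartitePair (G : SimpleGraph α) (D K : ℕ) (A₁ B₁ A₂ B₂ : Finset α) : Prop where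
  disjoint_left : Disjoint A₁ B₁
  disjoint_right : Disjoint A₂ B₂
  disjoint : Disjoint (A₁ ∪ B₁) (A₂ ∪ B₂)
  cover : ∀ x, x ∈ A₁ ∪ B₁ ∨ x ∈ A₂ ∪ B₂
  regular : ∀ x, degIn G A₁ x + degIn G B₁ x + (degIn G A₂ x + degIn G B₂ x) = D
  cut_left : ∀ x ∈ A₁ ∪ B₁, degIn G A₂ x + degIn G B₂ x ≤ degIn G A₁ x + degIn G B₁ x
  cut_right : ∀ x ∈ A₂ ∪ B₂, degIn G A₁ x + degIn G B₁ x ≤ degIn G A₂ x + degIn G B₂ x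
  inner_A₁ : ∀ x ∈ A₁, degIn G A₁ x ≤ degIn G B₁ x
  inner_B₁ : ∀ x ∈ B₁, degIn G B₁ x ≤ degIn G A₁ x
  inner_A₂ : ∀ x ∈ A₂, degIn G A₂ x ≤ degIn G B₂ x
  inner_B₂ : ∀ x ∈ B₂, degIn G B₂ x ≤ degIn G A₂ x
  sum_A₁ : ∑ x ∈ A₁, degIn G A₁ x ≤ K * D
  sum_B₁ : ∑ x ∈ B₁, degIn G B₁ x ≤ K * D
  sum_A₂ : ∑ x ∈ A₂, degIn G A₂ x ≤ K * D
  sum_B₂ : ∑ x ∈ B₂, degIn G B₂ x ≤ K * D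
  sum_A₁A₂ : ∑ x ∈ A₂, degIn G A₁ x ≤ K * D
  sum_A₁B₂ : ∑ x ∈ B₂, degIn G A₁ x ≤ K * D
  sum_B₁A₂ : ∑ x ∈ A₂, degIn G B₁ x ≤ K * D
  sum_B₁B₂ : ∑ x ∈ B₂, degIn G B₁ x ≤ K * D
  K_pos : 1 ≤ K
  K_le : 1000 * K ≤ D
  two_edges : ∃ c ∈ A₁ ∪ B₁, ∃ c' ∈ A₁ ∪ B₁, ∃ d ∈ A₂ ∪ B₂, ∃ d' ∈ A₂ ∪ B₂,
    c ≠ c' ∧ d ≠ d' ∧ G.Adj c d ∧ G.Adj c' d'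

open Classical in
/-- There is a small path system with the degree surplus required of a tour. -/
def HasWeightedSystem [Fintype α] (G : SimpleGraph α) (K : ℕ) (A₁ B₁ A₂ B₂ : Finset α) : Prop :=
  ∃ P : PathSystem G, P.weight A₁ B₁ = 2 * (#A₁ - #B₁) ∧ P.weight A₂ B₂ = 2 * (#A₂ - #B₂) ∧
    #P.verts ≤ 16 * K ∧ P.Crosses (A₁ ∪ B₁)

section Symmetry

variable {D K : ℕ} {A₁ B₁ A₂ B₂ : Finset α}

theorem BipartitePair.swap_sides (h : BipartitePair G D K A₁ B₁ A₂ B₂) :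
    BipartitePair G D K B₁ A₁ B₂ A₂ := by
  classical
  have e1 : B₁ ∪ A₁ = A₁ ∪ B₁ := Finset.union_comm _ _
  have e2 : B₂ ∪ A₂ = A₂ ∪ B₂ := Finset.union_comm _ _
  refine ⟨h.1.symm, h.2.symm, ?_, ?_, ?_, ?_, ?_, h.9, h.8, h.11, h.10, h.13, h.12, h.15, h.14,
    h.19, h.18, h.17, h.16, h.K_pos, h.K_le, ?_⟩
  · rw [e1, e2]; exact h.disjoint
  · rw [e1, e2]; exact h.cover
  · intro x; have := h.regular x; omega
  · rw [e1]; intro x hx; have := h.cut_left x hx; omega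
  · rw [e2]; intro x hx; have := h.cut_right x hx; omega
  · rw [e1, e2]; exact h.two_edges

theorem BipartitePair.swap_parts (h : BipartitePair G D K A₁ B₁ A₂ B₂) :
    BipartitePair G D K A₂ B₂ A₁ B₁ := by
  refine ⟨h.2, h.1, h.disjoint.symm, fun x => (h.cover x).symm, ?_, h.7, h.6, h.10, h.11, h.8, h.9,
    h.14, h.15, h.12, h.13, ?_, ?_, ?_, ?_, h.K_pos, h.K_le, ?_⟩
  · intro x; have := h.regular x; omega
  · rw [sum_degIn_comm]; exact h.sum_A₁A₂
  · rw [sum_degIn_comm]; exact h.sum_B₁A₂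
  · rw [sum_degIn_comm]; exact h.sum_A₁B₂
  · rw [sum_degIn_comm]; exact h.sum_B₁B₂
  · obtain ⟨c, hc, c', hc', d, hd, d', hd', h1, h2, h3, h4⟩ := h.two_edges
    exact ⟨d, hd, d', hd', c, hc, c', hc', h2, h1, h3.symm, h4.symm⟩

variable [Fintype α]

theorem HasWeightedSystem.swap_sides (h : HasWeightedSystem G K A₁ B₁ A₂ B₂) :
    HasWeightedSystem G K B₁ A₁ B₂ A₂ := by
  classical
  obtain ⟨P, h1, h2, h3, h4⟩ := h
  refine ⟨P, ?_, ?_, h3, by rwa [Finset.union_comm]⟩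
  · rw [P.weight_comm, h1]; ring
  · rw [P.weight_comm, h2]; ring

theorem HasWeightedSystem.swap_parts (hp : BipartitePair G D K A₁ B₁ A₂ B₂)
    (h : HasWeightedSystem G K A₁ B₁ A₂ B₂) : HasWeightedSystem G K A₂ B₂ A₁ B₁ := by
  classical
  obtain ⟨P, h1, h2, h3, i, hi⟩ := h
  refine ⟨P, h2, h1, h3, i, ?_⟩
  have hc : ∀ x, x ∈ A₂ ∪ B₂ ↔ x ∉ A₁ ∪ B₁ := fun x =>
    ⟨fun h => Finset.disjoint_right.1 hp.disjoint h, fun h => (hp.cover x).resolve_left h⟩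
  rw [hc, hc]
  tauto

end Symmetry

/-- A supply of `|i|` edges, inside `A` if `i ≥ 0` and inside `B` if `i ≤ 0`. -/
def SignedSupply (G : SimpleGraph α) (φ : ℕ) (A B X : Finset α) (i : ℤ) : Prop :=
  ∃ m : ℕ, i = m ∧ Supply G φ A X m ∨ i = -m ∧ Supply G φ B X m

/-- The sign of `i` decides which of the two bounds feeds `supply_of_many`. Both bounds follow when
Di is within 3D/4 of the difference of the two degree sums. -/
theorem signedSupply_of_near {A B X : Finset α} {φ D : ℕ} {i : ℤ}
    (hA : ∀ x ∈ A, 2 * degIn G A x ≤ D) (hB : ∀ x ∈ B, 2 * degIn G B x ≤ D)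
    (hφ : 0 < φ) (hφD : 48 * φ ≤ D)
    (h₁ : 4 * (D * i) ≤ 4 * (∑ x ∈ A, (degIn G A x : ℤ)) + 3 * D)
    (h₂ : -(4 * (D * i)) ≤ 4 * (∑ x ∈ B, (degIn G B x : ℤ)) + 3 * D) :
    SignedSupply G φ A B X i := by
  rcases le_total 0 i with hi | hi
  · obtain ⟨m, rfl⟩ := Int.eq_ofNat_of_zero_le hi
    refine ⟨m, Or.inl ⟨rfl, supply_of_many hA hφ hφD ?_⟩⟩
    exact_mod_cast h₁
  · obtain ⟨m, hm⟩ := Int.eq_ofNat_of_zero_le (show 0 ≤ -i by omega)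
    refine ⟨m, Or.inr ⟨by omega, supply_of_many hB hφ hφD ?_⟩⟩
    have : i = -(m : ℤ) := by omega
    subst this
    have h3 : 4 * ((D : ℤ) * m) ≤ 4 * (∑ x ∈ B, (degIn G B x : ℤ)) + 3 * D := by linarith
    exact_mod_cast h3

open Classical in
-- For a union of edge-disjoint matchings covering `X` and `Y`, both sides are the degree sum over
-- `S`: two per covered vertex, less one per endpoint.
theorem card_inter_sdiff_add (S X Y : Finset α) :
    2 * (#(S ∩ (X ∪ Y)) : ℤ) - #(S ∩ (X \ Y ∪ Y \ X)) = #(S ∩ X) + #(S ∩ Y) := by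
  have h1 : #(S ∩ (X ∪ Y)) + #(S ∩ X ∩ (S ∩ Y)) = #(S ∩ X) + #(S ∩ Y) := by
    rw [Finset.inter_union_distrib_left, Finset.card_union_add_card_inter]
  have h2 : #(S ∩ (X \ Y ∪ Y \ X)) + #(S ∩ X ∩ (S ∩ Y)) = #(S ∩ (X ∪ Y)) := by
    rw [← Finset.card_union_of_disjoint]
    · congr 1
      ext x
      simp only [Finset.mem_union, Finset.mem_inter, Finset.mem_sdiff]
      tauto
    · rw [Finset.disjoint_left]
      intro x
      simp only [Finset.mem_union, Finset.mem_inter, Finset.mem_sdiff]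
      tauto
  omega

open Classical in
-- The crossing edges contribute `#(A ∩ X) - #(B ∩ X)` to the weight, and the inner edges `2 * i`.
-- The size is at most 8K + 4(K + 1) ≤ 16K.
theorem hasWeightedSystem_of_matching [Fintype α] {D K : ℕ} {A₁ B₁ A₂ B₂ X : Finset α}
    {μ : α → α} {i₁ i₂ : ℤ}
    (h : BipartitePair G D K A₁ B₁ A₂ B₂) (hμ : IsMatchingOn G X μ)
    (hC : ∀ x ∈ X, (x ∈ A₁ ∪ B₁ ↔ μ x ∉ A₁ ∪ B₁)) (hX : X.Nonempty) (hXc : #X ≤ 8 * K)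
    (hs₁ : SignedSupply G (16 * K) A₁ B₁ X i₁) (hs₂ : SignedSupply G (16 * K) A₂ B₂ X i₂)
    (hi₁ : |i₁| ≤ K + 1) (hi₂ : |i₂| ≤ K + 1)
    (hw₁ : #(A₁ ∩ X) - #(B₁ ∩ X) + 2 * i₁ = 2 * ((#A₁ : ℤ) - #B₁))
    (hw₂ : #(A₂ ∩ X) - #(B₂ ∩ X) + 2 * i₂ = 2 * ((#A₂ : ℤ) - #B₂)) :
    HasWeightedSystem G K A₁ B₁ A₂ B₂ := by
  have hd := h.disjoint
  rw [Finset.disjoint_union_left, Finset.disjoint_union_right, Finset.disjoint_union_right] at hd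
  obtain ⟨⟨d1, d2⟩, d3, d4⟩ := hd
  have conv : ∀ {A B : Finset α} {i : ℤ}, Disjoint A B → SignedSupply G (16 * K) A B X i →
      |i| ≤ K + 1 →
      ∃ (S : Finset α) (m : ℕ), S ⊆ A ∪ B ∧ Supply G (16 * K) S X m ∧ m ≤ K + 1 ∧
        ∀ Y ⊆ S, #Y = 2 * m → (#(A ∩ Y) : ℤ) - #(B ∩ Y) = 2 * i := by
    rintro A B i hAB ⟨m, ⟨rfl, hm⟩ | ⟨rfl, hm⟩⟩ hi
    · refine ⟨A, m, Finset.subset_union_left, hm, ?_, fun Y hY hYc => ?_⟩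
      · rw [abs_of_nonneg (by omega)] at hi; omega
      · rw [Finset.inter_eq_right.2 hY, Finset.disjoint_iff_inter_eq_empty.1
          (Finset.disjoint_of_subset_right hY hAB.symm)]
        simp [hYc]
    · refine ⟨B, m, Finset.subset_union_right, hm, ?_, fun Y hY hYc => ?_⟩
      · rw [abs_neg, abs_of_nonneg (by omega)] at hi; omega
      · rw [Finset.inter_eq_right.2 hY, Finset.disjoint_iff_inter_eq_empty.1
          (Finset.disjoint_of_subset_right hY hAB)]
        simp [hYc]
  obtain ⟨S₁, m₁, a1, a2, a3, a4⟩ := conv h.disjoint_left hs₁ hi₁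
  obtain ⟨S₂, m₂, b1, b2, b3, b4⟩ := conv h.disjoint_right hs₂ hi₂
  have hK := h.K_pos
  obtain ⟨P, X₁, X₂, p1, p2, p3, p4, p5, p6, p7⟩ := exists_pathSystem_of_supply hμ hC hX a1
    (Finset.disjoint_of_subset_left b1 h.disjoint.symm) a2 b2 (by omega)
  have key : ∀ S : Finset α, 2 * (#(S ∩ P.verts) : ℤ) - #(S ∩ P.endpoints) =
      #(S ∩ X) + #(S ∩ (X₁ ∪ X₂)) := fun S => by rw [p5, p6]; exact card_inter_sdiff_add _ _ _
  have hX₁ : X₁ ⊆ A₁ ∪ B₁ := p1.trans a1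
  have hX₂ : X₂ ⊆ A₂ ∪ B₂ := p2.trans b1
  have k1 : ∀ S ⊆ A₁ ∪ B₁, S ∩ (X₁ ∪ X₂) = S ∩ X₁ := by
    intro S hS
    rw [Finset.inter_union_distrib_left, Finset.disjoint_iff_inter_eq_empty.1
      (Finset.disjoint_of_subset_left hS (Finset.disjoint_of_subset_right hX₂ h.disjoint)),
      Finset.union_empty]
  have k2 : ∀ S ⊆ A₂ ∪ B₂, S ∩ (X₁ ∪ X₂) = S ∩ X₂ := by
    intro S hS
    rw [Finset.inter_union_distrib_left, Finset.disjoint_iff_inter_eq_empty.1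
      (Finset.disjoint_of_subset_left hS (Finset.disjoint_of_subset_right hX₁ h.disjoint.symm)),
      Finset.empty_union]
  refine ⟨P, ?_, ?_, ?_, p7⟩
  · have e1 := key A₁
    have e2 := key B₁
    rw [k1 _ Finset.subset_union_left] at e1
    rw [k1 _ Finset.subset_union_right] at e2
    have e3 := a4 X₁ p1 p3
    simp only [PathSystem.weight, PathSystem.surplus]
    linarith
  · have e1 := key A₂
    have e2 := key B₂
    rw [k2 _ Finset.subset_union_left] at e1
    rw [k2 _ Finset.subset_union_right] at e2
    have e3 := b4 X₂ p2 p4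
    simp only [PathSystem.weight, PathSystem.surplus]
    linarith
  · rw [p5]
    have e1 := Finset.card_union_le X (X₁ ∪ X₂)
    have e2 := Finset.card_union_le X₁ X₂
    omega

open Classical in
theorem exists_crossing_matching {C X : Finset α} {f : α → α} (hf : Set.InjOn f X)
    (hX : ∀ x ∈ X, x ∉ C) (hfX : ∀ x ∈ X, f x ∈ C) (hadj : ∀ x ∈ X, G.Adj x (f x)) :
    ∃ μ : α → α, IsMatchingOn G (X ∪ X.image f) μ ∧
      ∀ x ∈ X ∪ X.image f, (x ∈ C ↔ μ x ∉ C) := by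
  obtain ⟨μ, h1, h2, h3⟩ := exists_isMatchingOn_of_injOn hf
    (fun x hx h => hX _ h (hfX x hx)) hadj
  refine ⟨μ, h1, fun x hx => ?_⟩
  rcases Finset.mem_union.1 hx with h | h
  · rw [h2 x h]
    exact iff_of_false (hX x h) (fun h' => h' (hfX x h))
  · obtain ⟨y, hy, rfl⟩ := Finset.mem_image.1 h
    rw [h3 y hy]
    exact iff_of_true (hfX y hy) (hX y hy)

open Classical in
theorem exists_crossing_pair {C : Finset α} {c c' d d' : α} (hc : c ∈ C) (hc' : c' ∈ C)
    (hd : d ∉ C) (hd' : d' ∉ C) (hcc : c ≠ c') (hdd : d ≠ d') (h : G.Adj c d) (h' : G.Adj c' d') :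
    ∃ (X : Finset α) (μ : α → α), IsMatchingOn G X μ ∧ (∀ x ∈ X, (x ∈ C ↔ μ x ∉ C)) ∧
      X.Nonempty ∧ #X = 4 ∧ (∀ x, x ∈ X ↔ x = c ∨ x = c' ∨ x = d ∨ x = d') ∧
      ∀ S : Finset α, (#(S ∩ X) : ℤ) = (if c ∈ S then 1 else 0) + (if c' ∈ S then 1 else 0) +
        (if d ∈ S then 1 else 0) + (if d' ∈ S then 1 else 0) := by
  let f : α → α := fun z => if z = d then c else c'
  have fd : f d = c := by simp [f]
  have fd' : f d' = c' := by simp [f, hdd.symm]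
  have hall : ∀ p : α → Prop, (∀ x ∈ ({d, d'} : Finset α), p x) ↔ p d ∧ p d' := by
    intro p; simp
  obtain ⟨μ, h1, h2⟩ := exists_crossing_matching (G := G) (C := C) (X := {d, d'}) (f := f) (by
      intro x hx y hy hxy
      simp only [Finset.coe_insert, Finset.coe_singleton, Set.mem_insert_iff,
        Set.mem_singleton_iff] at hx hy
      rcases hx with rfl | rfl <;> rcases hy with rfl | rfl
      · rfl
      · rw [fd, fd'] at hxy; exact absurd hxy hcc
      · rw [fd, fd'] at hxy; exact absurd hxy.symm hcc
      · rfl)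
    ((hall _).2 ⟨hd, hd'⟩) ((hall _).2 ⟨by rwa [fd], by rwa [fd']⟩)
    ((hall _).2 ⟨by rw [fd]; exact h.symm, by rw [fd']; exact h'.symm⟩)
  have hdc : d ≠ c := fun e => hd (e ▸ hc)
  have hdc' : d ≠ c' := fun e => hd (e ▸ hc')
  have hd'c : d' ≠ c := fun e => hd' (e ▸ hc)
  have hd'c' : d' ≠ c' := fun e => hd' (e ▸ hc')
  have hXeq : ({d, d'} : Finset α) ∪ ({d, d'} : Finset α).image f = {c, c', d, d'} := by
    rw [Finset.image_insert, Finset.image_singleton, fd, fd']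
    ext x
    simp only [Finset.mem_union, Finset.mem_insert, Finset.mem_singleton]
    tauto
  rw [hXeq] at h1 h2
  have hsum : ∀ g : α → ℕ, ∑ x ∈ ({c, c', d, d'} : Finset α), g x = g c + g c' + g d + g d' := by
    intro g
    rw [Finset.sum_insert, Finset.sum_insert, Finset.sum_insert, Finset.sum_singleton]
    · ring
    · simpa using hdd
    · simp [hdc'.symm, hd'c'.symm]
    · simp [hcc, hdc.symm, hd'c.symm]
  refine ⟨_, μ, h1, h2, ⟨c, by simp⟩, ?_, by simp, fun S => ?_⟩
  · rw [Finset.card_eq_sum_ones, hsum]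
  · rw [Finset.inter_comm, ← Finset.filter_mem_eq_inter, Finset.card_filter, hsum]
    push_cast
    rfl

end RobustPartition

/-! ### Existence of a path system of the required weight. -/

namespace RobustPartition

variable {α : Type*} {G : SimpleGraph α}

theorem SignedSupply.neg {A B X : Finset α} {φ : ℕ} {i : ℤ} (h : SignedSupply G φ A B X i) :
    SignedSupply G φ B A X (-i) := by
  obtain ⟨m, ⟨rfl, hm⟩ | ⟨rfl, hm⟩⟩ := h
  · exact ⟨m, Or.inr ⟨rfl, hm⟩⟩
  · exact ⟨m, Or.inl ⟨neg_neg _, hm⟩⟩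

/-- When a ≤ 0, one more edge is needed inside `B`, namely 1 - a in all. The positive surplus `w` of
outgoing edges at `A` makes the inequality of `supply_of_disjoint` strict, which is just enough. -/
theorem signedSupply_pred {A B X : Finset α} {φ D : ℕ} {a w : ℤ}
    (hA : ∀ x ∈ A, 2 * degIn G A x ≤ D) (hB : ∀ x ∈ B, 2 * degIn G B x ≤ D)
    (hφ : 0 < φ) (hφD : 48 * φ ≤ D) (hBX : Disjoint B X)
    (ha : D * a = ∑ x ∈ A, (degIn G A x : ℤ) - ∑ x ∈ B, (degIn G B x : ℤ) + w) (hw : 0 < w)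
    (h : 4 * (D * a) ≤ 4 * (∑ x ∈ A, (degIn G A x : ℤ) - ∑ x ∈ B, (degIn G B x : ℤ)) + 3 * D) :
    SignedSupply G φ A B X (a - 1) := by
  have hA0 : 0 ≤ ∑ x ∈ A, (degIn G A x : ℤ) := Finset.sum_nonneg fun _ _ => by positivity
  have hB0 : 0 ≤ ∑ x ∈ B, (degIn G B x : ℤ) := Finset.sum_nonneg fun _ _ => by positivity
  rcases le_or_gt 1 a with h1 | h1
  · obtain ⟨m, hm⟩ := Int.eq_ofNat_of_zero_le (show 0 ≤ a - 1 by omega)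
    refine ⟨m, Or.inl ⟨hm, supply_of_many hA hφ hφD ?_⟩⟩
    have e : (D : ℤ) * m = D * a - D := by rw [← hm]; ring
    have : 4 * ((D : ℤ) * m) ≤ 4 * (∑ x ∈ A, (degIn G A x : ℤ)) + 3 * D := by
      rw [e]; linarith [Int.natCast_nonneg D]
    exact_mod_cast this
  · obtain ⟨m, hm⟩ := Int.eq_ofNat_of_zero_le (show 0 ≤ -(a - 1) by omega)
    refine ⟨m, Or.inr ⟨by omega, supply_of_disjoint hB hφD hBX ?_⟩⟩
    have e : (D : ℤ) * m = D - D * a := by rw [← hm]; ring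
    have : (D : ℤ) * m < ∑ x ∈ B, (degIn G B x : ℤ) + D := by
      rw [e]; linarith
    exact_mod_cast this

open Classical in
-- The hypotheses say P ≥ 0 and R ≥ 0, so the net crossing edges can all be taken at `A₁`.
theorem hasWeightedSystem_of_le [Fintype α] {D K : ℕ} {A₁ B₁ A₂ B₂ : Finset α}
    (h : BipartitePair G D K A₁ B₁ A₂ B₂)
    (hqp : ∑ x ∈ B₂, degIn G B₁ x ≤ ∑ x ∈ A₂, degIn G A₁ x)
    (hsr : ∑ x ∈ A₂, degIn G B₁ x ≤ ∑ x ∈ B₂, degIn G A₁ x) :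
    HasWeightedSystem G K A₁ B₁ A₂ B₂ := by
  have hK := h.K_pos
  have hKD := h.K_le
  have hφ : 0 < 16 * K := by omega
  have hφD : 48 * (16 * K) ≤ D := by omega
  have iA₁ : ∀ x ∈ A₁, 2 * degIn G A₁ x ≤ D := fun x hx => by
    have := h.inner_A₁ x hx; have := h.regular x; omega
  have iB₁ : ∀ x ∈ B₁, 2 * degIn G B₁ x ≤ D := fun x hx => by
    have := h.inner_B₁ x hx; have := h.regular x; omega
  have iA₂ : ∀ x ∈ A₂, 2 * degIn G A₂ x ≤ D := fun x hx => by
    have := h.inner_A₂ x hx; have := h.regular x; omega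
  have iB₂ : ∀ x ∈ B₂, 2 * degIn G B₂ x ≤ D := fun x hx => by
    have := h.inner_B₂ x hx; have := h.regular x; omega
  have hsum : ∀ S : Finset α, (D : ℤ) * #S = ∑ x ∈ S, (degIn G A₁ x : ℤ) +
      ∑ x ∈ S, (degIn G B₁ x : ℤ) + (∑ x ∈ S, (degIn G A₂ x : ℤ) + ∑ x ∈ S, (degIn G B₂ x : ℤ)) := by
    intro S
    simp only [← Finset.sum_add_distrib]
    rw [Finset.sum_congr rfl (g := fun _ => (D : ℤ)) fun x _ => by exact_mod_cast h.regular x]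
    simp [mul_comm]
  have hcomm : ∀ S T : Finset α, ∑ x ∈ S, (degIn G T x : ℤ) = ∑ x ∈ T, (degIn G S x : ℤ) := by
    intro S T
    exact_mod_cast sum_degIn_comm S T
  have sA₁ := hsum A₁
  have sB₁ := hsum B₁
  have sA₂ := hsum A₂
  have sB₂ := hsum B₂
  rw [hcomm A₁ A₂, hcomm A₁ B₂] at sA₁
  rw [hcomm B₁ A₁, hcomm B₁ A₂, hcomm B₁ B₂] at sB₁
  rw [hcomm B₂ A₂] at sB₂
  have KA₁ : ∑ x ∈ A₁, (degIn G A₁ x : ℤ) ≤ K * D := by exact_mod_cast h.sum_A₁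
  have KB₁ : ∑ x ∈ B₁, (degIn G B₁ x : ℤ) ≤ K * D := by exact_mod_cast h.sum_B₁
  have KA₂ : ∑ x ∈ A₂, (degIn G A₂ x : ℤ) ≤ K * D := by exact_mod_cast h.sum_A₂
  have KB₂ : ∑ x ∈ B₂, (degIn G B₂ x : ℤ) ≤ K * D := by exact_mod_cast h.sum_B₂
  have Kp : ∑ x ∈ A₂, (degIn G A₁ x : ℤ) ≤ K * D := by exact_mod_cast h.sum_A₁A₂
  have Kr : ∑ x ∈ B₂, (degIn G A₁ x : ℤ) ≤ K * D := by exact_mod_cast h.sum_A₁B₂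
  have hqp' : ∑ x ∈ B₂, (degIn G B₁ x : ℤ) ≤ ∑ x ∈ A₂, (degIn G A₁ x : ℤ) := by exact_mod_cast hqp
  have hsr' : ∑ x ∈ A₂, (degIn G B₁ x : ℤ) ≤ ∑ x ∈ B₂, (degIn G A₁ x : ℤ) := by exact_mod_cast hsr
  have nonneg : ∀ S T : Finset α, 0 ≤ ∑ x ∈ S, (degIn G T x : ℤ) :=
    fun S T => Finset.sum_nonneg fun _ _ => by positivity
  have nA₁ := nonneg A₁ A₁
  have nB₁ := nonneg B₁ B₁
  have nA₂ := nonneg A₂ A₂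
  have nB₂ := nonneg B₂ B₂
  have np := nonneg A₂ A₁
  have nq := nonneg B₂ B₁
  have nr := nonneg B₂ A₁
  have ns := nonneg A₂ B₁
  have castp : ((∑ x ∈ A₂, degIn G A₁ x : ℕ) : ℤ) = ∑ x ∈ A₂, (degIn G A₁ x : ℤ) := by push_cast; rfl
  have castr : ((∑ x ∈ B₂, degIn G A₁ x : ℕ) : ℤ) = ∑ x ∈ B₂, (degIn G A₁ x : ℤ) := by push_cast; rfl
  have castq : ((∑ x ∈ B₂, degIn G B₁ x : ℕ) : ℤ) = ∑ x ∈ B₂, (degIn G B₁ x : ℤ) := by push_cast; rfl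
  have casts : ((∑ x ∈ A₂, degIn G B₁ x : ℕ) : ℤ) = ∑ x ∈ A₂, (degIn G B₁ x : ℤ) := by push_cast; rfl
  have near₁ : ∀ (X : Finset α) (i : ℤ),
      4 * (D * i) ≤ 4 * (∑ x ∈ A₁, (degIn G A₁ x : ℤ) - ∑ x ∈ B₁, (degIn G B₁ x : ℤ)) + 3 * D →
      4 * (∑ x ∈ A₁, (degIn G A₁ x : ℤ) - ∑ x ∈ B₁, (degIn G B₁ x : ℤ)) ≤ 4 * (D * i) + 3 * D →
      SignedSupply G (16 * K) A₁ B₁ X i := fun X i e1 e2 =>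
    signedSupply_of_near iA₁ iB₁ hφ hφD (by linarith) (by linarith)
  have near₂ : ∀ (X : Finset α) (i : ℤ),
      4 * (D * i) ≤ 4 * (∑ x ∈ A₂, (degIn G A₂ x : ℤ) - ∑ x ∈ B₂, (degIn G B₂ x : ℤ)) + 3 * D →
      4 * (∑ x ∈ A₂, (degIn G A₂ x : ℤ) - ∑ x ∈ B₂, (degIn G B₂ x : ℤ)) ≤ 4 * (D * i) + 3 * D →
      SignedSupply G (16 * K) A₂ B₂ X i := fun X i e1 e2 =>
    signedSupply_of_near iA₂ iB₂ hφ hφD (by linarith) (by linarith)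
  have hDpos : (0 : ℤ) < D := by omega
  have bound : ∀ I i : ℤ, I ≤ K * D → -(K * D : ℤ) ≤ I → 4 * (D * i) ≤ 4 * I + 3 * D →
      4 * I ≤ 4 * (D * i) + 3 * D → |i| ≤ K := by
    intro I i e1 e2 e3 e4
    rw [abs_le]
    constructor
    · by_contra hneg
      have : (D : ℤ) * i ≤ D * (-K - 1) := mul_le_mul_of_nonneg_left (by omega) hDpos.le
      have e : (D : ℤ) * (-K - 1) = -(K * D) - D := by ring
      linarith
    · by_contra hneg
      have : (D : ℤ) * (K + 1) ≤ D * i := mul_le_mul_of_nonneg_left (by omega) hDpos.le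
      have e : (D : ℤ) * (K + 1) = K * D + D := by ring
      linarith
  have hW : ∀ x, x ∈ A₂ ∪ B₂ → x ∉ A₁ ∪ B₁ := fun x hx => Finset.disjoint_right.1 h.disjoint hx
  have mA₁ : ∀ x ∈ A₁, x ∉ B₁ ∧ x ∉ A₂ ∧ x ∉ B₂ := fun x hx => by
    have h1 := Finset.disjoint_left.1 h.disjoint_left hx
    have h2 := Finset.disjoint_left.1 h.disjoint (Finset.mem_union_left _ hx)
    simp only [Finset.mem_union, not_or] at h2
    exact ⟨h1, h2⟩
  have mB₁ : ∀ x ∈ B₁, x ∉ A₁ ∧ x ∉ A₂ ∧ x ∉ B₂ := fun x hx => by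
    have h1 := Finset.disjoint_right.1 h.disjoint_left hx
    have h2 := Finset.disjoint_left.1 h.disjoint (Finset.mem_union_right _ hx)
    simp only [Finset.mem_union, not_or] at h2
    exact ⟨h1, h2⟩
  have mA₂ : ∀ x ∈ A₂, x ∉ B₂ ∧ x ∉ A₁ ∧ x ∉ B₁ := fun x hx => by
    have h1 := Finset.disjoint_left.1 h.disjoint_right hx
    have h2 := hW x (Finset.mem_union_left _ hx)
    simp only [Finset.mem_union, not_or] at h2
    exact ⟨h1, h2⟩
  have mB₂ : ∀ x ∈ B₂, x ∉ A₂ ∧ x ∉ A₁ ∧ x ∉ B₁ := fun x hx => by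
    have h1 := Finset.disjoint_right.1 h.disjoint_right hx
    have h2 := hW x (Finset.mem_union_right _ hx)
    simp only [Finset.mem_union, not_or] at h2
    exact ⟨h1, h2⟩
  obtain ⟨i₁, i₂, y, z, hy1, hz1, hy0, hz0, hy, hz, hyz, ⟨n1, n2⟩, n3, n4⟩ :=
    exists_rounding (D := D) (a₁ := #A₁ - #B₁) (a₂ := #A₂ - #B₂)
      (I₁ := ∑ x ∈ A₁, (degIn G A₁ x : ℤ) - ∑ x ∈ B₁, (degIn G B₁ x : ℤ))
      (I₂ := ∑ x ∈ A₂, (degIn G A₂ x : ℤ) - ∑ x ∈ B₂, (degIn G B₂ x : ℤ))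
      (P := ∑ x ∈ A₂, (degIn G A₁ x : ℤ) - ∑ x ∈ B₂, (degIn G B₁ x : ℤ))
      (R := ∑ x ∈ B₂, (degIn G A₁ x : ℤ) - ∑ x ∈ A₂, (degIn G B₁ x : ℤ))
      hDpos (by linarith) (by linarith) (by rw [mul_sub]; linarith) (by rw [mul_sub]; linarith)
  have bi₁ := bound _ i₁ (by linarith) (by linarith) n1 n2
  have bi₂ := bound _ i₂ (by linarith) (by linarith) n3 n4
  -- If y = z = 0 the rounded solution has no crossing edge, and iⱼ = |Aⱼ| - |Bⱼ| exactly. Two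
  -- disjoint crossing edges have to be inserted.
  by_cases hyz0 : y = 0 ∧ z = 0
  · obtain ⟨rfl, rfl⟩ := hyz0
    obtain rfl : i₁ = #A₁ - #B₁ := by omega
    obtain rfl : i₂ = #A₂ - #B₂ := by omega
    have abs_pred : ∀ a : ℤ, |a| ≤ K → |a - 1| ≤ K + 1 := fun a ha => by
      rw [abs_le] at ha ⊢; omega
    have bp₁ := abs_pred _ bi₁
    have bp₂ := abs_pred _ bi₂
    have bn₂ : |-((#B₂ : ℤ) - #A₂ - 1)| ≤ K + 1 := by
      rw [abs_neg]; exact abs_pred _ (by rwa [abs_sub_comm])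
    have pair : ∀ c c' d d' : α, c ∈ A₁ ∪ B₁ → c' ∈ A₁ ∪ B₁ → d ∈ A₂ ∪ B₂ → d' ∈ A₂ ∪ B₂ →
        c ≠ c' → d ≠ d' → G.Adj c d → G.Adj c' d' → ∀ j₁ j₂ : ℤ,
        (∀ X : Finset α, (∀ x, x ∈ X ↔ x = c ∨ x = c' ∨ x = d ∨ x = d') →
          SignedSupply G (16 * K) A₁ B₁ X j₁) →
        (∀ X : Finset α, (∀ x, x ∈ X ↔ x = c ∨ x = c' ∨ x = d ∨ x = d') →
          SignedSupply G (16 * K) A₂ B₂ X j₂) → |j₁| ≤ K + 1 → |j₂| ≤ K + 1 →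
        ((if c ∈ A₁ then 1 else 0) + (if c' ∈ A₁ then 1 else 0) - (if c ∈ B₁ then 1 else 0)
          - (if c' ∈ B₁ then 1 else 0) + 2 * j₁ = 2 * ((#A₁ : ℤ) - #B₁)) →
        ((if d ∈ A₂ then 1 else 0) + (if d' ∈ A₂ then 1 else 0) - (if d ∈ B₂ then 1 else 0)
          - (if d' ∈ B₂ then 1 else 0) + 2 * j₂ = 2 * ((#A₂ : ℤ) - #B₂)) →
        HasWeightedSystem G K A₁ B₁ A₂ B₂ := by
      intro c c' d d' hc hc' hd hd' hcc hdd had had' j₁ j₂ s1 s2 b1 b2 w1 w2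
      obtain ⟨X, μ, h1, h2, h3, h4, h5, h6⟩ :=
        exists_crossing_pair hc hc' (hW d hd) (hW d' hd') hcc hdd had had'
      have k1 := hW d hd
      have k2 := hW d' hd'
      have k3 := Finset.disjoint_left.1 h.disjoint hc
      have k4 := Finset.disjoint_left.1 h.disjoint hc'
      simp only [Finset.mem_union, not_or] at k1 k2 k3 k4
      refine hasWeightedSystem_of_matching h h1 h2 h3 (by omega) (s1 X h5) (s2 X h5) b1 b2 ?_ ?_
      · rw [h6, h6, ← w1]
        simp only [k1, k2, if_false]
        ring
      · rw [h6, h6, ← w2]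
        simp only [k3, k4, if_false]
        ring
    -- An A₁A₂-edge and a B₁B₂-edge have total weight zero in both parts; the same holds below for
    -- an A₁B₂-edge with a B₁A₂-edge.
    by_cases hpq : 0 < ∑ x ∈ A₂, degIn G A₁ x ∧ 0 < ∑ x ∈ B₂, degIn G B₁ x
    · obtain ⟨d, hd, c, hc, had⟩ := exists_adj_of_sum_degIn_pos hpq.1
      obtain ⟨d', hd', c', hc', had'⟩ := exists_adj_of_sum_degIn_pos hpq.2
      refine pair c c' d d' (mem_union_left _ hc) (mem_union_right _ hc') (mem_union_left _ hd)
        (mem_union_right _ hd') (fun e => (mA₁ c hc).1 (e ▸ hc')) (fun e => (mA₂ d hd).1 (e ▸ hd'))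
        had.symm had'.symm _ _ (fun X _ => near₁ X _ n1 n2) (fun X _ => near₂ X _ n3 n4)
        (by omega) (by omega) ?_ ?_
      · simp [hc, hc', mA₁ c hc, mB₁ c' hc']
      · simp [hd, hd', mA₂ d hd, mB₂ d' hd']
    by_cases hrs : 0 < ∑ x ∈ B₂, degIn G A₁ x ∧ 0 < ∑ x ∈ A₂, degIn G B₁ x
    · obtain ⟨d, hd, c, hc, had⟩ := exists_adj_of_sum_degIn_pos hrs.1
      obtain ⟨d', hd', c', hc', had'⟩ := exists_adj_of_sum_degIn_pos hrs.2
      refine pair c c' d d' (mem_union_left _ hc) (mem_union_right _ hc') (mem_union_right _ hd)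
        (mem_union_left _ hd') (fun e => (mA₁ c hc).1 (e ▸ hc')) (fun e => (mB₂ d hd).1 (e ▸ hd'))
        had.symm had'.symm _ _ (fun X _ => near₁ X _ n1 n2) (fun X _ => near₂ X _ n3 n4)
        (by omega) (by omega) ?_ ?_
      · simp [hc, hc', mA₁ c hc, mB₁ c' hc']
      · simp [hd, hd', mB₂ d hd, mA₂ d' hd']
    -- With no cancelling pair, P, R ≥ 0 forces e(B₁,B₂) = e(B₁,A₂) = 0. All crossing edges start in
    -- A₁, so two disjoint ones have weight 2 in the first part and i₁ drops by one.
    have hq0 : ∑ x ∈ B₂, degIn G B₁ x = 0 := by omega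
    have hs0 : ∑ x ∈ A₂, degIn G B₁ x = 0 := by omega
    rw [hq0, Nat.cast_zero] at castq
    rw [hs0, Nat.cast_zero] at casts
    have hcross : ∀ c d, c ∈ A₁ ∪ B₁ → d ∈ A₂ ∪ B₂ → G.Adj c d → c ∈ A₁ := by
      intro c d hc hd had
      rcases Finset.mem_union.1 hc with hc | hc
      · exact hc
      · rcases Finset.mem_union.1 hd with hd | hd
        · have := sum_degIn_pos hd hc had.symm; omega
        · have := sum_degIn_pos hd hc had.symm; omega
    obtain ⟨c, hc, c', hc', d, hd, d', hd', hcc, hdd, had, had'⟩ := h.two_edges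
    have hcA := hcross c d hc hd had
    have hcA' := hcross c' d' hc' hd' had'
    have hpr : 0 < ∑ x ∈ A₂, (degIn G A₁ x : ℤ) + ∑ x ∈ B₂, (degIn G A₁ x : ℤ) := by
      rw [← castp, ← castr]
      rcases Finset.mem_union.1 hd with hd | hd
      · have := sum_degIn_pos hd hcA had.symm; omega
      · have := sum_degIn_pos hd hcA had.symm; omega
    have pred₁ : ∀ X : Finset α, Disjoint B₁ X →
        SignedSupply G (16 * K) A₁ B₁ X (#A₁ - #B₁ - 1) := fun X hX =>
      signedSupply_pred iA₁ iB₁ hφ hφD hX (by rw [mul_sub]; linarith) hpr n1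
    -- One edge into A₂ and one into B₂ cancel in the second part, leaving i₂ unchanged.
    by_cases hmix : ∃ c ∈ A₁, ∃ c' ∈ A₁, ∃ d ∈ A₂, ∃ d' ∈ B₂, c ≠ c' ∧ G.Adj c d ∧ G.Adj c' d'
    · obtain ⟨c, hc, c', hc', d, hd, d', hd', hcc, had, had'⟩ := hmix
      refine pair c c' d d' (mem_union_left _ hc) (mem_union_left _ hc') (mem_union_left _ hd)
        (mem_union_right _ hd') hcc (fun e => (mA₂ d hd).1 (e ▸ hd')) had had' _ _
        (fun X hX => pred₁ X ?_) (fun X _ => near₂ X _ n3 n4) bp₁ (by omega) ?_ ?_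
      · rw [Finset.disjoint_right]
        intro x hx
        rcases (hX x).1 hx with rfl | rfl | rfl | rfl
        · exact (mA₁ _ hc).1
        · exact (mA₁ _ hc').1
        · exact (mA₂ _ hd).2.2
        · exact (mB₂ _ hd').2.2
      · simp [hc, hc', mA₁ c hc, mA₁ c' hc']; ring
      · simp [hd, hd', mA₂ d hd, mB₂ d' hd']
    push Not at hmix
    rcases Finset.mem_union.1 hd with hdA | hdB
    · have hdA' : d' ∈ A₂ := by
        rcases Finset.mem_union.1 hd' with h' | h'
        · exact h'
        · exact absurd had' (hmix c hcA c' hcA' d hdA d' h' hcc had)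
      -- An edge between A₁ and B₂ would form a mixed pair with whichever of the two chosen edges
      -- has a different end in A₁.
      have hr0 : ∑ x ∈ B₂, degIn G A₁ x = 0 := by
        by_contra hr
        obtain ⟨f, hf, e, he, hfe⟩ := exists_adj_of_sum_degIn_pos (Nat.pos_of_ne_zero hr)
        by_cases hce : c = e
        · exact hmix c' hcA' e he d' hdA' f hf (fun h' => hcc (hce.trans h'.symm)) had' hfe.symm
        · exact hmix c hcA e he d hdA f hf hce had hfe.symm
      rw [hr0, Nat.cast_zero] at castr
      have hp : 0 < ∑ x ∈ A₂, (degIn G A₁ x : ℤ) := by omega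
      refine pair c c' d d' hc hc' hd hd' hcc hdd had had' _ (#A₂ - #B₂ - 1)
        (fun X hX => pred₁ X ?_) (fun X hX => signedSupply_pred iA₂ iB₂ hφ hφD ?_ (by
          rw [mul_sub]; linarith) hp n3) bp₁ bp₂ ?_ ?_
      · rw [Finset.disjoint_right]
        intro x hx
        rcases (hX x).1 hx with rfl | rfl | rfl | rfl
        · exact (mA₁ _ hcA).1
        · exact (mA₁ _ hcA').1
        · exact (mA₂ _ hdA).2.2
        · exact (mA₂ _ hdA').2.2
      · rw [Finset.disjoint_right]
        intro x hx
        rcases (hX x).1 hx with rfl | rfl | rfl | rfl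
        · exact (mA₁ _ hcA).2.2
        · exact (mA₁ _ hcA').2.2
        · exact (mA₂ _ hdA).1
        · exact (mA₂ _ hdA').1
      · simp [hcA, hcA', mA₁ c hcA, mA₁ c' hcA']; ring
      · simp [hdA, hdA', mA₂ d hdA, mA₂ d' hdA']; ring
    · have hdB' : d' ∈ B₂ := by
        rcases Finset.mem_union.1 hd' with h' | h'
        · exact absurd had (hmix c' hcA' c hcA d' h' d hdB hcc.symm had')
        · exact h'
      have hp0 : ∑ x ∈ A₂, degIn G A₁ x = 0 := by
        by_contra hr
        obtain ⟨f, hf, e, he, hfe⟩ := exists_adj_of_sum_degIn_pos (Nat.pos_of_ne_zero hr)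
        by_cases hce : e = c
        · exact hmix e he c' hcA' f hf d' hdB' (fun h' => hcc (hce.symm.trans h')) hfe.symm had'
        · exact hmix e he c hcA f hf d hdB hce hfe.symm had
      rw [hp0, Nat.cast_zero] at castp
      have hr : 0 < ∑ x ∈ B₂, (degIn G A₁ x : ℤ) := by omega
      -- Both edges end in B₂, so i₂ has to grow by one; this is the decrease by one with A₂ and B₂
      -- exchanged.
      refine pair c c' d d' hc hc' hd hd' hcc hdd had had' _ (-(#B₂ - #A₂ - 1))
        (fun X hX => pred₁ X ?_) (fun X hX => (signedSupply_pred iB₂ iA₂ hφ hφD ?_ (by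
          rw [mul_sub]; linarith) hr (by linarith)).neg) bp₁ bn₂ ?_ ?_
      · rw [Finset.disjoint_right]
        intro x hx
        rcases (hX x).1 hx with rfl | rfl | rfl | rfl
        · exact (mA₁ _ hcA).1
        · exact (mA₁ _ hcA').1
        · exact (mB₂ _ hdB).2.2
        · exact (mB₂ _ hdB').2.2
      · rw [Finset.disjoint_right]
        intro x hx
        rcases (hX x).1 hx with rfl | rfl | rfl | rfl
        · exact (mA₁ _ hcA).2.1
        · exact (mA₁ _ hcA').2.1
        · exact (mB₂ _ hdB).1
        · exact (mB₂ _ hdB').1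
      · simp [hcA, hcA', mA₁ c hcA, mA₁ c' hcA']; ring
      · simp [hdB, hdB', mB₂ d hdB, mB₂ d' hdB']; ring
  · obtain ⟨y, rfl⟩ := Int.eq_ofNat_of_zero_le hy0
    obtain ⟨z, rfl⟩ := Int.eq_ofNat_of_zero_le hz0
    have hsumU : ∑ x ∈ A₂ ∪ B₂, degIn G A₁ x =
        ∑ x ∈ A₂, degIn G A₁ x + ∑ x ∈ B₂, degIn G A₁ x := Finset.sum_union h.disjoint_right
    obtain ⟨R, hR, S, hS, f, hRc, hSc, hf, hfA⟩ := exists_matching_of_sum_degIn (G := G) (A := A₁)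
      (R := A₂) (S := B₂) (D := D) (y := y) (z := z) h.disjoint_right
      (fun a ha => by
        rw [degIn_union h.disjoint_right]
        have := h.cut_left a (mem_union_left _ ha)
        have := h.regular a
        omega)
      (fun x hx => by
        have := h.cut_right x hx
        have := h.regular x
        omega)
      (by zify; rw [← castp] at *; linarith) (by zify; rw [← castr] at *; linarith)
      (by rw [hsumU]; zify; linarith)
    have hRS : R ∪ S ⊆ A₂ ∪ B₂ := Finset.union_subset_union hR hS
    have hRSd : Disjoint R S :=
      Finset.disjoint_of_subset_left hR (Finset.disjoint_of_subset_right hS h.disjoint_right)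
    obtain ⟨μ, h1, h2⟩ := exists_crossing_matching (C := A₁ ∪ B₁) hf (fun x hx => hW x (hRS hx))
      (fun x hx => mem_union_left _ (hfA x hx).1) (fun x hx => (hfA x hx).2)
    have him : (R ∪ S).image f ⊆ A₁ := by
      intro x hx
      obtain ⟨u, hu, rfl⟩ := Finset.mem_image.1 hx
      exact (hfA u hu).1
    have himc : #((R ∪ S).image f) = y + z := by
      rw [Finset.card_image_of_injOn hf, Finset.card_union_of_disjoint hRSd, hRc, hSc]
    have xA₁ : A₁ ∩ (R ∪ S ∪ (R ∪ S).image f) = (R ∪ S).image f := by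
      ext x
      simp only [Finset.mem_inter, Finset.mem_union]
      refine ⟨fun hx => ?_, fun hx => ⟨him hx, Or.inr hx⟩⟩
      refine hx.2.resolve_left fun h' => ?_
      exact hW x (hRS (Finset.mem_union.2 h')) (mem_union_left _ hx.1)
    have xB₁ : B₁ ∩ (R ∪ S ∪ (R ∪ S).image f) = ∅ := by
      refine Finset.eq_empty_of_forall_notMem fun x hx => ?_
      obtain ⟨hx1, hx2⟩ := Finset.mem_inter.1 hx
      rcases Finset.mem_union.1 hx2 with h' | h'
      · exact hW x (hRS h') (mem_union_right _ hx1)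
      · exact (mA₁ x (him h')).1 hx1
    have xA₂ : A₂ ∩ (R ∪ S ∪ (R ∪ S).image f) = R := by
      ext x
      simp only [Finset.mem_inter, Finset.mem_union]
      refine ⟨?_, fun hx => ⟨hR hx, Or.inl (Or.inl hx)⟩⟩
      rintro ⟨hx1, (hx2 | hx2) | hx2⟩
      · exact hx2
      · exact absurd (hS hx2) (mA₂ x hx1).1
      · exact absurd (him hx2) (mA₂ x hx1).2.1
    have xB₂ : B₂ ∩ (R ∪ S ∪ (R ∪ S).image f) = S := by
      ext x
      simp only [Finset.mem_inter, Finset.mem_union]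
      refine ⟨?_, fun hx => ⟨hS hx, Or.inl (Or.inr hx)⟩⟩
      rintro ⟨hx1, (hx2 | hx2) | hx2⟩
      · exact absurd (hR hx2) (mB₂ x hx1).1
      · exact hx2
      · exact absurd (him hx2) (mB₂ x hx1).2.1
    have small : ∀ (k : ℕ) (Q q : ℤ), (D : ℤ) * k < 2 * (Q - q) + D → Q ≤ K * D → 0 ≤ q →
        k ≤ 2 * K := by
      intro k Q q e1 e2 e3
      by_contra hk
      have : (D : ℤ) * (2 * K + 1) ≤ D * k := mul_le_mul_of_nonneg_left (by omega) hDpos.le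
      have e : (D : ℤ) * (2 * K + 1) = 2 * (K * D) + D := by ring
      linarith
    have hy2 := small y _ _ hy Kp nq
    have hz2 := small z _ _ hz Kr ns
    refine hasWeightedSystem_of_matching h h1 h2 ?_ ?_ (near₁ _ i₁ n1 n2) (near₂ _ i₂ n3 n4)
      (by omega) (by omega) ?_ ?_
    · have : 0 < #((R ∪ S).image f) := by omega
      exact (Finset.card_pos.1 this).mono Finset.subset_union_right
    · refine (Finset.card_union_le _ _).trans ?_
      rw [himc, Finset.card_union_of_disjoint hRSd]
      omega
    · rw [xA₁, xB₁, himc, Finset.card_empty]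
      push_cast
      linarith
    · rw [xA₂, xB₂, hRc, hSc]
      linarith

/-- Exchanging the sides reverses the signs of both P and R, and exchanging the parts reverses that
of R alone, so every sign pattern reduces to P, R ≥ 0. -/
theorem BipartitePair.hasWeightedSystem [Fintype α] {D K : ℕ} {A₁ B₁ A₂ B₂ : Finset α}
    (h : BipartitePair G D K A₁ B₁ A₂ B₂) : HasWeightedSystem G K A₁ B₁ A₂ B₂ := by
  have c := fun S T : Finset α => sum_degIn_comm (G := G) S T
  rcases le_total (∑ x ∈ B₂, degIn G B₁ x) (∑ x ∈ A₂, degIn G A₁ x) with h1 | h1 <;>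
    rcases le_total (∑ x ∈ A₂, degIn G B₁ x) (∑ x ∈ B₂, degIn G A₁ x) with h2 | h2
  · exact hasWeightedSystem_of_le h h1 h2
  · refine (hasWeightedSystem_of_le h.swap_parts ?_ ?_).swap_parts h.swap_parts
    · rw [c B₁, c A₁]; exact h1
    · rw [c A₁ B₂, c B₁ A₂]; exact h2
  · refine (HasWeightedSystem.swap_parts h.swap_sides.swap_parts
      (hasWeightedSystem_of_le h.swap_sides.swap_parts ?_ ?_)).swap_sides
    · rw [c A₁, c B₁]; exact h1
    · rw [c B₁ A₂, c A₁ B₂]; exact h2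
  · exact (hasWeightedSystem_of_le h.swap_sides h1 h2).swap_sides

end RobustPartition

/-! ### From robust partitions to bipartite pairs, the constants, and the conclusion. -/

namespace RobustPartition

variable {α : Type*} {G : SimpleGraph α}

open Classical in
-- The factor 2 is needed because `S` and `T` may overlap, and then an edge can be counted from both
-- ends.
theorem sum_degIn_le_two_mul_edgesBetween [Fintype α] (S T : Finset α) :
    ∑ x ∈ S, degIn G T x ≤ 2 * edgesBetween G S T := by
  have h1 : ∑ x ∈ S, degIn G T x = #{q ∈ S ×ˢ T | G.Adj q.1 q.2} := by
    rw [Finset.card_filter, Finset.sum_product]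
    exact Finset.sum_congr rfl fun x _ => degIn_eq_sum _ _
  rw [h1]
  refine Finset.card_le_mul_card_image_of_maps_to (f := fun q : α × α => s(q.1, q.2)) ?_ 2 ?_
  · rintro ⟨x, y⟩ hq
    simp only [Finset.mem_filter, Finset.mem_product] at hq
    simp only [Finset.mem_filter, Finset.mem_univ, true_and, SimpleGraph.mem_edgeSet]
    exact ⟨hq.2, x, hq.1.1, y, hq.1.2, rfl⟩
  · rintro e -
    induction e using Sym2.inductionOn with
    | _ a b =>
      refine (Finset.card_le_card (t := {(a, b), (b, a)}) ?_).trans Finset.card_le_two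
      rintro ⟨x, y⟩ hq
      simp only [Finset.mem_filter, Sym2.eq_iff] at hq
      simpa using hq.2

theorem edgesBetween_mono [Fintype α] (S : Finset α) {T T' : Finset α} (h : T ⊆ T') :
    edgesBetween G S T ≤ edgesBetween G S T' := by
  refine Finset.card_le_card fun e he => ?_
  simp only [Finset.mem_filter, Finset.mem_univ, true_and] at he ⊢
  obtain ⟨h1, s, hs, t, ht, h2⟩ := he
  exact ⟨h1, s, hs, t, h ht, h2⟩

theorem subset_outside [Fintype α] {S T : Finset α} (h : Disjoint S T) : S ⊆ outside T := by
  intro x hx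
  simp [outside, Finset.disjoint_left.1 h hx]

theorem exists_adj_of_connected {S C : Finset α} (h : (G.induce {x | x ∉ S}).Connected)
    (h1 : ∃ x ∈ C, x ∉ S) (h2 : ∃ x, x ∉ C ∧ x ∉ S) :
    ∃ c ∈ C, ∃ d, d ∉ C ∧ c ∉ S ∧ d ∉ S ∧ G.Adj c d := by
  by_contra hno
  push Not at hno
  obtain ⟨x, hxC, hxS⟩ := h1
  obtain ⟨y, hyC, hyS⟩ := h2
  refine hyC (reachable_closed (Q := fun z : {x | x ∉ S} => z.1 ∈ C) ?_
    (h.preconnected ⟨x, hxS⟩ ⟨y, hyS⟩) hxC)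
  rintro ⟨a, ha⟩ ⟨b, hb⟩ hab haC
  by_contra hbC
  exact hno a haC b hbC ha hb hab

/-- A 3-connected graph has two disjoint edges across every partition into sets of size at
least two. -/
theorem IsKConnected.exists_two_edges [Fintype α] (h : IsKConnected G 3) {C C' : Finset α}
    (hC : ∀ x, x ∉ C ↔ x ∈ C') (h1 : ∀ c, ∃ x ∈ C, x ≠ c) (h2 : ∀ d, ∃ x ∈ C', x ≠ d) :
    ∃ c ∈ C, ∃ c' ∈ C, ∃ d ∈ C', ∃ d' ∈ C', c ≠ c' ∧ d ≠ d' ∧ G.Adj c d ∧ G.Adj c' d' := by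
  classical
  have hne : Nonempty α := Fintype.card_pos_iff.1 (by have := h.1; omega)
  obtain ⟨a⟩ := hne
  obtain ⟨x, hx, -⟩ := h1 a
  obtain ⟨y, hy, -⟩ := h2 a
  obtain ⟨c, hc, d, hd, -, -, hcd⟩ := exists_adj_of_connected (C := C) (h.2 ∅ (by simp))
    ⟨x, hx, by simp⟩ ⟨y, (hC y).2 hy, by simp⟩
  obtain ⟨x, hx, hxc⟩ := h1 c
  obtain ⟨y, hy, hyd⟩ := h2 d
  -- Deleting both ends of the first edge leaves a connected graph that still meets both sides.
  obtain ⟨c', hc', d', hd', h3, h4, hcd'⟩ := exists_adj_of_connected (C := C)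
    (h.2 {c, d} (lt_of_le_of_lt Finset.card_le_two (by norm_num)))
    ⟨x, hx, by
      simp only [Finset.mem_insert, Finset.mem_singleton, not_or]
      exact ⟨hxc, fun e => hd (e ▸ hx)⟩⟩
    ⟨y, (hC y).2 hy, by
      simp only [Finset.mem_insert, Finset.mem_singleton, not_or]
      exact ⟨fun e => (hC y).2 hy (e ▸ hc), hyd⟩⟩
  simp only [Finset.mem_insert, Finset.mem_singleton, not_or] at h3 h4
  exact ⟨c, hc, c', hc', d, (hC d).1 hd, d', (hC d').1 hd', fun e => h3.1 e.symm,
    fun e => h4.2 e.symm, hcd, hcd'⟩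

/-- The numerical consequences of the hierarchy of constants. -/
theorem exists_bound {n D : ℕ} {ρ ν τ a : ℝ} (hn : 0 < n) (hρ : 0 < ρ) (hν : 0 < ν) (hτ : 0 < τ)
    (ha : 0 < a) (ha1 : a < 1) (h1 : τ ≤ a ^ 3 / 10 ^ 6) (h2 : ν ≤ τ ^ 3 / 10 ^ 6)
    (h3 : ρ ≤ ν ^ 3 / 10 ^ 6) (h4 : 1 / (n : ℝ) ≤ ρ ^ 3 / 10 ^ 6) (hD : a * n ≤ D) :
    ∃ K : ℕ, 1 ≤ K ∧ 1000 * K ≤ D ∧ 2 * (ρ * (n : ℝ) ^ 2) ≤ K * D ∧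
      32 * (K : ℝ) ≤ ρ ^ (1 / 3 : ℝ) * n := by
  have hn' : (0 : ℝ) < n := by exact_mod_cast hn
  have cube_le : ∀ x : ℝ, 0 < x → x < 1 → x ^ 3 / 10 ^ 6 ≤ x := by
    intro x hx hx1
    have : x ^ 3 ≤ x := by simpa using pow_le_pow_of_le_one hx.le hx1.le (show 1 ≤ 3 by norm_num)
    have h0 : 0 < x ^ 3 := by positivity
    linarith [div_le_self h0.le (show (1 : ℝ) ≤ 10 ^ 6 by norm_num)]
  have hτa : τ ≤ a := h1.trans (cube_le a ha ha1)
  have hντ : ν ≤ τ := h2.trans (cube_le τ hτ (by linarith))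
  have hρa : ρ ≤ a ^ 3 / 10 ^ 6 := by
    have : ν ^ 3 ≤ a ^ 3 := pow_le_pow_left₀ hν.le (by linarith) 3
    linarith
  set w : ℝ := ρ ^ (1 / 3 : ℝ) with hw
  have hw0 : 0 < w := Real.rpow_pos_of_pos hρ _
  have hw3 : w ^ 3 = ρ := by
    rw [hw, ← Real.rpow_natCast, ← Real.rpow_mul hρ.le]
    norm_num
  have hwa : w ≤ a / 100 := by
    refine le_of_pow_le_pow_left₀ (n := 3) (by norm_num) (by positivity) ?_
    rw [hw3, div_pow]
    norm_num at hρa ⊢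
    exact hρa
  have hw1 : w ≤ 1 / 100 := by linarith
  have hwn : 10 ^ 6 ≤ w * n := by
    have e1 : 10 ^ 6 ≤ ρ ^ 3 * n := by
      rw [div_le_div_iff₀ hn' (by norm_num)] at h4
      linarith
    have e2 : ρ ^ 3 ≤ w := by
      rw [← hw3, ← pow_mul]
      simpa using pow_le_pow_of_le_one hw0.le (by linarith : w ≤ 1) (show 1 ≤ 3 * 3 by norm_num)
    nlinarith
  have hq : 2 * ρ * n / a ≤ w * (w * n) / 50 := by
    rw [div_le_iff₀ ha, ← hw3]
    have : 0 ≤ w * w * n := by positivity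
    nlinarith
  -- As D ≥ an, this `K` makes KD an upper bound for 2ρn², the bound for the sparse degree sums.
  -- With w = ρ^(1/3) ≤ a/100 it is about 2w³n/a ≤ w²n/50, far below both D and wn.
  refine ⟨⌈2 * ρ * n / a⌉₊, Nat.ceil_pos.2 (by positivity), ?_, ?_, ?_⟩
  · have hK := Nat.ceil_lt_add_one (show 0 ≤ 2 * ρ * n / a by positivity)
    have e1 : w * (w * n) ≤ 1 / 100 * (w * n) := by gcongr
    have e2 : w * n ≤ a / 100 * n := by gcongr
    have : (1000 * (⌈2 * ρ * n / a⌉₊ : ℝ)) ≤ D := by linarith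
    exact_mod_cast this
  · have hK := Nat.le_ceil (2 * ρ * n / a)
    calc 2 * (ρ * (n : ℝ) ^ 2) = (2 * ρ * n / a) * (a * n) := by field_simp
      _ ≤ _ := by gcongr
  · have hK := Nat.ceil_lt_add_one (show 0 ≤ 2 * ρ * n / a by positivity)
    have e1 : w * (w * n) ≤ 1 / 100 * (w * n) := by gcongr
    linarith

open Classical in
theorem IsRobustPartition.bipartitePair [Fintype α] [DecidableRel G.Adj] {D K : ℕ} {ρ ν τ : ℝ}
    {𝒱 : ClusterPartition α 0 2} (h : IsRobustPartition G D ρ ν τ 𝒱) (hG : IsKConnected G 3)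
    (hreg : G.IsRegularOfDegree D) (hK : 1 ≤ K) (hKD : 1000 * K ≤ D)
    (hρ : 2 * (ρ * (Fintype.card α : ℝ) ^ 2) ≤ K * D) :
    BipartitePair G D K (𝒱.A 0) (𝒱.B 0) (𝒱.A 1) (𝒱.B 1) := by
  have hd₁ := 𝒱.disjoint_bipartition 0
  have hd₂ := 𝒱.disjoint_bipartition 1
  have hcl := 𝒱.not_mem_cluster_iff
  have hd : Disjoint (𝒱.A 0 ∪ 𝒱.B 0) (𝒱.A 1 ∪ 𝒱.B 1) :=
    Finset.disjoint_right.2 fun x hx => (hcl x).2 hx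
  have hcov : ∀ x, x ∈ 𝒱.A 0 ∪ 𝒱.B 0 ∨ x ∈ 𝒱.A 1 ∪ 𝒱.B 1 := fun x =>
    (Classical.em (x ∈ 𝒱.A 0 ∪ 𝒱.B 0)).imp_right fun hx => (hcl x).1 hx
  have hd' := hd
  rw [Finset.disjoint_union_left, Finset.disjoint_union_right, Finset.disjoint_union_right] at hd'
  obtain ⟨⟨d1, d2⟩, d3, d4⟩ := hd'
  have hn : (0 : ℝ) < Fintype.card α := by
    have := hG.1
    exact_mod_cast (show 0 < Fintype.card α by omega)
  have hpos : 0 < √ρ * Fintype.card α := mul_pos (Real.sqrt_pos.2 h.rho_pos) hn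
  have hA : ∀ j, (𝒱.A j).Nonempty := fun j => by
    rw [← Finset.card_pos]
    exact_mod_cast hpos.trans_le (h.bipartite j).1.card_left
  have hB : ∀ j, (𝒱.B j).Nonempty := fun j => by
    rw [← Finset.card_pos]
    exact_mod_cast hpos.trans_le (h.bipartite j).1.card_right
  have hother : ∀ j c, ∃ x ∈ 𝒱.A j ∪ 𝒱.B j, x ≠ c := by
    intro j c
    obtain ⟨u, hu⟩ := hA j
    obtain ⟨v, hv⟩ := hB j
    by_cases huc : u = c
    · exact ⟨v, mem_union_right _ hv, fun e =>
        Finset.disjoint_left.1 (𝒱.disjoint_bipartition j) hu (huc.trans e.symm ▸ hv)⟩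
    · exact ⟨u, mem_union_left _ hu, huc⟩
  have hsumA : ∀ j, ∀ T : Finset α, Disjoint T (𝒱.B j) →
      ∑ x ∈ 𝒱.A j, degIn G T x ≤ K * D := by
    intro j T hT
    have e1 := sum_degIn_le_two_mul_edgesBetween (G := G) (𝒱.A j) T
    have e2 := edgesBetween_mono (G := G) (𝒱.A j) (subset_outside hT)
    have e3 := (h.bipartite j).1.edges
    have e4 : (0 : ℝ) ≤ edgesBetween G (𝒱.B j) (outside (𝒱.A j)) := Nat.cast_nonneg _
    have e5 : (∑ x ∈ 𝒱.A j, degIn G T x : ℕ) ≤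
        (2 : ℝ) * edgesBetween G (𝒱.A j) (outside (𝒱.B j)) := by
      exact_mod_cast e1.trans (Nat.mul_le_mul_left 2 e2)
    exact_mod_cast (show ((∑ x ∈ 𝒱.A j, degIn G T x : ℕ) : ℝ) ≤ K * D by linarith)
  have hsumB : ∀ j, ∀ T : Finset α, Disjoint T (𝒱.A j) →
      ∑ x ∈ 𝒱.B j, degIn G T x ≤ K * D := by
    intro j T hT
    have e1 := sum_degIn_le_two_mul_edgesBetween (G := G) (𝒱.B j) T
    have e2 := edgesBetween_mono (G := G) (𝒱.B j) (subset_outside hT)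
    have e3 := (h.bipartite j).1.edges
    have e4 : (0 : ℝ) ≤ edgesBetween G (𝒱.A j) (outside (𝒱.B j)) := Nat.cast_nonneg _
    have e5 : (∑ x ∈ 𝒱.B j, degIn G T x : ℕ) ≤
        (2 : ℝ) * edgesBetween G (𝒱.B j) (outside (𝒱.A j)) := by
      exact_mod_cast e1.trans (Nat.mul_le_mul_left 2 e2)
    exact_mod_cast (show ((∑ x ∈ 𝒱.B j, degIn G T x : ℕ) : ℝ) ≤ K * D by linarith)
  refine ⟨hd₁, hd₂, hd, hcov, ?_, ?_, ?_, h.deg_left 0, h.deg_right 0, h.deg_left 1,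
    h.deg_right 1, hsumA 0 _ hd₁, hsumB 0 _ hd₁.symm, hsumA 1 _ hd₂, hsumB 1 _ hd₂.symm,
    ?_, ?_, ?_, ?_, hK, hKD, ?_⟩
  · intro x
    rw [← degIn_union hd₁, ← degIn_union hd₂, ← degIn_union hd]
    have : 𝒱.A 0 ∪ 𝒱.B 0 ∪ (𝒱.A 1 ∪ 𝒱.B 1) = univ :=
      Finset.eq_univ_of_forall fun x => Finset.mem_union.2 (hcov x)
    rw [this, ← hreg x, ← SimpleGraph.card_neighborFinset_eq_degree]
    unfold degIn
    congr 1
    ext y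
    simp
  · intro x hx
    rw [← degIn_union hd₁, ← degIn_union hd₂]
    exact h.deg_cluster (Sum.inr 0) (Sum.inr 1) x hx
  · intro x hx
    rw [← degIn_union hd₁, ← degIn_union hd₂]
    exact h.deg_cluster (Sum.inr 1) (Sum.inr 0) x hx
  · rw [sum_degIn_comm]; exact hsumA 0 _ d3.symm
  · rw [sum_degIn_comm]; exact hsumA 0 _ d4.symm
  · rw [sum_degIn_comm]; exact hsumB 0 _ d1.symm
  · rw [sum_degIn_comm]; exact hsumB 0 _ d2.symm
  · exact hG.exists_two_edges hcl (hother 0) (hother 1)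

open Classical in
-- The surpluses are bounded by the number of endpoints, hence by 16K, so at most 32K vertices are
-- ever used. Each vertex has at least D/4 ≥ 250K neighbours on the opposite side of its part, so an
-- extension is always available.
theorem BipartitePair.exists_balanced [Fintype α] {D K : ℕ} {A₁ B₁ A₂ B₂ : Finset α}
    (h : BipartitePair G D K A₁ B₁ A₂ B₂) :
    ∃ P : PathSystem G, P.surplus A₁ B₁ = 0 ∧ P.surplus A₂ B₂ = 0 ∧
      P.weight A₁ B₁ = 2 * (#A₁ - #B₁) ∧ P.weight A₂ B₂ = 2 * (#A₂ - #B₂) ∧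
      #P.verts ≤ 32 * K ∧ P.Crosses (A₁ ∪ B₁) := by
  obtain ⟨P, h1, h2, h3, h4⟩ := h.hasWeightedSystem
  have hK := h.K_pos
  have hKD := h.K_le
  have hsur : (P.surplus A₁ B₁).natAbs + (P.surplus A₂ B₂).natAbs ≤ 16 * K := by
    have e : #(A₁ ∩ P.endpoints) + #(B₁ ∩ P.endpoints) +
        (#(A₂ ∩ P.endpoints) + #(B₂ ∩ P.endpoints)) ≤ #P.endpoints := by
      have hi : ∀ {S T : Finset α}, Disjoint S T →
          #(S ∩ P.endpoints) + #(T ∩ P.endpoints) = #((S ∪ T) ∩ P.endpoints) := fun {S T} hST => by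
        rw [Finset.union_inter_distrib_right, Finset.card_union_of_disjoint]
        exact Finset.disjoint_of_subset_left Finset.inter_subset_left
          (Finset.disjoint_of_subset_right Finset.inter_subset_left hST)
      rw [hi h.disjoint_left, hi h.disjoint_right, hi h.disjoint]
      exact Finset.card_le_card Finset.inter_subset_right
    have e' := Finset.card_le_card P.endpoints_subset_verts
    simp only [PathSystem.surplus]
    omega
  obtain ⟨P', q1, q2, q3, q4, q5, q6⟩ := P.exists_balanced (M := 32 * K) h.disjoint_left
    h.disjoint_right h.disjoint
    (fun u hu => by
      have := h.cut_left u (mem_union_left _ hu)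
      have := h.inner_A₁ u hu
      have := h.regular u
      omega)
    (fun u hu => by
      have := h.cut_left u (mem_union_right _ hu)
      have := h.inner_B₁ u hu
      have := h.regular u
      omega)
    (fun u hu => by
      have := h.cut_right u (mem_union_left _ hu)
      have := h.inner_A₂ u hu
      have := h.regular u
      omega)
    (fun u hu => by
      have := h.cut_right u (mem_union_right _ hu)
      have := h.inner_B₂ u hu
      have := h.regular u
      omega)
    (by rw [h1]; exact even_two_mul _) (by rw [h2]; exact even_two_mul _) (by omega) h4
  exact ⟨P', q1, q2, q3.trans h1, q4.trans h2, q5, q6⟩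

open Classical in
theorem isTour_of_balanced [Fintype α] {K : ℕ} {γ : ℝ} {𝒱 : ClusterPartition α 0 2}
    {P : PathSystem G} (hs : ∀ j, P.surplus (𝒱.A j) (𝒱.B j) = 0)
    (hw : ∀ j, P.weight (𝒱.A j) (𝒱.B j) = 2 * (#(𝒱.A j) - #(𝒱.B j)))
    (hK : #P.verts ≤ 32 * K) (hγ : 32 * (K : ℝ) ≤ γ * Fintype.card α)
    (hP : P.Crosses (𝒱.A 0 ∪ 𝒱.B 0)) : IsTour 𝒱 P γ := by
  have hends : ∀ j, #(𝒱.A j ∩ P.endpoints) = #(𝒱.B j ∩ P.endpoints) := fun j => by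
    have := hs j
    simp only [PathSystem.surplus] at this
    omega
  have hcluster : ∀ j, #(𝒱.cluster (Sum.inr j) ∩ P.endpoints) = 2 * #(𝒱.A j ∩ P.endpoints) := by
    intro j
    change #((𝒱.A j ∪ 𝒱.B j) ∩ P.endpoints) = _
    rw [Finset.union_inter_distrib_right, Finset.card_union_of_disjoint, ← hends j]
    · ring
    · exact Finset.disjoint_of_subset_left Finset.inter_subset_left
        (Finset.disjoint_of_subset_right Finset.inter_subset_left (𝒱.disjoint_bipartition j))
  refine ⟨?_, ?_, ?_, hends, ?_⟩
  · refine hasEulerTour_reducedGraph 𝒱 P hP ?_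
    rw [hcluster 0]
    exact even_two_mul _
  · intro X
    refine le_trans ?_ hγ
    exact_mod_cast (Finset.card_le_card Finset.inter_subset_left).trans hK
  · intro j
    have h1 := hs j
    have h2 := hw j
    have h3 := Finset.card_sdiff_add_card_inter (𝒱.A j) P.verts
    have h4 := Finset.card_sdiff_add_card_inter (𝒱.B j) P.verts
    simp only [PathSystem.weight, h1] at h2
    omega
  · intro j
    have hne : (𝒱.cluster (Sum.inr j) ∩ P.endpoints).Nonempty := by
      obtain ⟨i, hi⟩ := hP
      have hf : P.fst i ∈ P.endpoints := PathSystem.mem_endpoints.2 ⟨i, Or.inl rfl⟩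
      have hs : P.snd i ∈ P.endpoints := PathSystem.mem_endpoints.2 ⟨i, Or.inr rfl⟩
      change ¬ (P.fst i ∈ 𝒱.cluster (Sum.inr 0) ↔ P.snd i ∈ 𝒱.cluster (Sum.inr 0)) at hi
      have c1 := 𝒱.not_mem_cluster_iff (P.fst i)
      have c2 := 𝒱.not_mem_cluster_iff (P.snd i)
      by_cases hif : P.fst i ∈ 𝒱.cluster (Sum.inr 0)
      · have his : P.snd i ∉ 𝒱.cluster (Sum.inr 0) := fun h => hi (iff_of_true hif h)
        fin_cases j
        · exact ⟨_, Finset.mem_inter.2 ⟨hif, hf⟩⟩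
        · exact ⟨_, Finset.mem_inter.2 ⟨c2.1 his, hs⟩⟩
      · have his : P.snd i ∈ 𝒱.cluster (Sum.inr 0) := by
          by_contra h
          exact hi (iff_of_false hif h)
        fin_cases j
        · exact ⟨_, Finset.mem_inter.2 ⟨his, hs⟩⟩
        · exact ⟨_, Finset.mem_inter.2 ⟨c1.1 hif, hf⟩⟩
    have := Finset.card_pos.2 hne
    rw [hcluster j] at this
    omega

end RobustPartition

/-- The function `f` spells out the hierarchy `0 < 1/n ≪ ρ ≪ ν ≪ τ ≪ α < 1`. -/
theorem lemma6p1 :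
    ∃ f : ℝ → ℝ, MonotoneOn f (Set.Ioc 0 1) ∧ Set.MapsTo f (Set.Ioc 0 1) (Set.Ioc 0 1) ∧
      ∀ (n D : ℕ) (ρ ν τ α : ℝ),
        0 < n → 0 < ρ → 0 < ν → 0 < τ → 0 < α → α < 1 →
        τ ≤ f α → ν ≤ f τ → ρ ≤ f ν → 1 / (n : ℝ) ≤ f ρ →
        α * n ≤ D →
        ∀ (V : Type*) [Fintype V] (G : SimpleGraph V) [DecidableRel G.Adj],
          Fintype.card V = n →
          RobustPartition.IsKConnected G 3 →
          G.IsRegularOfDegree D →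
          ∀ 𝒱 : RobustPartition.ClusterPartition V 0 2,
            RobustPartition.IsRobustPartition G D ρ ν τ 𝒱 →
            ∃ P : RobustPartition.PathSystem G,
              RobustPartition.IsTour 𝒱 P (ρ ^ (1 / 3 : ℝ)) := by
  -- The cube matches the exponent 1/3 in the parameter: ρ ≤ α³/10⁶ becomes ρ^(1/3) ≤ α/100.
  refine ⟨fun x => x ^ 3 / 10 ^ 6, ?_, ?_, ?_⟩
  · intro x hx y hy hxy
    have : x ^ 3 ≤ y ^ 3 := pow_le_pow_left₀ hx.1.le hxy 3
    change x ^ 3 / 10 ^ 6 ≤ y ^ 3 / 10 ^ 6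
    gcongr
  · intro x hx
    have h0 : 0 < x ^ 3 := pow_pos hx.1 3
    have h1 : x ^ 3 ≤ 1 := pow_le_one₀ hx.1.le hx.2
    change 0 < x ^ 3 / 10 ^ 6 ∧ x ^ 3 / 10 ^ 6 ≤ 1
    constructor
    · positivity
    · linarith [div_le_self h0.le (show (1 : ℝ) ≤ 10 ^ 6 by norm_num)]
  · intro n D ρ ν τ α hn hρ hν hτ hα hα1 h1 h2 h3 h4 hD V _ G _ hcard hG hreg 𝒱 h𝒱
    obtain ⟨K, hK, hKD, hρK, hγ⟩ :=
      RobustPartition.exists_bound hn hρ hν hτ hα hα1 h1 h2 h3 h4 hD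
    rw [← hcard] at hρK hγ
    obtain ⟨P, p1, p2, p3, p4, p5, p6⟩ :=
      (h𝒱.bipartitePair hG hreg hK hKD hρK).exists_balanced
    exact ⟨P, RobustPartition.isTour_of_balanced (Fin.forall_fin_two.2 ⟨p1, p2⟩)
      (Fin.forall_fin_two.2 ⟨p3, p4⟩) p5 hγ p6⟩
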